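/- **Conventions.** $G=(V,E,w)$ is a complete undirected graph on $n\ge 2$ vertices with weights $w:E\to\{1,\dots,L\}$, where $L=\mathrm{poly}(n)$, i.e. $L\le n^{a}$ for some fixed $a\in\mathbb N$. Paths need not be simple; $\mathrm{hop}(P)$ is the number of steps of $P$ and $w(P)=\sum_{e\in E(P)}w(e)$. For real $t\ge 0$, $d_G^{(t)}(u,v)$ is the minimum of $w(P)$ over the paths $P$ in $G$ between $u$ and $v$ with $\mathrm{hop}(P)\le t$ ($\infty$ if there is none). A *partial tree embedding* $(T,\cdot)$ of $G$ is a rooted weighted tree $T=(V(T),E(T),w_T)$ with $V(T)\subseteq V$ together with, for each $e\in E(T)$, a path $T_e^G$ of $G$ between the endpoints of $e$ with $w(T_e^G)\le w_T(e)$. For $u,v\in V(T)$, $d_T(u,v)$ is the distance in $T$, and $T_{uv}^G$ is the concatenation of the paths $T_e^G$ along the simple path from $u$ to $v$ in $T$. For $h\in\mathbb N$, $h\ge1$, it is an *$h$-hop partial tree embedding with distance stretch $\alpha\ge1$ and hop stretch $\beta\ge1$* if for all $u,v\in V(T)$ $$d_G^{(\beta h)}(u,v)\le d_T(u,v)\le\alpha\,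 d_G^{(h)}(u,v)\qquad\text{and}\qquad \mathrm{hop}(T_{uv}^G)\le\beta h .$$ $T$ is *well-separated* if along every root-to-leaf path the edge weights are strictly decreasing powers of $2$. **Theorem.** There is a randomized algorithm (using fair coin flips) which, given such a $G$, an integer $h\ge 1$, a rational $0<\varepsilon<\frac13$ and a vertex $r\in V$, runs in time polynomial in the number of bits of its input and outputs a sample from a distribution $\mathcal D$ over partial tree embeddings of $G$ with the following properties, where the constants hidden in $O(\cdot)$ depend only on $a$. 1. For every $(T,\cdot)$ in the support of $\mathcal D$, the tree $T$ is well-separated and rooted at $r$, and $(T,\cdot)$ is an $h$-hop partial tree embedding with (worst-case) distance stretch $\alpha_{\mathrm{WC}}=O\!\left(\frac{\log^2 n}{\varepsilon}\right)$ and hop stretch $\beta=O\!\left(\frac{\log^3 n}{\varepsilon}\right)$. 2. (Exclusion probability $\varepsilon$.) $\Pr_{(T,\cdot)\sim\mathcal D}[v\in V(T)]\ge1-\varepsilon$ for every $v\in V$. 3. (Expected distance stretch.) For all $u,v\in V$, $\ \mathbb E_{(T,\cdot)\sim\mathcal D}\big[d_T(u,v)\cdot\mathbf 1\{u,v\in V(T)\}\big]\le\alpha_{\mathbb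 E}\cdot d_G^{(h)}(u,v)$ with $\alpha_{\mathbb E}=O\!\left(\log n\cdot\log\frac{\log n}{\varepsilon}\right)$. -/

import Mathlib

open scoped ENNReal

namespace HopEmbed

/-! ### Randomized random-access machines with logarithmic cost

A program is a finite term of an imperative language over natural-number registers and unbounded
natural-number arrays (all cells initially `0`), with fair coin flips.  The same program serves
inputs of every size.  Every operation is charged one unit plus the bit lengths of the numbers it
handles (the logarithmic cost criterion), so that polynomial cost is polynomial time. -/

/-- Binary operations; `sub` is truncated, the comparisons return `1` (true) or `0` (false). -/
inductive BinOp : Type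
  | add | sub | mul | div | mod | lt | eq

/-- The value of a binary operation. -/
def BinOp.eval : BinOp → ℕ → ℕ → ℕ
  | .add, a, b => a + b
  | .sub, a, b => a - b
  | .mul, a, b => a * b
  | .div, a, b => a / b
  | .mod, a, b => a % b
  | .lt, a, b => if a < b then 1 else 0
  | .eq, a, b => if a = b then 1 else 0

/-- Expressions: numerals, registers, array cells, and binary operations. -/
inductive Expr : Type
  | const (k : ℕ)
  | var (x : ℕ)
  | load (a : ℕ) (idx : Expr)
  | bin (op : BinOp) (e₁ e₂ : Expr)

/-- A machine state: the registers, the arrays, and the coins that have not been flipped yet. -/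
structure State : Type where
  vars : ℕ → ℕ
  arrs : ℕ → ℕ → ℕ
  coins : ℕ → Bool

/-- The value of an expression. -/
def Expr.eval (s : State) : Expr → ℕ
  | .const k => k
  | .var x => s.vars x
  | .load a i => s.arrs a (i.eval s)
  | .bin op e₁ e₂ => op.eval (e₁.eval s) (e₂.eval s)

/-- The logarithmic cost of evaluating an expression: each node costs one plus the bit length of
its value.  (An address is the value of the index expression, so its length is charged there.) -/
def Expr.cost (s : State) : Expr → ℕ
  | .const k => 1 + k.size
  | .var x => 1 + (s.vars x).size
  | .load a i => i.cost s + 1 + (s.arrs a (i.eval s)).size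
  | .bin op e₁ e₂ => e₁.cost s + e₂.cost s + 1 + (op.eval (e₁.eval s) (e₂.eval s)).size

/-- Programs. -/
inductive Cmd : Type
  | skip
  | assign (x : ℕ) (e : Expr)
  | store (a : ℕ) (idx e : Expr)
  | flip (x : ℕ)
  | seq (c₁ c₂ : Cmd)
  | cond (e : Expr) (c₁ c₂ : Cmd)
  | loop (e : Expr) (c : Cmd)

/-- Write `k` into register `x`. -/
def State.assign (s : State) (x k : ℕ) : State :=
  { s with vars := Function.update s.vars x k }

/-- Write `k` into cell `i` of array `a`. -/
def State.store (s : State) (a i k : ℕ) : State :=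
  { s with arrs := Function.update s.arrs a (Function.update (s.arrs a) i k) }

/-- Flip the next coin and write the outcome (`0` or `1`) into register `x`. -/
def State.flip (s : State) (x : ℕ) : State :=
  { s with
    vars := Function.update s.vars x (s.coins 0).toNat
    coins := fun i => s.coins (i + 1) }

/-- `Exec c s s' t`: started in state `s`, the program `c` halts in state `s'` after `t` steps.
A test is passed when its value is nonzero; `loop e c` is "while `e` do `c`". -/
inductive Exec : Cmd → State → State → ℕ → Prop
  | skip (s : State) : Exec .skip s s 1
  | assign (s : State) (x : ℕ) (e : Expr) :
      Exec (.assign x e) s (s.assign x (e.eval s)) (e.cost s + 1)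
  | store (s : State) (a : ℕ) (i e : Expr) :
      Exec (.store a i e) s (s.store a (i.eval s) (e.eval s)) (i.cost s + e.cost s + 1)
  | flip (s : State) (x : ℕ) : Exec (.flip x) s (s.flip x) 1
  | seq {c₁ c₂ : Cmd} {s s₁ s₂ : State} {t₁ t₂ : ℕ} :
      Exec c₁ s s₁ t₁ → Exec c₂ s₁ s₂ t₂ → Exec (.seq c₁ c₂) s s₂ (t₁ + t₂)
  | cond_true {e : Expr} {c₁ c₂ : Cmd} {s s' : State} {t : ℕ} :
      e.eval s ≠ 0 → Exec c₁ s s' t → Exec (.cond e c₁ c₂) s s' (e.cost s + 1 + t)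
  | cond_false {e : Expr} {c₁ c₂ : Cmd} {s s' : State} {t : ℕ} :
      e.eval s = 0 → Exec c₂ s s' t → Exec (.cond e c₁ c₂) s s' (e.cost s + 1 + t)
  | loop_stop {e : Expr} {c : Cmd} {s : State} :
      e.eval s = 0 → Exec (.loop e c) s s (e.cost s + 1)
  | loop_step {e : Expr} {c : Cmd} {s s₁ s₂ : State} {t₁ t₂ : ℕ} :
      e.eval s ≠ 0 → Exec c s s₁ t₁ → Exec (.loop e c) s₁ s₂ t₂ →
      Exec (.loop e c) s s₂ (e.cost s + 1 + t₁ + t₂)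

/-! ### Weighted graphs, path weights, hop-constrained distances -/

/-- A complete weighted graph on the vertex set `Fin n` with weights in `{1, 2, …}`.  Edges are the
non-diagonal elements of `Sym2 (Fin n)`; the values of `w` on the diagonal are never used. -/
structure WGraph (n : ℕ) : Type where
  w : Sym2 (Fin n) → ℕ
  one_le : ∀ e : Sym2 (Fin n), ¬ e.IsDiag → 1 ≤ w e

/-- The weight of a (not necessarily simple) path: the sum of the weights over its set of edges. -/
def pathWeight {n : ℕ} {H : SimpleGraph (Fin n)} (w : Sym2 (Fin n) → ℕ) {u v : Fin n}
    (p : H.Walk u v) : ℕ :=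
  ∑ e ∈ p.edges.toFinset, w e

/-- The hop-constrained distance `d_G^{(t)}(u, v)`: the least weight of a path between `u` and `v`
with at most `t` hops (`∞` if there is none). -/
noncomputable def WGraph.hopDist {n : ℕ} (G : WGraph n) (t : ℝ) (u v : Fin n) : ℝ≥0∞ :=
  ⨅ (p : (⊤ : SimpleGraph (Fin n)).Walk u v) (_ : (p.length : ℝ) ≤ t),
    ((pathWeight G.w p : ℕ) : ℝ≥0∞)

/-! ### Partial tree embeddings -/

/-- A partial tree embedding on `G`: a rooted weighted tree `T` with `V(T) ⊆ V(G)` together with,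
for every edge of `T`, a path of `G` between its endpoints whose weight is at most the weight of the
edge.  (The path belongs to the undirected edge: in the other direction it is reversed.)
The values of `wt` outside the edge set are never used.  All edge weights are natural numbers:
they will be powers of two, and they are at least the weight, hence at least `1`, of a path
of `G` between distinct vertices. -/
structure PartialTreeEmbedding {n : ℕ} (G : WGraph n) : Type where
  tree : (⊤ : SimpleGraph (Fin n)).Subgraph
  isTree : tree.coe.IsTree
  root : Fin n
  root_mem : root ∈ tree.verts
  wt : Sym2 (Fin n) → ℕ
  path : ∀ {u v : Fin n}, tree.Adj u v → (⊤ : SimpleGraph (Fin n)).Walk u v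
  path_symm : ∀ {u v : Fin n} (e : tree.Adj u v), path e.symm = (path e).reverse
  path_weight_le : ∀ {u v : Fin n} (e : tree.Adj u v), pathWeight G.w (path e) ≤ wt s(u, v)

namespace PartialTreeEmbedding

variable {n : ℕ} {G : WGraph n}

/-- The vertex set `V(T)`. -/
def verts (T : PartialTreeEmbedding G) : Set (Fin n) := T.tree.verts

/-- The edges of the tree, as a graph on all of `V(G)`. -/
def graph (T : PartialTreeEmbedding G) : SimpleGraph (Fin n) := T.tree.spanningCoe

/-- The shortest-path distance `d_T(u, v)` in the tree. -/
noncomputable def dist (T : PartialTreeEmbedding G) (u v : Fin n) : ℝ≥0∞ :=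
  ⨅ p : T.graph.Walk u v, ((pathWeight T.wt p : ℕ) : ℝ≥0∞)

/-- The path of `G` obtained from a path of `T` by concatenating the paths of its edges. -/
def toG (T : PartialTreeEmbedding G) : {u v : Fin n} → T.graph.Walk u v →
    (⊤ : SimpleGraph (Fin n)).Walk u v
  | _, _, .nil => .nil
  | _, _, .cons e p => (T.path (show T.tree.Adj _ _ from e)).append (T.toG p)

/-- Along every simple path of the tree that starts at the root, the edge weights are strictly
decreasing powers of two. -/
def WellSeparated (T : PartialTreeEmbedding G) : Prop :=
  ∀ (v : Fin n) (p : T.graph.Walk T.root v), p.IsPath →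
    (∀ e ∈ p.edges, ∃ k : ℕ, T.wt e = 2 ^ k) ∧ (p.edges.map T.wt).Pairwise (fun a b => b < a)

/-- `h`-hop partial tree embedding with distance stretch `α` and hop stretch `β`. -/
structure IsHop (T : PartialTreeEmbedding G) (h : ℕ) (α β : ℝ) : Prop where
  one_le_dist_stretch : 1 ≤ α
  one_le_hop_stretch : 1 ≤ β
  le_dist : ∀ u ∈ T.verts, ∀ v ∈ T.verts, G.hopDist (β * h) u v ≤ T.dist u v
  dist_le : ∀ u ∈ T.verts, ∀ v ∈ T.verts, T.dist u v ≤ ENNReal.ofReal α * G.hopDist h u v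
  hop_le : ∀ u ∈ T.verts, ∀ v ∈ T.verts, ∀ p : T.graph.Walk u v, p.IsPath →
    ((T.toG p).length : ℝ) ≤ β * h

end PartialTreeEmbedding

/-! ### Distributions over partial tree embeddings -/

/-- Exclusion probability (at most) `ε`: every vertex is in the tree with probability at least
`1 - ε`. -/
def HasExclusionProb {n : ℕ} {G : WGraph n} (D : PMF (PartialTreeEmbedding G)) (ε : ℝ) : Prop :=
  ∀ v : Fin n, ENNReal.ofReal (1 - ε) ≤ D.toOuterMeasure {T | v ∈ T.verts}

open Classical in
/-- The induced distance `d_D(u, v)`: the expectation of `d_T(u, v)` times the indicator of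
`u, v ∈ V(T)`. -/
noncomputable def inducedDist {n : ℕ} {G : WGraph n} (D : PMF (PartialTreeEmbedding G))
    (u v : Fin n) : ℝ≥0∞ :=
  ∑' T, D T * (if u ∈ T.verts ∧ v ∈ T.verts then T.dist u v else 0)

/-- Expected distance stretch (at most) `α`. -/
def HasExpectedStretch {n : ℕ} {G : WGraph n} (D : PMF (PartialTreeEmbedding G)) (h : ℕ)
    (α : ℝ) : Prop :=
  ∀ u v : Fin n, inducedDist D u v ≤ ENNReal.ofReal α * G.hopDist h u v

/-! ### Inputs, outputs, and sampling -/

/-- An input of the sampling problem. -/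
structure Input (n : ℕ) : Type where
  G : WGraph n
  h : ℕ
  ε : ℚ
  r : Fin n

/-- The entry `(i, j)` of the weight matrix of `G`, with zeros on the diagonal. -/
def WGraph.entry {n : ℕ} (G : WGraph n) (i j : Fin n) : ℕ := if i = j then 0 else G.w s(i, j)

/-- The number of bits of the input, all numbers being written in binary. -/
def Input.size {n : ℕ} (I : Input n) : ℕ :=
  n.size + I.h.size + I.ε.num.toNat.size + I.ε.den.size + (I.r : ℕ).size
    + ∑ i : Fin n, ∑ j : Fin n, (1 + (I.G.entry i j).size)

/-- The initial state for the given input and coins.  Registers `0`, …, `4` hold `n`, `h`, the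
numerator and the denominator of `ε`, and `r`; array `0` holds the weight matrix, row by row. -/
def Input.start {n : ℕ} (I : Input n) (coins : ℕ → Bool) : State where
  vars
    | 0 => n
    | 1 => I.h
    | 2 => I.ε.num.toNat
    | 3 => I.ε.den
    | 4 => I.r
    | _ => 0
  arrs
    | 0 => fun k => if hk : k < n * n then
        I.G.entry ⟨k / n, Nat.div_lt_of_lt_mul hk⟩
          ⟨k % n, Nat.mod_lt _ (Nat.pos_of_ne_zero fun h0 => by simp [h0] at hk)⟩ else 0
    | _ => fun _ => 0
  coins := coins

/-- The state `s` contains the partial tree embedding `T` as output.  Register `0` holds the root;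
array `1` the indicator of `V(T)`; array `2` the adjacency matrix of `T`, row by row; at the matrix
position of an edge, array `3` holds its weight, array `4` the number of hops of its path in `G`, and
array `5` the position in array `6` from which on the vertices of that path are listed. -/
structure Outputs {n : ℕ} {G : WGraph n} (s : State) (T : PartialTreeEmbedding G) : Prop where
  root : s.vars 0 = T.root
  verts : ∀ v : Fin n, v ∈ T.verts ↔ s.arrs 1 v = 1
  adj : ∀ u v : Fin n, T.tree.Adj u v ↔ s.arrs 2 (u * n + v) = 1
  wt : ∀ u v : Fin n, T.tree.Adj u v → s.arrs 3 (u * n + v) = T.wt s(u, v)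
  length : ∀ (u v : Fin n) (e : T.tree.Adj u v), s.arrs 4 (u * n + v) = (T.path e).length
  path : ∀ (u v : Fin n) (e : T.tree.Adj u v), ∀ i ≤ (T.path e).length,
    s.arrs 6 (s.arrs 5 (u * n + v) + i) = (T.path e).getVert i

/-- The infinite coin sequence that starts with the given `B` coins. -/
def coinTape {B : ℕ} (ρ : Fin B → Bool) : ℕ → Bool :=
  fun i => if hi : i < B then ρ ⟨i, hi⟩ else false

/-- On input `I`, the program `c` samples from the distribution `D` within `B` steps: for every
outcome of `B` independent fair coins (more cannot be flipped in `B` steps) it halts after at most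
`B` steps, and its random output has distribution `D`. -/
def SamplesWithin {n : ℕ} (c : Cmd) (I : Input n) (B : ℕ) (D : PMF (PartialTreeEmbedding I.G)) :
    Prop :=
  ∃ f : (Fin B → Bool) → PartialTreeEmbedding I.G,
    (∀ ρ : Fin B → Bool, ∃ (s : State) (t : ℕ),
      Exec c (I.start (coinTape ρ)) s t ∧ t ≤ B ∧ Outputs s (f ρ)) ∧
    D = (PMF.uniformOfFintype (Fin B → Bool)).map f

end HopEmbed

namespace HopEmbed

/-! ### Structured programs with bounded loops -/

/-! The hop constraint is absorbed into a family of ordinary metrics. At level `l` a step of weight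
`w` is charged `2 ^ (expo + l) * w + 2 ^ levels`. The charge per hop is the same at all levels,
while the weight that fits into a given length halves from one level to the next. A short walk for
`lvlDist` therefore has few hops and small weight at once.

At each level the vertices are partitioned by carving balls, first around the root and then around
every vertex, with independent random radii between `2 ^ ucoins` and `2 ^ (ucoins + mu)`. Two
vertices of one cluster are joined through its center by a walk with at most `2 ^ expo` hops and
weight at most `2 ^ (levels - l)` (`weight_le_of_mixLen_le`). A vertex is discarded when at some
level its neighbourhood of radius `width` is cut. If `u` and `v` survive and are joined by a walk
with at most `hops`, the minimum of `h` and `n`, steps and weight `d`, then they can only be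
separated at levels with `hops * 2 ^ (levels - l) < 2 ^ expo * d` (`lt_of_common_lt'`, from
`carve_eq_carve`). This bounds the tree distance by `8 * 2 ^ lgStretch * d`. The factor `2 ^
lgStretch` is of order `log² n / ε`: one logarithm is the number of levels, paid in a union bound,
and the other is the ratio of the largest to the smallest radius.

The radius is a uniform number plus a truncated geometric multiple of the length of the uniform
range, so its hazard rate is bounded (`coinProb_tapeRadius_eq_le`). Consequently the first ball that
reaches an interval of length `ρ` ends inside it with probability at most `2 * ρ / 2 ^ ucoins`,
however many balls there are (`coinProb_cut_le`, `coinProb_level_le`). With `ρ = 2 * width` and a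
union bound over the levels this is the exclusion probability (`coinProb_not_alive_le`). With `ρ`
the length of a shortest walk it bounds the probability of separation. For a pair at distance `d`
only `lgStretch` many scales lie between `d` and the worst case, and each contributes `O(2 ^ mu *
d)` to the expectation (`coinAvg_cost_le`), whence `log n * log (log n / ε)`.

The number of coarsest levels shared by two vertices defines an ultrametric. Every surviving vertex
is joined to the closest surviving vertex of smaller rank, with ties broken by rank. This gives a
tree on the survivors themselves, without extra vertices, whose edge weights strictly increase
towards the root (`ex_par_par_lt`). Tree distances are then geometric sums (`TreeData.dist_le`), and
tree paths have at most `2 * (levels + 1)` edges, which yields the hop stretch.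

The algorithm is an explicit program. Its correctness is proved with an invariant rule for bounded
loops (`forLt_rule`), and its running time with a syntactic criterion under which bit lengths grow
only additively (`exec_compile`, `exists_time`). -/

instance : Add Expr := ⟨.bin .add⟩
instance : Sub Expr := ⟨.bin .sub⟩
instance : Mul Expr := ⟨.bin .mul⟩
instance : Div Expr := ⟨.bin .div⟩
instance : Mod Expr := ⟨.bin .mod⟩

@[simp] theorem Expr.eval_const (s : State) (k : ℕ) : (Expr.const k).eval s = k := rfl
@[simp] theorem Expr.eval_var (s : State) (x : ℕ) : (Expr.var x).eval s = s.vars x := rfl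
@[simp] theorem Expr.eval_load (s : State) (a : ℕ) (i : Expr) :
    (Expr.load a i).eval s = s.arrs a (i.eval s) := rfl
@[simp] theorem Expr.eval_add (s : State) (e f : Expr) : (e + f).eval s = e.eval s + f.eval s := rfl
@[simp] theorem Expr.eval_sub (s : State) (e f : Expr) : (e - f).eval s = e.eval s - f.eval s := rfl
@[simp] theorem Expr.eval_mul (s : State) (e f : Expr) : (e * f).eval s = e.eval s * f.eval s := rfl
@[simp] theorem Expr.eval_div (s : State) (e f : Expr) : (e / f).eval s = e.eval s / f.eval s := rfl
@[simp] theorem Expr.eval_mod (s : State) (e f : Expr) : (e % f).eval s = e.eval s % f.eval s := rfl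
@[simp] theorem Expr.eval_lt (s : State) (e f : Expr) :
    (Expr.bin .lt e f).eval s = if e.eval s < f.eval s then 1 else 0 := rfl
@[simp] theorem Expr.eval_eq (s : State) (e f : Expr) :
    (Expr.bin .eq e f).eval s = if e.eval s = f.eval s then 1 else 0 := rfl

@[simp] theorem State.assign_vars (s : State) (x k z : ℕ) :
    (s.assign x k).vars z = if z = x then k else s.vars z := by
  simp [State.assign, Function.update_apply]
@[simp] theorem State.assign_arrs (s : State) (x k : ℕ) : (s.assign x k).arrs = s.arrs := rfl
@[simp] theorem State.assign_coins (s : State) (x k : ℕ) : (s.assign x k).coins = s.coins := rfl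
@[simp] theorem State.store_vars (s : State) (a i k : ℕ) : (s.store a i k).vars = s.vars := rfl
@[simp] theorem State.store_arrs (s : State) (a i k b j : ℕ) :
    (s.store a i k).arrs b j = if b = a ∧ j = i then k else s.arrs b j := by
  by_cases h : b = a
  · subst h; simp [State.store, Function.update_apply]
  · simp [State.store, h]
@[simp] theorem State.store_coins (s : State) (a i k : ℕ) : (s.store a i k).coins = s.coins := rfl
@[simp] theorem State.flip_vars (s : State) (x z : ℕ) :
    (s.flip x).vars z = if z = x then (s.coins 0).toNat else s.vars z := by
  simp [State.flip, Function.update_apply]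
@[simp] theorem State.flip_arrs (s : State) (x : ℕ) : (s.flip x).arrs = s.arrs := rfl
@[simp] theorem State.flip_coins (s : State) (x : ℕ) :
    (s.flip x).coins = fun i => s.coins (i + 1) := rfl

/-- Structured programs: `forLt x y p` runs `p` with `x = 0, …, y - 1`, and `clog k p y` computes
`k = ⌈log₂ y⌉` and `p = 2 ^ k`. -/
inductive Prog : Type
  | assign (x : ℕ) (e : Expr)
  | store (a : ℕ) (i e : Expr)
  | flip (x : ℕ)
  | seq (p q : Prog)
  | cond (e : Expr) (p q : Prog)
  | forLt (x y : ℕ) (p : Prog)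
  | clog (k p y : ℕ)
  | skip

namespace Prog

/-- Sequential composition of a list of programs. -/
def block : List Prog → Prog
  | [] => skip
  | [p] => p
  | p :: q :: l => seq p (block (q :: l))

/-- The machine program of a structured program. -/
def compile : Prog → Cmd
  | assign x e => .assign x e
  | store a i e => .store a i e
  | flip x => .flip x
  | seq p q => .seq p.compile q.compile
  | cond e p q => .cond e p.compile q.compile
  | forLt x y p => .seq (.assign x (.const 0)) (.loop (.bin .lt (.var x) (.var y))
      (.seq p.compile (.assign x (.var x + .const 1))))
  | clog k p y => .seq (.seq (.assign k (.const 0)) (.assign p (.const 1)))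
      (.loop (.bin .lt (.var p) (.var y))
        (.seq (.assign p (.var p + .var p)) (.assign k (.var k + .const 1))))
  | skip => .skip

/-- The final state of a structured program. -/
def run : Prog → State → State
  | assign x e, s => s.assign x (e.eval s)
  | store a i e, s => s.store a (i.eval s) (e.eval s)
  | flip x, s => s.flip x
  | seq p q, s => q.run (p.run s)
  | cond e p q, s => if e.eval s ≠ 0 then p.run s else q.run s
  | forLt x y p, s =>
      (fun s' => (p.run s').assign x (s'.vars x + 1))^[s.vars y] (s.assign x 0)
  | clog k p y, s =>
      (fun s' => (s'.assign p (s'.vars p + s'.vars p)).assign k (s'.vars k + 1))^[Nat.clog 2 (s.vars y)]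
        ((s.assign k 0).assign p 1)
  | skip, s => s

/-- The registers that a program may write. -/
def wv : Prog → List ℕ
  | assign x _ => [x]
  | store _ _ _ => []
  | flip x => [x]
  | seq p q => p.wv ++ q.wv
  | cond _ p q => p.wv ++ q.wv
  | forLt x _ p => x :: p.wv
  | clog k p _ => [k, p]
  | skip => []

/-- The arrays that a program may write. -/
def wa : Prog → List ℕ
  | store a _ _ => [a]
  | seq p q => p.wa ++ q.wa
  | cond _ p q => p.wa ++ q.wa
  | forLt _ _ p => p.wa
  | _ => []

/-- Whether a program flips no coins. -/
def noFlip : Prog → Bool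
  | flip _ => false
  | seq p q => p.noFlip && q.noFlip
  | cond _ p q => p.noFlip && q.noFlip
  | forLt _ _ p => p.noFlip
  | _ => true

/-- The registers that hold the loop bounds. -/
def bnds : Prog → List ℕ
  | seq p q => p.bnds ++ q.bnds
  | cond _ p q => p.bnds ++ q.bnds
  | forLt _ y p => y :: p.bnds
  | _ => []

end Prog

/-! ### Growth of bit lengths and cost of expressions. -/

/-- Evaluating the expression increases bit lengths additively: products are only formed with
register `0` or with entries of array `0`. -/
def Expr.additive : Expr → Bool
  | .bin .mul e (.var 0) => e.additive
  | .bin .mul e (.load 0 _) => e.additive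
  | .bin .mul _ _ => false
  | .bin .add e f => e.additive && f.additive
  | .bin .sub e _ => e.additive
  | .bin .div e _ => e.additive
  | .bin .mod e _ => e.additive
  | _ => true

/-- The increase of the bit length, up to a factor. -/
def Expr.growth : Expr → ℕ
  | .const k => k.size
  | .bin .add e f => e.growth + f.growth + 1
  | .bin .lt _ _ => 1
  | .bin .eq _ _ => 1
  | .bin _ e _ => e.growth + 1
  | _ => 0

/-- The bit length of the value, up to a factor. -/
def Expr.wt : Expr → ℕ
  | .const k => k.size
  | .var _ => 1
  | .load _ _ => 1
  | .bin _ e f => e.wt + f.wt + 1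

/-- The cost of the evaluation, up to a factor. -/
def Expr.kc : Expr → ℕ
  | .const k => 1 + k.size
  | .var _ => 2
  | .load _ i => i.kc + 2
  | .bin _ e f => e.kc + f.kc + 1 + (e.wt + f.wt + 1)

/-- All registers and array cells are less than `2 ^ B`. -/
def State.Bdd (s : State) (B : ℕ) : Prop :=
  (∀ x, s.vars x < 2 ^ B) ∧ ∀ a i, s.arrs a i < 2 ^ B

theorem State.Bdd.mono {s : State} {B C : ℕ} (h : s.Bdd B) (hBC : B ≤ C) : s.Bdd C :=
  ⟨fun x => (h.1 x).trans_le (Nat.pow_le_pow_right two_pos hBC),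
    fun a i => (h.2 a i).trans_le (Nat.pow_le_pow_right two_pos hBC)⟩

theorem State.Bdd.assign {s : State} {B x k : ℕ} (h : s.Bdd B) (hk : k < 2 ^ B) :
    (s.assign x k).Bdd B :=
  ⟨fun z => by rw [State.assign_vars]; split_ifs; exacts [hk, h.1 z], h.2⟩

theorem State.Bdd.store {s : State} {B a i k : ℕ} (h : s.Bdd B) (hk : k < 2 ^ B) :
    (s.store a i k).Bdd B :=
  ⟨h.1, fun b j => by rw [State.store_arrs]; split_ifs; exacts [hk, h.2 b j]⟩

/-- Iterated squaring would make bit lengths exponential. Here the second factor of each stored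
product is read-only input of at most `c` bits, so each node adds `O(c)` bits. The bound `c` is kept
apart from `B` because `B` increases during a run and `c` does not. -/
theorem Expr.eval_lt_growth {s : State} {B c : ℕ} (hs : s.Bdd B) (hc : 1 ≤ c)
    (h0 : s.vars 0 < 2 ^ c) (ha : ∀ i, s.arrs 0 i < 2 ^ c) :
    ∀ e : Expr, e.additive = true → e.eval s < 2 ^ (B + e.growth * c) := by
  have hmono : ∀ {x y : ℕ} (g : ℕ), x < 2 ^ (B + g * c) → g ≤ y → x < 2 ^ (B + y * c) :=
    fun g h hg => h.trans_le (Nat.pow_le_pow_right two_pos (by gcongr))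
  have hbit : ∀ {x g : ℕ}, x < 2 → x < 2 ^ (B + (g + 1) * c) := by
    intro x g hx
    refine hx.trans_le ?_
    calc 2 = 2 ^ 1 := rfl
      _ ≤ _ := Nat.pow_le_pow_right two_pos (by nlinarith)
  have hmul : ∀ {x y g : ℕ}, x < 2 ^ (B + g * c) → y < 2 ^ c → x * y < 2 ^ (B + (g + 1) * c) := by
    intro x y g hx hy
    rw [add_mul, one_mul, ← add_assoc, pow_add 2 (B + g * c)]
    exact Nat.mul_lt_mul'' hx hy
  intro e
  induction e with
  | const k =>
    intro _
    refine (Nat.lt_size_self k).trans_le (Nat.pow_le_pow_right two_pos ?_)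
    simp only [Expr.growth]; nlinarith
  | var x => intro _; simpa [Expr.growth] using hs.1 x
  | load a i _ => intro _; simpa [Expr.growth] using hs.2 a _
  | bin op e f ihe ihf =>
    intro h
    cases op with
    | add =>
      simp only [Expr.additive, Bool.and_eq_true] at h
      have h1 := hmono (y := e.growth + f.growth) _ (ihe h.1) (by omega)
      have h2 := hmono (y := e.growth + f.growth) _ (ihf h.2) (by omega)
      simp only [Expr.eval, BinOp.eval, Expr.growth]
      calc e.eval s + f.eval s < 2 ^ (B + (e.growth + f.growth) * c + 1) := by
            rw [pow_succ]; omega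
        _ ≤ _ := Nat.pow_le_pow_right two_pos (by nlinarith)
    | sub => exact hmono _ ((Nat.sub_le _ _).trans_lt (ihe h)) (Nat.le_succ _)
    | div => exact hmono _ ((Nat.div_le_self _ _).trans_lt (ihe h)) (Nat.le_succ _)
    | mod => exact hmono _ ((Nat.mod_le _ _).trans_lt (ihe h)) (Nat.le_succ _)
    | lt =>
      exact hbit (g := 0) (by simp only [Expr.eval, BinOp.eval]; split_ifs <;> simp)
    | eq =>
      exact hbit (g := 0) (by simp only [Expr.eval, BinOp.eval]; split_ifs <;> simp)
    | mul =>
      cases f with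
      | const k => simp [Expr.additive] at h
      | bin _ _ _ => simp [Expr.additive] at h
      | var x =>
        cases x with
        | zero => exact hmul (ihe (by simpa [Expr.additive] using h)) h0
        | succ x => simp [Expr.additive] at h
      | load a i =>
        cases a with
        | zero => exact hmul (ihe (by simpa [Expr.additive] using h)) (ha _)
        | succ x => simp [Expr.additive] at h

/-- For the cost, multiplicative growth is harmless, since an intermediate value is not fed back
into the state. No condition on products is needed here. -/
theorem Expr.eval_lt_wt {s : State} {B : ℕ} (hs : s.Bdd B) (hB : 1 ≤ B) (e : Expr) :
    e.eval s < 2 ^ (e.wt * B) := by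
  have hmono : ∀ {x y : ℕ} (g : ℕ), x < 2 ^ (g * B) → g ≤ y → x < 2 ^ (y * B) :=
    fun g h hg => h.trans_le (Nat.pow_le_pow_right two_pos (by gcongr))
  have hbit : ∀ {x g : ℕ}, x < 2 → x < 2 ^ ((g + 1) * B) := by
    intro x g hx
    refine hx.trans_le ?_
    calc 2 = 2 ^ 1 := rfl
      _ ≤ _ := Nat.pow_le_pow_right two_pos (by nlinarith)
  induction e with
  | const k =>
    exact (Nat.lt_size_self k).trans_le
      (Nat.pow_le_pow_right two_pos (by simp only [Expr.wt]; nlinarith))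
  | var x => simpa [Expr.wt] using hs.1 x
  | load a i _ => simpa [Expr.wt] using hs.2 a _
  | bin op e f ihe ihf =>
    cases op with
    | add =>
      have h1 := hmono (y := e.wt + f.wt) _ ihe (by omega)
      have h2 := hmono (y := e.wt + f.wt) _ ihf (by omega)
      simp only [Expr.eval, BinOp.eval, Expr.wt]
      calc e.eval s + f.eval s < 2 ^ ((e.wt + f.wt) * B + 1) := by
            rw [pow_succ]; omega
        _ ≤ _ := Nat.pow_le_pow_right two_pos (by nlinarith)
    | sub => exact hmono _ ((Nat.sub_le _ _).trans_lt ihe) (by simp only [Expr.wt]; omega)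
    | div => exact hmono _ ((Nat.div_le_self _ _).trans_lt ihe) (by simp only [Expr.wt]; omega)
    | mod => exact hmono _ ((Nat.mod_le _ _).trans_lt ihe) (by simp only [Expr.wt]; omega)
    | lt => exact hbit (by simp only [Expr.eval, BinOp.eval]; split_ifs <;> simp)
    | eq => exact hbit (by simp only [Expr.eval, BinOp.eval]; split_ifs <;> simp)
    | mul =>
      refine hmono (e.wt + f.wt) ?_ (by simp only [Expr.wt]; omega)
      rw [add_mul, pow_add]
      exact Nat.mul_lt_mul'' ihe ihf

theorem Expr.cost_le {s : State} {B : ℕ} (hs : s.Bdd B) (hB : 1 ≤ B) (e : Expr) :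
    e.cost s ≤ e.kc * B := by
  induction e with
  | const k => simp only [Expr.cost, Expr.kc]; nlinarith
  | var x =>
    have := Nat.size_le.2 (hs.1 x)
    simp only [Expr.cost, Expr.kc]; omega
  | load a i ih =>
    have := Nat.size_le.2 (hs.2 a (i.eval s))
    simp only [Expr.cost, Expr.kc]; nlinarith
  | bin op e f ihe ihf =>
    have := Nat.size_le.2 (Expr.eval_lt_wt hs hB (.bin op e f))
    simp only [Expr.eval, Expr.wt] at this
    simp only [Expr.cost, Expr.kc]; nlinarith

/-! ### Frames, loop invariants and running time of structured programs. -/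

namespace Prog

/-- The conditions under which the bit lengths grow additively and the loops are bounded. -/
def ok : Prog → Bool
  | assign x e => x != 0 && e.additive
  | store a _ e => a != 0 && e.additive
  | flip x => x != 0
  | seq p q => p.ok && q.ok
  | cond _ p q => p.ok && q.ok
  | forLt x y p => x != 0 && x != y && !(p.wv.contains x) && !(p.wv.contains y) && p.ok
  | clog k p y => k != 0 && p != 0 && k != p && p != y && k != y
  | skip => true

/-- `s'` agrees with `s` on everything that `p` does not write. -/
structure Frame (p : Prog) (s s' : State) : Prop where
  vars : ∀ z, z ∉ p.wv → s'.vars z = s.vars z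
  arrs : ∀ a, a ∉ p.wa → s'.arrs a = s.arrs a
  coins : p.noFlip = true → s'.coins = s.coins

/-- The sets `wv` and `wa` are computed from the syntax, so that a later claim that some phase
leaves a register or array alone is settled by `decide`. -/
theorem frame (p : Prog) : ∀ s, p.Frame s (p.run s) := by
  induction p with
  | assign x e => exact fun s => ⟨fun z hz => by simp_all [wv, run], by simp [run], by simp [run]⟩
  | store a i e =>
    exact fun s => ⟨by simp [run], fun b hb => by
      have : b ≠ a := by simpa [wa] using hb
      funext j; simp [run, this], by simp [run]⟩
  | flip x => exact fun s => ⟨fun z hz => by simp_all [wv, run], by simp [run], by simp [noFlip]⟩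
  | seq p q ihp ihq =>
    intro s
    refine ⟨fun z hz => ?_, fun a ha => ?_, fun h => ?_⟩
    · simp only [wv, List.mem_append, not_or] at hz
      exact ((ihq _).vars z hz.2).trans ((ihp s).vars z hz.1)
    · simp only [wa, List.mem_append, not_or] at ha
      exact ((ihq _).arrs a ha.2).trans ((ihp s).arrs a ha.1)
    · simp only [noFlip, Bool.and_eq_true] at h
      exact ((ihq _).coins h.2).trans ((ihp s).coins h.1)
  | cond e p q ihp ihq =>
    intro s
    refine ⟨fun z hz => ?_, fun a ha => ?_, fun h => ?_⟩
    · simp only [wv, List.mem_append, not_or] at hz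
      simp only [run]; split_ifs
      exacts [(ihp s).vars z hz.1, (ihq s).vars z hz.2]
    · simp only [wa, List.mem_append, not_or] at ha
      simp only [run]; split_ifs
      exacts [(ihp s).arrs a ha.1, (ihq s).arrs a ha.2]
    · simp only [noFlip, Bool.and_eq_true] at h
      simp only [run]; split_ifs
      exacts [(ihp s).coins h.1, (ihq s).coins h.2]
  | forLt x y p ih =>
    intro s
    simp only [run]
    generalize s.vars y = N
    induction N with
    | zero => exact ⟨fun z hz => by simp_all [wv], by simp, by simp⟩
    | succ N iN =>
      rw [Function.iterate_succ_apply']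
      refine ⟨fun z hz => ?_, fun a ha => ?_, fun h => ?_⟩
      · rw [← iN.vars z hz]
        simp only [wv, List.mem_cons, not_or] at hz
        simp only [State.assign_vars, hz.1, if_false]
        exact (ih _).vars z hz.2
      · rw [← iN.arrs a ha]
        exact (ih _).arrs a ha
      · rw [← iN.coins h]
        exact (ih _).coins h
  | clog k p y =>
    intro s
    simp only [run]
    generalize Nat.clog 2 (s.vars y) = N
    induction N with
    | zero => exact ⟨fun z hz => by simp_all [wv], by simp, by simp⟩
    | succ N iN =>
      rw [Function.iterate_succ_apply']
      refine ⟨fun z hz => ?_, fun a ha => ?_, fun h => ?_⟩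
      · rw [← iN.vars z hz]
        simp_all [wv]
      · rw [← iN.arrs a ha]; rfl
      · rw [← iN.coins h]; rfl
  | skip => exact fun s => ⟨fun _ _ => rfl, fun _ _ => rfl, fun _ => rfl⟩

/-- The invariant rule for bounded loops. -/
theorem forLt_rule {x y : ℕ} {p : Prog} (hok : (forLt x y p).ok = true) (s : State)
    (Inv : ℕ → State → Prop) (h0 : Inv 0 (s.assign x 0))
    (hstep : ∀ k < s.vars y, ∀ s', (forLt x y p).Frame s s' → s'.vars x = k → Inv k s' →
      Inv (k + 1) ((p.run s').assign x (k + 1))) :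
    Inv (s.vars y) ((forLt x y p).run s) := by
  simp only [ok, Bool.and_eq_true, bne_iff_ne, Bool.not_eq_true', List.contains_eq_mem,
    decide_eq_false_iff_not] at hok
  have key : ∀ N ≤ s.vars y, (forLt x y p).Frame s
      ((fun s' => (p.run s').assign x (s'.vars x + 1))^[N] (s.assign x 0)) ∧
      ((fun s' => (p.run s').assign x (s'.vars x + 1))^[N] (s.assign x 0)).vars x = N ∧
      Inv N ((fun s' => (p.run s').assign x (s'.vars x + 1))^[N] (s.assign x 0)) := by
    intro N
    induction N with
    | zero => exact fun _ => ⟨⟨fun z hz => by simp_all [wv], by simp, by simp⟩, by simp, h0⟩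
    | succ N ih =>
      intro hN
      obtain ⟨hf, hx, hI⟩ := ih (by omega)
      rw [Function.iterate_succ_apply']
      have hp := p.frame ((fun s' => (p.run s').assign x (s'.vars x + 1))^[N] (s.assign x 0))
      refine ⟨⟨fun z hz => ?_, fun a ha => ?_, fun h => ?_⟩, by simp [hx], ?_⟩
      · rw [← hf.vars z hz]
        simp only [wv, List.mem_cons, not_or] at hz
        simp only [State.assign_vars, hz.1, if_false]
        exact hp.vars z hz.2
      · rw [← hf.arrs a ha]; exact hp.arrs a ha
      · rw [← hf.coins h]; exact hp.coins h
      · rw [hx]; exact hstep N (by omega) _ hf hx hI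
  exact (key _ le_rfl).2.2

/-- The number `b` pays for one test together with one run of the body; the extra summand in `(N +
1) * b` is the failing last test. -/
theorem exec_loop {e : Expr} {c : Cmd} (f : State → State) (b : ℕ) (N : ℕ) (s : State)
    (hstep : ∀ k < N, e.eval (f^[k] s) ≠ 0 ∧ ∃ t, t + e.cost (f^[k] s) + 1 ≤ b ∧
      Exec c (f^[k] s) (f^[k + 1] s) t)
    (hdone : e.eval (f^[N] s) = 0) (hcost : e.cost (f^[N] s) + 1 ≤ b) :
    ∃ t ≤ (N + 1) * b, Exec (.loop e c) s (f^[N] s) t := by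
  induction N generalizing s with
  | zero =>
    refine ⟨e.cost s + 1, by simpa using hcost, ?_⟩
    constructor
    exact hdone
  | succ N ih =>
    obtain ⟨h1, t1, ht1, hx1⟩ := hstep 0 (by omega)
    obtain ⟨t, ht, hx⟩ := ih (f s) (fun k hk => hstep (k + 1) (by omega)) hdone hcost
    refine ⟨_, ?_, .loop_step h1 hx1 hx⟩
    simp only [Function.iterate_zero, id] at ht1 ⊢
    nlinarith

open Polynomial in
/-- The increase of the bit lengths, as a polynomial in the loop bounds, up to a factor. -/
noncomputable def gp : Prog → Polynomial ℕ
  | assign _ e => C e.growth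
  | store _ _ e => C e.growth
  | seq p q => p.gp + q.gp
  | cond _ p q => p.gp + q.gp
  | forLt _ _ p => X * p.gp
  | clog _ _ _ => C 1
  | _ => 0

open Polynomial in
/-- A bound on the cost, as a polynomial in the loop bounds and bit lengths. -/
noncomputable def cp : Prog → Polynomial ℕ
  | assign _ e => C (e.kc + 1) * X
  | store _ i e => C (i.kc + e.kc + 1) * X
  | seq p q => p.cp + q.cp
  | cond e p q => C (e.kc + 1) * X + p.cp + q.cp
  | forLt _ _ p => C 2 + (X + 1) * (p.cp + C 30 * X)
  | clog _ _ _ => C 10 + (X + 1) * (C 30 * X)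
  | _ => 1

/-- The roles of the bounds: `N` for the loop counts, `c` for the bit length of the read-only data,
`B` for the bit length at the start, and `M` for the bit length at all times. Registers that bound
loops are never written, so `N` is valid throughout, and the cost can be evaluated at the single
ceiling `M`. -/
theorem exec_compile {N c : ℕ} (hc : 1 ≤ c) (p : Prog) : ∀ (s : State) (B M : ℕ), p.ok = true →
    (∀ y ∈ p.bnds, y ∉ p.wv) → (∀ y ∈ p.bnds, s.vars y ≤ N) → 0 ∉ p.wv → 0 ∉ p.wa → 1 ≤ B →
    s.Bdd B → s.vars 0 < 2 ^ c → (∀ i, s.arrs 0 i < 2 ^ c) → N ≤ M →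
    B + (p.gp).eval N * c ≤ M →
    (p.run s).Bdd (B + (p.gp).eval N * c) ∧ ∃ t ≤ (p.cp).eval M, Exec p.compile s (p.run s) t := by
  induction p with
  | assign x e =>
    intro s B M hok _ _ _ _ hB hs h0 ha _ hM
    simp only [ok, Bool.and_eq_true, bne_iff_ne] at hok
    simp only [gp, Polynomial.eval_C] at hM ⊢
    refine ⟨(hs.mono (by omega)).assign (Expr.eval_lt_growth hs hc h0 ha e hok.2), _, ?_,
      .assign s x e⟩
    have := Expr.cost_le (hs.mono (C := M) (by omega)) (by omega) e
    simp only [cp, Polynomial.eval_mul, Polynomial.eval_C, Polynomial.eval_X]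
    nlinarith
  | store a i e =>
    intro s B M hok _ _ _ _ hB hs h0 ha _ hM
    simp only [ok, Bool.and_eq_true, bne_iff_ne] at hok
    simp only [gp, Polynomial.eval_C] at hM ⊢
    refine ⟨(hs.mono (by omega)).store (Expr.eval_lt_growth hs hc h0 ha e hok.2), _, ?_,
      .store s a i e⟩
    have := Expr.cost_le (hs.mono (C := M) (by omega)) (by omega) e
    have := Expr.cost_le (hs.mono (C := M) (by omega)) (by omega) i
    simp only [cp, Polynomial.eval_mul, Polynomial.eval_C, Polynomial.eval_X]
    nlinarith
  | flip x =>
    intro s B M _ _ _ _ _ hB hs _ _ _ hM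
    simp only [gp, Polynomial.eval_zero, zero_mul, add_zero] at hM ⊢
    refine ⟨⟨fun z => ?_, hs.2⟩, 1, by simp [cp], .flip s x⟩
    simp only [run, State.flip_vars]
    split_ifs
    · refine (Bool.toNat_lt _).trans_le ?_
      calc 2 = 2 ^ 1 := rfl
        _ ≤ _ := Nat.pow_le_pow_right two_pos hB
    · exact hs.1 z
  | skip =>
    intro s B M _ _ _ _ _ hB hs _ _ _ hM
    exact ⟨hs.mono (by omega), 1, by simp [cp], .skip s⟩
  | seq p q ihp ihq =>
    intro s B M hok hb hN hw0 hwa hB hs h0 ha hNM hM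
    simp only [ok, Bool.and_eq_true] at hok
    simp only [wv, wa, bnds, List.mem_append, not_or] at hb hN hw0 hwa
    simp only [gp, Polynomial.eval_add, add_mul] at hM ⊢
    obtain ⟨hs1, t1, ht1, hx1⟩ := ihp s B M hok.1 (fun y hy => (hb y (.inl hy)).1)
      (fun y hy => hN y (.inl hy)) hw0.1 hwa.1 hB hs h0 ha hNM (by omega)
    have hf := p.frame s
    obtain ⟨hs2, t2, ht2, hx2⟩ := ihq (p.run s) _ M hok.2 (fun y hy => (hb y (.inr hy)).2)
      (fun y hy => by rw [hf.vars y (hb y (.inr hy)).1]; exact hN y (.inr hy)) hw0.2 hwa.2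
      (by omega) hs1 (by rw [hf.vars 0 hw0.1]; exact h0)
      (by rw [hf.arrs 0 hwa.1]; exact ha) hNM (by omega)
    refine ⟨hs2.mono (by omega), _, ?_, .seq hx1 hx2⟩
    simp only [cp, Polynomial.eval_add]; omega
  | cond e p q ihp ihq =>
    intro s B M hok hb hN hw0 hwa hB hs h0 ha hNM hM
    simp only [ok, Bool.and_eq_true] at hok
    simp only [wv, wa, bnds, List.mem_append, not_or] at hb hN hw0 hwa
    simp only [gp, Polynomial.eval_add, add_mul] at hM ⊢
    have hcost := Expr.cost_le (hs.mono (C := M) (by omega)) (by omega) e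
    have hcp : ((cond e p q).cp).eval M = (e.kc + 1) * M + p.cp.eval M + q.cp.eval M := by
      simp [cp]
    rw [hcp]
    by_cases he : e.eval s = 0
    · obtain ⟨hs1, t1, ht1, hx1⟩ := ihq s B M hok.2 (fun y hy => (hb y (.inr hy)).2)
        (fun y hy => hN y (.inr hy)) hw0.2 hwa.2 hB hs h0 ha hNM (by omega)
      have hr : (cond e p q).run s = q.run s := by simp [run, he]
      rw [hr]
      exact ⟨hs1.mono (by omega), _, by nlinarith, .cond_false he hx1⟩
    · obtain ⟨hs1, t1, ht1, hx1⟩ := ihp s B M hok.1 (fun y hy => (hb y (.inl hy)).1)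
        (fun y hy => hN y (.inl hy)) hw0.1 hwa.1 hB hs h0 ha hNM (by omega)
      have hr : (cond e p q).run s = p.run s := by simp [run, he]
      rw [hr]
      exact ⟨hs1.mono (by omega), _, by nlinarith, .cond_true he hx1⟩
  | forLt x y p ih =>
    intro s B M hok hb hN hw0 hwa hB hs h0 ha hNM hM
    simp only [ok, Bool.and_eq_true, bne_iff_ne, Bool.not_eq_true', List.contains_eq_mem,
      decide_eq_false_iff_not] at hok
    obtain ⟨⟨⟨⟨hx0, hxy⟩, hxp⟩, hyp⟩, hokp⟩ := hok
    simp only [wv, wa, bnds, List.mem_cons, not_or] at hb hN hw0 hwa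
    simp only [gp, Polynomial.eval_mul, Polynomial.eval_X] at hM ⊢
    have hyN : s.vars y ≤ N := hN y (.inl rfl)
    set g := (p.gp).eval N
    set f : State → State := fun s' => (p.run s').assign x (s'.vars x + 1) with hf
    have hbound : ∀ k ≤ s.vars y, B + k * g * c ≤ B + N * g * c := fun k hk => by
      gcongr; exact hk.trans hyN
    -- The execution of the body belongs to the claim, because the same appeal to the induction
    -- hypothesis yields the run of iteration `k` and the bit bound for iteration `k + 1`.
    have key : ∀ k ≤ s.vars y, (f^[k] (s.assign x 0)).Bdd (B + k * g * c) ∧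
        (f^[k] (s.assign x 0)).vars x = k ∧
        (∀ z, z ≠ x → z ∉ p.wv → (f^[k] (s.assign x 0)).vars z = s.vars z) ∧
        (f^[k] (s.assign x 0)).arrs 0 = s.arrs 0 ∧
        (k < s.vars y → ∃ t ≤ (p.cp).eval M,
          Exec p.compile (f^[k] (s.assign x 0)) (p.run (f^[k] (s.assign x 0))) t ∧
          (p.run (f^[k] (s.assign x 0))).Bdd (B + (k + 1) * g * c)) := by
      have hstep : ∀ k, k ≤ s.vars y → (f^[k] (s.assign x 0)).Bdd (B + k * g * c) →
          (∀ z, z ≠ x → z ∉ p.wv → (f^[k] (s.assign x 0)).vars z = s.vars z) →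
          (f^[k] (s.assign x 0)).arrs 0 = s.arrs 0 →
          (k < s.vars y → ∃ t ≤ (p.cp).eval M,
            Exec p.compile (f^[k] (s.assign x 0)) (p.run (f^[k] (s.assign x 0))) t ∧
            (p.run (f^[k] (s.assign x 0))).Bdd (B + (k + 1) * g * c)) := by
        intro k hk hB1 hv1 ha1 hlt
        have hle := hbound (k + 1) hlt
        obtain ⟨hs1, t1, ht1, hx1⟩ := ih (f^[k] (s.assign x 0)) (B + k * g * c) M hokp
          (fun z hz => (hb z (.inr hz)).2)
          (fun z hz => by
            rw [hv1 z (hb z (.inr hz)).1 (hb z (.inr hz)).2]; exact hN z (.inr hz))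
          hw0.2 hwa (by omega) hB1 (by rw [hv1 0 hw0.1 hw0.2]; exact h0)
          (by rw [ha1]; exact ha) hNM (by nlinarith)
        exact ⟨t1, ht1, hx1, hs1.mono (by simp only [g]; nlinarith)⟩
      intro k
      induction k with
      | zero =>
        intro hk
        have h1 : (s.assign x 0).Bdd (B + 0 * g * c) := by simpa using hs.assign (by positivity)
        have h2 : ∀ z, z ≠ x → z ∉ p.wv → (s.assign x 0).vars z = s.vars z := by
          intro z hz _; simp [hz]
        exact ⟨h1, by simp, h2, rfl, hstep 0 hk h1 h2 rfl⟩
      | succ k ihk =>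
        intro hk
        obtain ⟨hB1, hx1, hv1, ha1, hst⟩ := ihk (by omega)
        obtain ⟨t, ht, hex, hB2⟩ := hst (by omega)
        have hfr := p.frame (f^[k] (s.assign x 0))
        have e1 : f^[k + 1] (s.assign x 0) =
            (p.run (f^[k] (s.assign x 0))).assign x (k + 1) := by
          rw [Function.iterate_succ_apply', hf]; simp only; rw [← hf, hx1]
        have h1 : (f^[k + 1] (s.assign x 0)).Bdd (B + (k + 1) * g * c) := by
          rw [e1]
          -- The counter never exceeds the register that bounds the loop, so incrementing it costs
          -- no additional bits.
          refine hB2.assign (lt_of_le_of_lt (hk.trans ?_) ((hs.mono (Nat.le_add_right _ _)).1 y))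
          exact le_rfl
        have h2 : ∀ z, z ≠ x → z ∉ p.wv → (f^[k + 1] (s.assign x 0)).vars z = s.vars z := by
          intro z hz hzp
          rw [e1, State.assign_vars, if_neg hz, hfr.vars z hzp, hv1 z hz hzp]
        have h3 : (f^[k + 1] (s.assign x 0)).arrs 0 = s.arrs 0 := by
          rw [e1, State.assign_arrs, hfr.arrs 0 hwa, ha1]
        exact ⟨h1, by rw [e1]; simp, h2, h3, hstep _ hk h1 h2 h3⟩
    have hall : ∀ k ≤ s.vars y, (f^[k] (s.assign x 0)).Bdd M := fun k hk =>
      (key k hk).1.mono ((hbound k hk).trans hM)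
    have hy : ∀ k ≤ s.vars y, (f^[k] (s.assign x 0)).vars y = s.vars y := fun k hk =>
      (key k hk).2.2.1 y (Ne.symm hxy) hyp
    have hcost : ∀ k ≤ s.vars y,
        (Expr.bin .lt (.var x) (.var y)).cost (f^[k] (s.assign x 0)) + 1 ≤ 10 * M := by
      intro k hk
      have := Expr.cost_le (hall k hk) (by omega) (.bin .lt (.var x) (.var y))
      simp only [Expr.kc, Expr.wt] at this
      omega
    have hMB : B ≤ M := by omega
    obtain ⟨t, ht, hex⟩ := exec_loop (e := .bin .lt (.var x) (.var y))
      (c := .seq p.compile (.assign x (.var x + .const 1))) f ((p.cp).eval M + 30 * M)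
      (s.vars y) (s.assign x 0) (by
        intro k hk
        obtain ⟨hB1, hx1, hv1, ha1, hst⟩ := key k hk.le
        obtain ⟨t, ht, hex, hB2⟩ := hst hk
        have e1 : f^[k + 1] (s.assign x 0) = (p.run (f^[k] (s.assign x 0))).assign x
              ((Expr.var x + Expr.const 1).eval (p.run (f^[k] (s.assign x 0)))) := by
          rw [Function.iterate_succ_apply']
          simp only [hf, Expr.eval_add, Expr.eval_var, Expr.eval_const]
          rw [← hf, (p.frame _).vars x hxp]
        have hx2 := Exec.assign (p.run (f^[k] (s.assign x 0))) x (.var x + .const 1)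
        rw [← e1] at hx2
        refine ⟨by simp [hx1, hy k hk.le, hk], _, ?_, .seq hex hx2⟩
        · have h1 := hcost k hk.le
          have h2 := Expr.cost_le (hB2.mono ((hbound (k + 1) hk).trans hM)) (by omega)
            (Expr.var x + Expr.const 1)
          have h3 : (Expr.var x + Expr.const 1).kc = 8 := by
            change 2 + (1 + Nat.size 1) + 1 + (1 + Nat.size 1 + 1) = 8; simp
          rw [h3] at h2
          omega)
      (by simp [(key _ le_rfl).2.1, hy _ le_rfl]) (by have := hcost _ le_rfl; omega)
    refine ⟨(key _ le_rfl).1.mono (hbound _ le_rfl), _, ?_, .seq (.assign _ _ _) hex⟩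
    have : ((forLt x y p).cp).eval M = 2 + (M + 1) * ((p.cp).eval M + 30 * M) := by simp [cp]
    rw [this]
    have h1 : (Expr.const 0).cost s + 1 = 2 := by simp [Expr.cost]
    rw [h1]
    have : (s.vars y + 1) * ((p.cp).eval M + 30 * M) ≤ (M + 1) * ((p.cp).eval M + 30 * M) := by
      gcongr; omega
    omega
  | clog k p y =>
    intro s B M hok hb hN hw0 hwa hB hs h0 ha hNM hM
    simp only [ok, Bool.and_eq_true, bne_iff_ne] at hok
    obtain ⟨⟨⟨⟨hk0, hp0⟩, hkp⟩, hpy⟩, hky⟩ := hok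
    simp only [gp, Polynomial.eval_C, one_mul] at hM ⊢
    set f : State → State :=
      fun s' => (s'.assign p (s'.vars p + s'.vars p)).assign k (s'.vars k + 1) with hf
    set s0 := (s.assign k 0).assign p 1
    -- The number of doublings is bounded by a bit length. Hence this loop needs no entry in `bnds`.
    have hcl : Nat.clog 2 (s.vars y) ≤ B := Nat.clog_le_of_le_pow (hs.1 y).le
    have key : ∀ j ≤ Nat.clog 2 (s.vars y), (f^[j] s0).Bdd (B + 1) ∧
        (f^[j] s0).vars k = j ∧ (f^[j] s0).vars p = 2 ^ j ∧ (f^[j] s0).vars y = s.vars y := by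
      intro j
      induction j with
      | zero =>
        intro _
        refine ⟨((hs.mono (Nat.le_succ B)).assign (by positivity)).assign
          (Nat.one_lt_two_pow (by omega)), ?_, ?_, ?_⟩
        · simp [s0, hkp]
        · simp [s0]
        · simp [s0, hpy.symm, hky.symm]
      | succ j ihj =>
        intro hj
        obtain ⟨h1, h2, h3, h4⟩ := ihj (by omega)
        have e1 : f^[j + 1] s0 = ((f^[j] s0).assign p (2 ^ j + 2 ^ j)).assign k (j + 1) := by
          rw [Function.iterate_succ_apply', hf]; simp only; rw [← hf, h2, h3]
        rw [e1]
        refine ⟨(h1.assign ?_).assign ?_, by simp, by simp [hkp.symm, pow_succ]; omega, ?_⟩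
        · rw [← two_mul, ← pow_succ']; exact Nat.pow_lt_pow_right (by omega) (by omega)
        · exact lt_of_lt_of_le (by omega) (Nat.lt_two_pow_self (n := B + 1)).le
        · simp [hpy.symm, hky.symm, h4]
    have hall : ∀ j ≤ Nat.clog 2 (s.vars y), (f^[j] s0).Bdd M := fun j hj =>
      (key j hj).1.mono (by omega)
    have hcost : ∀ j ≤ Nat.clog 2 (s.vars y),
        (Expr.bin .lt (.var p) (.var y)).cost (f^[j] s0) + 1 ≤ 9 * M := by
      intro k hk
      have := Expr.cost_le (hall k hk) (by omega) (.bin .lt (.var p) (.var y))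
      simp only [Expr.kc, Expr.wt] at this
      omega
    obtain ⟨t, ht, hex⟩ := exec_loop (e := .bin .lt (.var p) (.var y))
      (c := .seq (.assign p (.var p + .var p)) (.assign k (.var k + .const 1))) f (30 * M)
      (Nat.clog 2 (s.vars y)) s0 (by
        intro j hj
        obtain ⟨h1, h2, h3, h4⟩ := key j hj.le
        have hlt : 2 ^ j < s.vars y := Nat.pow_lt_of_lt_clog hj
        have e1 : f^[j + 1] s0 = ((f^[j] s0).assign p ((Expr.var p + Expr.var p).eval
              (f^[j] s0))).assign k ((Expr.var k + Expr.const 1).eval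
              ((f^[j] s0).assign p ((Expr.var p + Expr.var p).eval (f^[j] s0)))) := by
          rw [Function.iterate_succ_apply']
          simp [hf, hkp]
        have hx2 := Exec.assign ((f^[j] s0).assign p ((Expr.var p + Expr.var p).eval
              (f^[j] s0))) k (.var k + .const 1)
        rw [← e1] at hx2
        refine ⟨by simp [h3, h4, hlt], _, ?_, .seq (.assign _ _ _) hx2⟩
        · have hc1 := hcost j hj.le
          have hc2 := Expr.cost_le (hall j hj.le) (by omega) (Expr.var p + Expr.var p)
          have hB2 : ((f^[j] s0).assign p ((Expr.var p + Expr.var p).eval (f^[j] s0))).Bdd M := by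
            refine (hall j hj.le).assign ?_
            have : 2 ^ (j + 1) < 2 ^ M := Nat.pow_lt_pow_right (by omega) (by omega)
            simp only [Expr.eval_add, Expr.eval_var, h3]
            rw [pow_succ] at this; omega
          have hc3 := Expr.cost_le hB2 (by omega) (Expr.var k + Expr.const 1)
          have e3 : (Expr.var k + Expr.const 1).kc = 8 := by
            change 2 + (1 + Nat.size 1) + 1 + (1 + Nat.size 1 + 1) = 8; simp
          have e2 : (Expr.var p + Expr.var p).kc = 8 := by
            change 2 + 2 + 1 + (1 + 1 + 1) = 8; simp
          rw [e3] at hc3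
          rw [e2] at hc2
          omega)
      (by
        obtain ⟨h1, h2, h3, h4⟩ := key _ le_rfl
        simp only [Expr.eval_lt, Expr.eval_var, h3, h4]
        have := Nat.le_pow_clog (b := 2) (by omega) (s.vars y)
        simp; omega) (by have := hcost _ le_rfl; omega)
    refine ⟨(key _ le_rfl).1.mono (by omega), _, ?_, .seq (.seq (.assign _ _ _) (.assign _ _ _)) hex⟩
    have : ((clog k p y).cp).eval M = 10 + (M + 1) * (30 * M) := by simp [cp]
    rw [this]
    have h1 : (Expr.const 0).cost s = 1 := by simp [Expr.cost]
    have h2 : ∀ s', (Expr.const 1).cost s' = 2 := by simp [Expr.cost]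
    rw [h1, h2]
    have : (Nat.clog 2 (s.vars y) + 1) * (30 * M) ≤ (M + 1) * (30 * M) := by
      gcongr; omega
    omega

/-- A structured program whose loop bounds and values are polynomially bounded runs in
polynomial time, and leaves polynomially bounded bit lengths. -/
theorem exists_cost_polynomial (p : Prog) (hok : p.ok = true)
    (hb : (p.bnds.all fun y => !p.wv.contains y) = true)
    (h0 : (!p.wv.contains 0 && !p.wa.contains 0) = true) :
    ∃ P Q : Polynomial ℕ, ∀ (s : State) (z : ℕ), 1 ≤ z → s.Bdd z →
      (∀ y ∈ p.bnds, s.vars y ≤ z) →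
      (p.run s).Bdd (Q.eval z) ∧ ∃ t ≤ P.eval z, Exec p.compile s (p.run s) t := by
  simp only [List.all_eq_true, Bool.not_eq_true', List.contains_eq_mem, decide_eq_false_iff_not,
    Bool.and_eq_true] at hb h0
  refine ⟨p.cp.comp (.X + p.gp * .X), .X + p.gp * .X, fun s z hz hs hN => ?_⟩
  simp only [Polynomial.eval_comp, Polynomial.eval_add, Polynomial.eval_mul, Polynomial.eval_X]
  -- The same `z` serves as `N`, `c` and `B`.
  exact exec_compile hz p s z _ hok hb hN h0.1 h0.2 hz hs (hs.1 0) (hs.2 0) (by omega) le_rfl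

@[simp] theorem run_seq (p q : Prog) (s : State) : (seq p q).run s = q.run (p.run s) := rfl
@[simp] theorem run_assign (x : ℕ) (e : Expr) (s : State) :
    (assign x e).run s = s.assign x (e.eval s) := rfl
@[simp] theorem run_store (a : ℕ) (i e : Expr) (s : State) :
    (store a i e).run s = s.store a (i.eval s) (e.eval s) := rfl
@[simp] theorem run_flip (x : ℕ) (s : State) : (flip x).run s = s.flip x := rfl
@[simp] theorem run_skip (s : State) : skip.run s = s := rfl
theorem run_cond (e : Expr) (p q : Prog) (s : State) :
    (cond e p q).run s = if e.eval s ≠ 0 then p.run s else q.run s := rfl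

theorem run_clog {k p y : ℕ} (hok : (clog k p y).ok = true) (s : State) (z : ℕ) :
    ((clog k p y).run s).vars z = if z = k then Nat.clog 2 (s.vars y)
      else if z = p then 2 ^ Nat.clog 2 (s.vars y) else s.vars z := by
  simp only [ok, Bool.and_eq_true, bne_iff_ne] at hok
  obtain ⟨⟨⟨⟨hk0, hp0⟩, hkp⟩, hpy⟩, hky⟩ := hok
  simp only [run]
  generalize Nat.clog 2 (s.vars y) = N
  induction N generalizing z with
  | zero => simp only [Function.iterate_zero, id, State.assign_vars]; aesop
  | succ N ih =>
    rw [Function.iterate_succ_apply']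
    simp only [State.assign_vars, ih]
    split_ifs <;> simp_all [pow_succ]; omega

end Prog

end HopEmbed

namespace HopEmbed

/-! ### Mixture metrics -/

section Mixture

variable {n : ℕ} (G : WGraph n) (a T : ℕ)

/-- The length of a walk where every step costs `a` times its weight, plus `T`. -/
def mixLen {u v : Fin n} (p : (⊤ : SimpleGraph (Fin n)).Walk u v) : ℕ :=
  a * (p.edges.map G.w).sum + T * p.length

/-- The distance for `mixLen`. -/
noncomputable def mixDist (u v : Fin n) : ℕ :=
  ⨅ p : (⊤ : SimpleGraph (Fin n)).Walk u v, mixLen G a T p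

instance nonempty_walk_top (u v : Fin n) : Nonempty ((⊤ : SimpleGraph (Fin n)).Walk u v) := by
  by_cases h : u = v
  · subst h; exact ⟨.nil⟩
  · exact ⟨.cons (show (⊤ : SimpleGraph (Fin n)).Adj u v from h) .nil⟩

/-- `pathWeight` counts a repeated edge once, `mixLen` counts it every time. This inequality is what
transfers upper bounds from `mixLen`; on simple paths the two sides agree. -/
theorem pathWeight_le_sum {H : SimpleGraph (Fin n)} (w : Sym2 (Fin n) → ℕ) {u v : Fin n}
    (p : H.Walk u v) : pathWeight w p ≤ (p.edges.map w).sum := by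
  unfold pathWeight
  induction p.edges with
  | nil => simp
  | cons e l ih =>
    simp only [List.toFinset_cons, List.map_cons, List.sum_cons]
    by_cases h : e ∈ l.toFinset
    · rw [Finset.insert_eq_of_mem h]; omega
    · rw [Finset.sum_insert h]; omega

theorem pathWeight_eq_sum {H : SimpleGraph (Fin n)} (w : Sym2 (Fin n) → ℕ) {u v : Fin n}
    {p : H.Walk u v} (hp : p.IsPath) : pathWeight w p = (p.edges.map w).sum :=
  List.sum_toFinset w hp.isTrail.edges_nodup

variable {G a T}

theorem mixLen_nil (u : Fin n) : mixLen G a T (.nil : (⊤ : SimpleGraph (Fin n)).Walk u u) = 0 := by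
  simp [mixLen]

theorem mixLen_append {u v x : Fin n} (p : (⊤ : SimpleGraph (Fin n)).Walk u v)
    (q : (⊤ : SimpleGraph (Fin n)).Walk v x) :
    mixLen G a T (p.append q) = mixLen G a T p + mixLen G a T q := by
  simp only [mixLen, SimpleGraph.Walk.edges_append, SimpleGraph.Walk.length_append, List.map_append,
    List.sum_append]
  ring

theorem mixLen_cons {u v x : Fin n} (h : (⊤ : SimpleGraph (Fin n)).Adj u v)
    (q : (⊤ : SimpleGraph (Fin n)).Walk v x) :
    mixLen G a T (.cons h q) = a * G.w s(u, v) + T + mixLen G a T q := by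
  simp only [mixLen, SimpleGraph.Walk.edges_cons, SimpleGraph.Walk.length_cons, List.map_cons,
    List.sum_cons]
  ring

theorem mixLen_reverse {u v : Fin n} (p : (⊤ : SimpleGraph (Fin n)).Walk u v) :
    mixLen G a T p.reverse = mixLen G a T p := by
  simp [mixLen, SimpleGraph.Walk.edges_reverse]

theorem mixLen_bypass_le {u v : Fin n} (p : (⊤ : SimpleGraph (Fin n)).Walk u v) :
    mixLen G a T p.bypass ≤ mixLen G a T p := by
  unfold mixLen
  gcongr ?_ + _ * ?_
  · gcongr
    exact (p.edges_bypass_sublist_edges.map G.w).sum_le_sum (by simp)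
  · exact p.length_bypass_le_length

theorem exists_mixLen_eq (u v : Fin n) :
    ∃ p : (⊤ : SimpleGraph (Fin n)).Walk u v, mixLen G a T p = mixDist G a T u v :=
  Nat.sInf_mem (Set.range_nonempty _)

theorem mixDist_le {u v : Fin n} (p : (⊤ : SimpleGraph (Fin n)).Walk u v) :
    mixDist G a T u v ≤ mixLen G a T p :=
  Nat.sInf_le ⟨p, rfl⟩

theorem mixDist_self (u : Fin n) : mixDist G a T u u = 0 :=
  Nat.le_zero.1 ((mixDist_le .nil).trans_eq (mixLen_nil u))

theorem mixDist_le_add {c u v : Fin n} (p : (⊤ : SimpleGraph (Fin n)).Walk u v) :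
    mixDist G a T c v ≤ mixDist G a T c u + mixLen G a T p := by
  obtain ⟨q, hq⟩ := exists_mixLen_eq (G := G) (a := a) (T := T) c u
  rw [← hq, ← mixLen_append]
  exact mixDist_le _

theorem mixDist_le_add_reverse {c u v : Fin n} (p : (⊤ : SimpleGraph (Fin n)).Walk u v) :
    mixDist G a T c u ≤ mixDist G a T c v + mixLen G a T p := by
  rw [← mixLen_reverse]; exact mixDist_le_add _

theorem mixDist_le_edge (c : Fin n) {x v : Fin n} (h : x ≠ v) :
    mixDist G a T c v ≤ mixDist G a T c x + (a * G.w s(x, v) + T) := by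
  have := mixDist_le_add (G := G) (a := a) (T := T) (c := c)
    (.cons (show (⊤ : SimpleGraph (Fin n)).Adj x v from h) .nil)
  rwa [mixLen_cons, mixLen_nil, add_zero] at this

/-- The last step of a shortest walk. -/
theorem exists_mixDist_eq_edge {c v : Fin n} (h : c ≠ v) :
    ∃ x, x ≠ v ∧ mixDist G a T c x + (a * G.w s(x, v) + T) = mixDist G a T c v := by
  obtain ⟨p, hp⟩ := exists_mixLen_eq (G := G) (a := a) (T := T) v c
  have hs : mixDist G a T c v = mixLen G a T p := by
    refine le_antisymm ((mixDist_le p.reverse).trans_eq (mixLen_reverse p)) ?_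
    obtain ⟨q, hq⟩ := exists_mixLen_eq (G := G) (a := a) (T := T) c v
    rw [hp, ← hq, ← mixLen_reverse q]; exact mixDist_le _
  cases p with
  | nil => exact absurd rfl h
  | @cons _ x _ e q =>
    refine ⟨x, Ne.symm e, le_antisymm ?_ (mixDist_le_edge c (Ne.symm e))⟩
    rw [hs, mixLen_cons, Sym2.eq_swap, add_comm]
    gcongr
    exact (mixDist_le q.reverse).trans_eq (mixLen_reverse q)

/-- A simple path has fewer than `n` hops, which is why `n` rounds of relaxation compute the
distances. -/
theorem exists_isPath_mixLen_eq (u v : Fin n) :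
    ∃ p : (⊤ : SimpleGraph (Fin n)).Walk u v, p.IsPath ∧ mixLen G a T p = mixDist G a T u v := by
  obtain ⟨p, hp⟩ := exists_mixLen_eq (G := G) (a := a) (T := T) u v
  exact ⟨p.bypass, p.bypass_isPath, le_antisymm (hp ▸ mixLen_bypass_le p) (mixDist_le _)⟩

end Mixture

/-! ### Ball carving -/

section Carving

variable {V : Type*} (D : ℕ → V → ℕ) (R : ℕ → ℕ) (ρ : ℕ)

/-- The index of the first ball that contains `v`. -/
noncomputable def carve (v : V) : ℕ := sInf {j | D j v ≤ R j}

/-- The first ball that comes close to `v` does not contain the whole neighbourhood of `v`. -/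
def Cuts (v : V) : Prop := ∃ j, D j v ≤ R j + ρ ∧ R j < D j v + ρ ∧ ∀ i < j, R i + ρ < D i v

variable {D R ρ}

theorem le_of_carve_eq {v : V} {j : ℕ} (hv : ∃ i, D i v ≤ R i) (h : carve D R v = j) :
    D j v ≤ R j := by
  have : sInf {j | D j v ≤ R j} ∈ {j | D j v ≤ R j} := Nat.sInf_mem hv
  rw [← h]; exact this

theorem carve_eq_iff {v : V} {j : ℕ} (hv : ∃ i, D i v ≤ R i) :
    carve D R v = j ↔ D j v ≤ R j ∧ ∀ i < j, R i < D i v := by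
  constructor
  · exact fun h => ⟨le_of_carve_eq hv h, fun i hi => not_le.1 fun h' =>
      Nat.notMem_of_lt_sInf (s := {j | D j v ≤ R j}) (by unfold carve at h; omega) h'⟩
  · rintro ⟨h1, h2⟩
    refine le_antisymm (Nat.sInf_le h1) (not_lt.1 fun h => ?_)
    exact absurd (le_of_carve_eq hv rfl) (not_le.2 (h2 _ h))

/-- Consider the first ball that comes within `ρ` of `v`. As `v` is not cut, this ball contains `v`
with a margin of `ρ`, hence also `u`. The earlier balls stay farther than `ρ` from `v` and so miss
both points. -/
theorem carve_eq_carve {u v : V} (hv : ∃ i, D i v ≤ R i) (hc : ¬ Cuts D R ρ v)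
    (h1 : ∀ j, D j u ≤ D j v + ρ) (h2 : ∀ j, D j v ≤ D j u + ρ) :
    carve D R u = carve D R v := by
  have hex : ∃ j, D j v ≤ R j + ρ := hv.imp fun j h => by omega
  have hle : ∀ i < Nat.find hex, R i + ρ < D i v := fun i hi => not_le.1 (Nat.find_min hex hi)
  have hj := Nat.find_spec hex
  have hR : D (Nat.find hex) v + ρ ≤ R (Nat.find hex) :=
    not_lt.1 fun h => hc ⟨_, hj, h, hle⟩
  have hu := h1 (Nat.find hex)
  rw [(carve_eq_iff (j := Nat.find hex) hv).2 ⟨by omega, fun i hi => by have := hle i hi; omega⟩,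
    (carve_eq_iff (j := Nat.find hex) ⟨Nat.find hex, by omega⟩).2
      ⟨by omega, fun i hi => by have := hle i hi; have := h2 i; omega⟩]

/-- If two points are separated, then some ball is the first one to contain one of them, and does
not contain the other. -/
theorem exists_of_carve_ne {u v : V} (hu : ∃ i, D i u ≤ R i) (hv : ∃ i, D i v ≤ R i)
    (h : carve D R u ≠ carve D R v) :
    ∃ j, min (D j u) (D j v) ≤ R j ∧ R j < max (D j u) (D j v) ∧
      ∀ i < j, R i < min (D i u) (D i v) := by
  obtain ⟨hu1, hu2⟩ := (carve_eq_iff hu).1 rfl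
  obtain ⟨hv1, hv2⟩ := (carve_eq_iff hv).1 rfl
  rcases lt_or_gt_of_ne h with h | h
  · exact ⟨_, (min_le_left _ _).trans hu1, (hv2 _ h).trans_le (le_max_right _ _),
      fun i hi => lt_min (hu2 i hi) (hv2 i (hi.trans h))⟩
  · exact ⟨_, (min_le_right _ _).trans hv1, (hu2 _ h).trans_le (le_max_left _ _),
      fun i hi => lt_min (hu2 i (hi.trans h)) (hv2 i hi)⟩

end Carving

end HopEmbed

namespace HopEmbed

/-! ### Trees from ultrametrics -/

/-- A set of vertices with an ultrametric `2 ^ ex u v`, where every vertex but the root is joined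
to the closest vertex of smaller rank. -/
structure TreeData {n : ℕ} (G : WGraph n) : Type where
  A : Set (Fin n)
  root : Fin n
  root_mem : root ∈ A
  rank : Fin n → ℕ
  rank_inj : Function.Injective rank
  root_le : ∀ v, rank root ≤ rank v
  ex : Fin n → Fin n → ℕ
  ex_comm : ∀ u v, ex u v = ex v u
  ex_le_max : ∀ u v x, ex u x ≤ max (ex u v) (ex v x)
  par : Fin n → Fin n
  par_mem : ∀ v ∈ A, v ≠ root → par v ∈ A
  rank_par_lt : ∀ v ∈ A, v ≠ root → rank (par v) < rank v
  ex_par_le : ∀ v ∈ A, v ≠ root → ∀ u ∈ A, rank u < rank v → ex (par v) v ≤ ex u v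
  rank_par_le : ∀ v ∈ A, v ≠ root → ∀ u ∈ A, rank u < rank v → ex u v = ex (par v) v →
    rank (par v) ≤ rank u
  path : ∀ u v : Fin n, (⊤ : SimpleGraph (Fin n)).Walk u v
  path_symm : ∀ u v, u ≠ v → path v u = (path u v).reverse
  path_weight : ∀ u v, u ≠ v → pathWeight G.w (path u v) ≤ 2 ^ ex u v

namespace TreeData

variable {n : ℕ} {G : WGraph n} (X : TreeData G)

/-- The adjacency relation of the tree. -/
def TAdj (u v : Fin n) : Prop :=
  (v ∈ X.A ∧ v ≠ X.root ∧ X.par v = u) ∨ (u ∈ X.A ∧ u ≠ X.root ∧ X.par u = v)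

theorem TAdj.symm {u v : Fin n} (h : X.TAdj u v) : X.TAdj v u := Or.symm h

theorem TAdj.ne {u v : Fin n} (h : X.TAdj u v) : u ≠ v := by
  rintro rfl
  rcases h with ⟨h1, h2, h3⟩ | ⟨h1, h2, h3⟩ <;>
  · have := X.rank_par_lt u h1 h2
    rw [h3] at this; omega

theorem TAdj.mem {u v : Fin n} (h : X.TAdj u v) : u ∈ X.A := by
  rcases h with ⟨h1, h2, h3⟩ | ⟨h1, h2, h3⟩
  · exact h3 ▸ X.par_mem v h1 h2
  · exact h1

/-- The tree as a graph on all vertices. -/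
def graph : SimpleGraph (Fin n) where
  Adj := X.TAdj
  symm := ⟨fun _ _ => TAdj.symm X⟩
  loopless := ⟨fun _ h => TAdj.ne X h rfl⟩

theorem TAdj.eq_par {u v : Fin n} (h : X.TAdj u v) (hr : X.rank v ≤ X.rank u) : v = X.par u := by
  rcases h with ⟨h1, h2, h3⟩ | ⟨h1, h2, h3⟩
  · have := X.rank_par_lt v h1 h2
    rw [h3] at this; omega
  · exact h3.symm

/-- At the vertex of largest rank on a cycle, both neighbours along the cycle would have to be its
parent. -/
theorem graph_isAcyclic : X.graph.IsAcyclic := by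
  intro u c hc
  obtain ⟨x, hx, hmax⟩ := c.support.toFinset.exists_max_image X.rank ⟨u, by simp⟩
  simp only [List.mem_toFinset] at hx hmax
  set d := c.rotate x hx
  have hd : d.IsCycle := (SimpleGraph.Walk.isCycle_rotate hx).2 hc
  have hsup : ∀ y ∈ d.support, X.rank y ≤ X.rank x := fun y hy =>
    hmax y ((SimpleGraph.Walk.mem_support_rotate_iff ..).1 hy)
  refine hd.snd_ne_penultimate ?_
  have h1 : X.TAdj x d.snd := d.adj_snd hd.not_nil
  have h2 : X.TAdj x d.penultimate := (d.adj_penultimate hd.not_nil).symm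
  rw [TAdj.eq_par X h1 (hsup _ (d.getVert_mem_support 1)),
    TAdj.eq_par X h2 (hsup _ (d.getVert_mem_support _))]

/-- The tree as a subgraph of the complete graph. -/
def toSubgraph : (⊤ : SimpleGraph (Fin n)).Subgraph where
  verts := X.A
  Adj := X.TAdj
  adj_sub h := TAdj.ne X h
  edge_vert h := TAdj.mem X h
  symm := ⟨fun _ _ => TAdj.symm X⟩

theorem reachable_root (v : Fin n) (hv : v ∈ X.A) :
    X.toSubgraph.coe.Reachable ⟨v, hv⟩ ⟨X.root, X.root_mem⟩ := by
  induction hk : X.rank v using Nat.strong_induction_on generalizing v with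
  | _ k ih =>
    by_cases h : v = X.root
    · subst h; exact .refl _
    · have hlt := X.rank_par_lt v hv h
      refine .trans (.symm (SimpleGraph.Adj.reachable ?_))
        (ih _ (hk ▸ hlt) (X.par v) (X.par_mem v hv h) rfl)
      exact .inl ⟨hv, h, rfl⟩

theorem toSubgraph_isTree : X.toSubgraph.coe.IsTree where
  connected :=
    { preconnected := fun u v =>
        (X.reachable_root u.1 u.2).trans (X.reachable_root v.1 v.2).symm
      nonempty := ⟨⟨X.root, X.root_mem⟩⟩ }
  isAcyclic := X.graph_isAcyclic.comap ⟨Subtype.val, fun h => h⟩ Subtype.val_injective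

/-- The partial tree embedding. -/
def toEmbedding : PartialTreeEmbedding G where
  tree := X.toSubgraph
  isTree := X.toSubgraph_isTree
  root := X.root
  root_mem := X.root_mem
  wt := Sym2.lift ⟨fun u v => 2 ^ X.ex u v, fun u v => congrArg (2 ^ ·) (X.ex_comm u v)⟩
  path {u v} _ := X.path u v
  path_symm {u v} e := X.path_symm u v (TAdj.ne X e)
  path_weight_le {u v} e := X.path_weight u v (TAdj.ne X e)

theorem toEmbedding_wt (u v : Fin n) : X.toEmbedding.wt s(u, v) = 2 ^ X.ex u v := rfl

theorem adj_par {v : Fin n} (hv : v ∈ X.A) (h : v ≠ X.root) :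
    X.toEmbedding.graph.Adj v (X.par v) := .inr ⟨hv, h, rfl⟩

theorem isAcyclic : X.toEmbedding.graph.IsAcyclic := X.graph_isAcyclic

theorem path_unique {u v : Fin n} {p q : X.toEmbedding.graph.Walk u v} (hp : p.IsPath)
    (hq : q.IsPath) : p = q :=
  congrArg Subtype.val ((X.isAcyclic.subsingleton_path u v).elim ⟨p, hp⟩ ⟨q, hq⟩)

/-- The grandparent also has smaller rank than `v`, so it is no closer to `v` than the parent. It is
not equally close either, since the tie would have been broken in its favour. Being strictly farther
from `v` than the parent is, it is by the ultrametric inequality also strictly farther from the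
parent than `v` is. -/
theorem ex_par_par_lt {v : Fin n} (hv : v ∈ X.A) (h : v ≠ X.root) (h' : X.par v ≠ X.root) :
    X.ex (X.par v) v < X.ex (X.par (X.par v)) (X.par v) := by
  have hp := X.par_mem v hv h
  have hpp := X.par_mem _ hp h'
  have h1 := X.rank_par_lt v hv h
  have h2 := X.rank_par_lt _ hp h'
  have h3 := X.ex_par_le v hv h _ hpp (h2.trans h1)
  have h4 := X.rank_par_le v hv h _ hpp (h2.trans h1)
  have h5 := X.ex_le_max (X.par (X.par v)) (X.par v) v
  rcases lt_or_eq_of_le h3 with h6 | h6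
  · rcases le_max_iff.1 h5 with h7 | h7
    · omega
    · omega
  · have := h4 h6.symm; omega

/-- The path from a vertex to the root. -/
theorem exists_path_root {K : ℕ} (hK : ∀ u v, X.ex u v ≤ K) (v : Fin n) (hv : v ∈ X.A) :
    ∃ p : X.toEmbedding.graph.Walk v X.root, p.IsPath ∧ (∀ x ∈ p.support, X.rank x ≤ X.rank v) ∧
      (v ≠ X.root → p.length + X.ex (X.par v) v ≤ K + 1) ∧ (v = X.root → p.length = 0) ∧
      (∀ e ∈ p.edges, 2 ^ X.ex (X.par v) v ≤ X.toEmbedding.wt e ∧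
        ∃ k, X.toEmbedding.wt e = 2 ^ k) ∧
      (p.edges.map X.toEmbedding.wt).Pairwise (· < ·) := by
  induction hk : X.rank v using Nat.strong_induction_on generalizing v with
  | _ k ih =>
    by_cases h : v = X.root
    · subst h
      exact ⟨.nil, by simp, by simp [hk], by simp, by simp, by simp, by simp⟩
    · have hlt := X.rank_par_lt v hv h
      have hp := X.par_mem v hv h
      obtain ⟨p, h1, h2, h3, h4, h5, h6⟩ := ih _ (hk ▸ hlt) (X.par v) hp rfl
      have hw : X.toEmbedding.wt s(v, X.par v) = 2 ^ X.ex (X.par v) v := by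
        rw [toEmbedding_wt, X.ex_comm]
      have hlt2 : ∀ e ∈ p.edges, 2 ^ X.ex (X.par v) v < X.toEmbedding.wt e := by
        intro e he
        have h' : X.par v ≠ X.root := by
          intro hr
          have hl := h4 hr
          rw [← p.length_edges] at hl
          simp [List.length_eq_zero_iff.1 hl] at he
        exact (Nat.pow_lt_pow_right (by omega) (X.ex_par_par_lt hv h h')).trans_le (h5 e he).1
      refine ⟨.cons (X.adj_par hv h) p, ?_, ?_, fun _ => ?_, fun h' => absurd h' h, ?_, ?_⟩
      · rw [SimpleGraph.Walk.cons_isPath_iff]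
        exact ⟨h1, fun hm => by have := h2 v hm; omega⟩
      · intro x hx
        rw [SimpleGraph.Walk.support_cons, List.mem_cons] at hx
        rcases hx with rfl | hx
        · omega
        · have := h2 x hx; omega
      -- The exponents strictly increase towards the root and never exceed `K`, which bounds the
      -- depth.
      · rw [SimpleGraph.Walk.length_cons]
        by_cases h' : X.par v = X.root
        · have := h4 h'; have := hK (X.par v) v; omega
        · have := h3 h'; have := X.ex_par_par_lt hv h h'; omega
      · intro e he
        rw [SimpleGraph.Walk.edges_cons, List.mem_cons] at he
        rcases he with rfl | he
        · exact ⟨hw.ge, _, hw⟩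
        · exact ⟨(hlt2 e he).le, (h5 e he).2⟩
      · rw [SimpleGraph.Walk.edges_cons, List.map_cons, List.pairwise_cons]
        refine ⟨fun b hb => ?_, h6⟩
        obtain ⟨e, he, rfl⟩ := List.mem_map.1 hb
        rw [hw]; exact hlt2 e he

theorem mem_of_walk_root {v : Fin n} (p : X.toEmbedding.graph.Walk v X.root) : v ∈ X.A := by
  cases p with
  | nil => exact X.root_mem
  | cons h p => exact TAdj.mem X h

theorem wellSeparated : X.toEmbedding.WellSeparated := by
  suffices key : ∀ (v : Fin n) (p : X.toEmbedding.graph.Walk X.root v), p.IsPath →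
      (∀ e ∈ p.edges, ∃ k : ℕ, X.toEmbedding.wt e = 2 ^ k) ∧
        (p.edges.map X.toEmbedding.wt).Pairwise (fun a b => b < a) from key
  intro v p hp
  have hv := X.mem_of_walk_root p.reverse
  -- The depth bound is not used here, so any upper bound for the exponents will do.
  have hK : ∀ u v, X.ex u v ≤ Finset.univ.sup fun x : Fin n × Fin n => X.ex x.1 x.2 :=
    fun u v => Finset.le_sup (f := fun x : Fin n × Fin n => X.ex x.1 x.2) (Finset.mem_univ (u, v))
  obtain ⟨q, h1, -, -, -, h5, h6⟩ := X.exists_path_root hK v hv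
  have hpq : p = q.reverse :=
    X.path_unique hp h1.reverse
  subst hpq
  simp only [SimpleGraph.Walk.edges_reverse, List.mem_reverse, List.map_reverse,
    List.pairwise_reverse]
  exact ⟨fun e he => (h5 e he).2, h6⟩

/-- In a tree the simple path is the loop erasure of the walk through the root, and each half of
that walk has at most `K + 1` edges. -/
theorem length_le_of_isPath {K : ℕ} (hK : ∀ u v, X.ex u v ≤ K) {u v : Fin n} (hu : u ∈ X.A)
    (hv : v ∈ X.A) (p : X.toEmbedding.graph.Walk u v) (hp : p.IsPath) : p.length ≤ 2 * (K + 1) := by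
  obtain ⟨q, -, -, h3, h4, -⟩ := X.exists_path_root hK u hu
  obtain ⟨q', -, -, h3', h4', -⟩ := X.exists_path_root hK v hv
  have hpq : p = (q.append q'.reverse).bypass := X.path_unique hp (q.append q'.reverse).bypass_isPath
  have h := (q.append q'.reverse).length_bypass_le_length
  rw [← hpq, SimpleGraph.Walk.length_append, SimpleGraph.Walk.length_reverse] at h
  by_cases hu' : u = X.root <;> by_cases hv' : v = X.root <;> grind

/-- The path from a vertex to the vertex of the least rank in its ball. -/
theorem exists_climb (e₀ : ℕ) (x : Fin n) (hx : x ∈ X.A) (v : Fin n) (hv : v ∈ X.A)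
    (hxv : X.ex x v ≤ e₀) (hmin : ∀ y ∈ X.A, X.ex y v ≤ e₀ → X.rank x ≤ X.rank y) :
    ∃ p : X.toEmbedding.graph.Walk v x, (p.edges.map X.toEmbedding.wt).sum ≤ 2 ^ (e₀ + 1) ∧
      (v ≠ x → (p.edges.map X.toEmbedding.wt).sum + 2 ^ X.ex (X.par v) v ≤ 2 ^ (e₀ + 1)) ∧
      (v = x → (p.edges.map X.toEmbedding.wt).sum = 0) := by
  induction hk : X.rank v using Nat.strong_induction_on generalizing v with
  | _ k ih =>
    by_cases h : v = x
    · subst h; exact ⟨.nil, by simp, by simp, by simp⟩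
    have hvv : X.ex v v ≤ e₀ := by
      have := X.ex_le_max v x v
      rw [X.ex_comm v x] at this; omega
    have hlt : X.rank x < X.rank v :=
      lt_of_le_of_ne (hmin v hv hvv) fun h' => h (X.rank_inj h').symm
    have hr : v ≠ X.root := by
      rintro rfl; have := X.root_le x; omega
    have hplt := X.rank_par_lt v hv hr
    have hp := X.par_mem v hv hr
    have hpe : X.ex (X.par v) v ≤ e₀ := (X.ex_par_le v hv hr x hx hlt).trans hxv
    have htr : ∀ y, X.ex y (X.par v) ≤ e₀ → X.ex y v ≤ e₀ := fun y hy =>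
      (X.ex_le_max y (X.par v) v).trans (max_le hy hpe)
    obtain ⟨p, h1, h2, h3⟩ := ih _ (hk ▸ hplt) (X.par v) hp
      ((X.ex_le_max x v (X.par v)).trans (max_le hxv (by rwa [X.ex_comm])))
      (fun y hy hye => hmin y hy (htr y hye)) rfl
    refine ⟨.cons (X.adj_par hv hr) p, ?_⟩
    have hw : X.toEmbedding.wt s(v, X.par v) = 2 ^ X.ex (X.par v) v := by
      rw [toEmbedding_wt, X.ex_comm]
    -- Geometric summation: the induction hypothesis leaves a slack as large as the weight of the
    -- next edge upwards. This weight is at least twice that of the new edge, so the slack pays for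
    -- the new edge and leaves as much again.
    have key : 2 ^ X.ex (X.par v) v + (p.edges.map X.toEmbedding.wt).sum +
        2 ^ X.ex (X.par v) v ≤ 2 ^ (e₀ + 1) := by
      by_cases hpx : X.par v = x
      · rw [h3 hpx]
        have : 2 ^ X.ex (X.par v) v ≤ 2 ^ e₀ := Nat.pow_le_pow_right (by omega) hpe
        rw [pow_succ]; omega
      · have h4 := h2 hpx
        have h' : X.par v ≠ X.root := by
          intro h'
          have h5 := X.root_le x
          have h6 := hmin _ hp hpe
          exact hpx (X.rank_inj (by rw [h'] at h6 ⊢; omega))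
        have h7 : 2 ^ (X.ex (X.par v) v + 1) ≤ 2 ^ X.ex (X.par (X.par v)) (X.par v) :=
          Nat.pow_le_pow_right (by omega) (X.ex_par_par_lt hv hr h')
        rw [pow_succ] at h7; omega
    simp only [SimpleGraph.Walk.edges_cons, List.map_cons, List.sum_cons, hw]
    exact ⟨by omega, fun _ => by omega, fun h' => absurd h' h⟩

/-- Both vertices climb to the vertex of least rank in their common ultrametric ball. Each climb is
a geometric sum that is at most twice the radius of the ball. -/
theorem dist_le {u v : Fin n} (hu : u ∈ X.A) (hv : v ∈ X.A) :
    X.toEmbedding.dist u v ≤ ((4 * 2 ^ X.ex u v : ℕ) : ℝ≥0∞) := by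
  classical
  obtain ⟨x, hx, hmin⟩ := (Finset.univ.filter fun y => y ∈ X.A ∧ X.ex y v ≤ X.ex u v).exists_min_image
    X.rank ⟨u, by simp [hu]⟩
  simp only [Finset.mem_filter, Finset.mem_univ, true_and] at hx hmin
  obtain ⟨p, hp, -⟩ := X.exists_climb (X.ex u v) x hx.1 v hv hx.2 fun y h1 h2 => hmin y ⟨h1, h2⟩
  obtain ⟨q, hq, -⟩ := X.exists_climb (X.ex u v) x hx.1 u hu
    ((X.ex_le_max x v u).trans (max_le hx.2 (X.ex_comm v u).le)) fun y h1 h2 =>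
      hmin y ⟨h1, (X.ex_le_max y u v).trans (max_le h2 le_rfl)⟩
  refine (iInf_le _ (q.append p.reverse)).trans (Nat.cast_le.2 ?_)
  refine (pathWeight_le_sum _ _).trans ?_
  simp only [SimpleGraph.Walk.edges_append, SimpleGraph.Walk.edges_reverse, List.map_append,
    List.map_reverse, List.sum_append, List.sum_reverse]
  rw [pow_succ] at hp hq; omega

end TreeData

namespace PartialTreeEmbedding

variable {n : ℕ} {G : WGraph n} (T : PartialTreeEmbedding G)

theorem dist_self (u : Fin n) : T.dist u u = 0 :=
  le_antisymm ((iInf_le _ .nil).trans (by simp [pathWeight])) zero_le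

theorem length_toG_le {H : ℕ} (hH : ∀ {u v} (e : T.tree.Adj u v), (T.path e).length ≤ H) :
    ∀ {u v : Fin n} (p : T.graph.Walk u v), (T.toG p).length ≤ p.length * H
  | _, _, .nil => by simp [toG]
  | _, _, .cons e p => by
    have h1 := hH (show T.tree.Adj _ _ from e)
    have h2 := length_toG_le hH p
    simp only [toG, SimpleGraph.Walk.length_append, SimpleGraph.Walk.length_cons]
    linarith

theorem pathWeight_toG_le : ∀ {u v : Fin n} (p : T.graph.Walk u v),
    pathWeight G.w (T.toG p) ≤ (p.edges.map T.wt).sum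
  | _, _, .nil => by simp [toG, pathWeight]
  | _, _, .cons e p => by
    have h1 := T.path_weight_le (show T.tree.Adj _ _ from e)
    have h2 := pathWeight_toG_le p
    simp only [toG, SimpleGraph.Walk.edges_cons, List.map_cons, List.sum_cons]
    refine le_trans ?_ (add_le_add h1 h2)
    unfold pathWeight
    rw [SimpleGraph.Walk.edges_append, List.toFinset_append]
    have := Finset.sum_union_inter (f := G.w)
      (s₁ := (T.path (show T.tree.Adj _ _ from e)).edges.toFinset)
      (s₂ := (T.toG p).edges.toFinset)
    omega

/-- It suffices to treat simple tree walks: the hop bound applies to them, and for them the weight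
over the set of edges equals the sum along the walk. -/
theorem hopDist_le_dist {t : ℝ} {u v : Fin n}
    (h : ∀ p : T.graph.Walk u v, p.IsPath → ((T.toG p).length : ℝ) ≤ t) :
    G.hopDist t u v ≤ T.dist u v := by
  refine le_iInf fun p => ?_
  refine (iInf₂_le (T.toG p.bypass) (h _ p.bypass_isPath)).trans (Nat.cast_le.2 ?_)
  refine (T.pathWeight_toG_le _).trans ?_
  rw [← pathWeight_eq_sum _ p.bypass_isPath]
  unfold pathWeight
  exact Finset.sum_le_sum_of_subset fun e he => by
    rw [List.mem_toFinset] at he ⊢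
    exact p.edges_bypass_subset_edges he

end PartialTreeEmbedding

end HopEmbed

namespace HopEmbed

/-! ### Averages over coin tapes -/

/-- Put a coin in front of a tape. -/
def tapeCons (b : Bool) (ω : ℕ → Bool) : ℕ → Bool
  | 0 => b
  | i + 1 => ω i

@[simp] theorem tapeCons_zero (b : Bool) (ω : ℕ → Bool) : tapeCons b ω 0 = b := rfl
@[simp] theorem tapeCons_succ (b : Bool) (ω : ℕ → Bool) (i : ℕ) : tapeCons b ω (i + 1) = ω i := rfl

/-- The average over `B` fair coins. -/
noncomputable def coinAvg : ℕ → ((ℕ → Bool) → ℝ) → ℝ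
  | 0, F => F fun _ => false
  | B + 1, F => (coinAvg B (fun ω => F (tapeCons false ω)) +
      coinAvg B (fun ω => F (tapeCons true ω))) / 2

open Classical in
/-- The probability of an event under `B` fair coins. -/
noncomputable def coinProb (B : ℕ) (P : (ℕ → Bool) → Prop) : ℝ :=
  coinAvg B fun ω => if P ω then 1 else 0

/-- The first `a` coins of `ω`, followed by `ω'`. -/
def tapeGlue : ℕ → (ℕ → Bool) → (ℕ → Bool) → ℕ → Bool
  | 0, _, ω' => ω'
  | a + 1, ω, ω' => tapeCons (ω 0) (tapeGlue a (fun i => ω (i + 1)) ω')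

theorem tapeGlue_lt {a i : ℕ} (ω ω' : ℕ → Bool) (h : i < a) : tapeGlue a ω ω' i = ω i := by
  induction a generalizing ω i with
  | zero => omega
  | succ a ih =>
    cases i with
    | zero => rfl
    | succ i => exact ih _ (by omega)

theorem tapeGlue_add (a i : ℕ) (ω ω' : ℕ → Bool) : tapeGlue a ω ω' (a + i) = ω' i := by
  induction a generalizing ω with
  | zero => simp [tapeGlue]
  | succ a ih => rw [Nat.add_right_comm]; exact ih _

theorem coinTape_cons {B : ℕ} (b : Bool) (ρ : Fin B → Bool) :
    coinTape (Fin.cons b ρ : Fin (B + 1) → Bool) = tapeCons b (coinTape ρ) := by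
  funext i
  cases i with
  | zero => simp [coinTape]
  | succ i =>
    simp only [coinTape, tapeCons_succ, add_lt_add_iff_right]
    split_ifs with h
    · exact Fin.cons_succ (α := fun _ => Bool) b ρ ⟨i, h⟩
    · rfl

/-- The recursive definition is suited to inductions on the coins; this form gives linearity and
monotonicity, and it matches the uniform distribution in the specification. -/
theorem coinAvg_eq_sum (B : ℕ) (F : (ℕ → Bool) → ℝ) :
    coinAvg B F = (∑ ρ : Fin B → Bool, F (coinTape ρ)) / 2 ^ B := by
  induction B generalizing F with
  | zero =>
    have : ∀ ρ : Fin 0 → Bool, coinTape ρ = fun _ => false := fun ρ => by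
      funext i; simp [coinTape]
    simp only [coinAvg, this]
    simp
  | succ B ih =>
    rw [coinAvg, ih, ih, ← (Fin.consEquiv fun _ : Fin (B + 1) => Bool).sum_comp,
      Fintype.sum_prod_type]
    have h : ∀ (b : Bool) (ρ : Fin B → Bool),
        coinTape ((Fin.consEquiv fun _ : Fin (B + 1) => Bool) (b, ρ)) = tapeCons b (coinTape ρ) :=
      coinTape_cons
    simp only [h, Fintype.sum_bool]
    rw [pow_succ]; field_simp; ring

theorem coinAvg_mono {B : ℕ} {F H : (ℕ → Bool) → ℝ} (h : ∀ ω, F ω ≤ H ω) :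
    coinAvg B F ≤ coinAvg B H := by
  simp only [coinAvg_eq_sum]
  gcongr with ρ
  exact h _

theorem coinAvg_add (B : ℕ) (F H : (ℕ → Bool) → ℝ) :
    coinAvg B (fun ω => F ω + H ω) = coinAvg B F + coinAvg B H := by
  simp only [coinAvg_eq_sum, Finset.sum_add_distrib, add_div]

theorem coinAvg_const (B : ℕ) (c : ℝ) : coinAvg B (fun _ => c) = c := by
  induction B with
  | zero => rfl
  | succ B ih => simp [coinAvg, ih]

theorem coinAvg_mul_const (B : ℕ) (F : (ℕ → Bool) → ℝ) (c : ℝ) :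
    coinAvg B (fun ω => F ω * c) = coinAvg B F * c := by
  simp only [coinAvg_eq_sum, ← Finset.sum_mul]; ring

theorem coinAvg_const_mul (B : ℕ) (F : (ℕ → Bool) → ℝ) (c : ℝ) :
    coinAvg B (fun ω => c * F ω) = c * coinAvg B F := by
  simp only [coinAvg_eq_sum, ← Finset.mul_sum]; ring

theorem coinAvg_sum {ι : Type*} (B : ℕ) (s : Finset ι) (F : ι → (ℕ → Bool) → ℝ) :
    coinAvg B (fun ω => ∑ i ∈ s, F i ω) = ∑ i ∈ s, coinAvg B (F i) := by
  simp only [coinAvg_eq_sum, ← Finset.sum_div]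
  rw [Finset.sum_comm]

/-- Fubini for the coins: every use of independence goes through this identity. -/
theorem coinAvg_glue (a b : ℕ) (F : (ℕ → Bool) → ℝ) :
    coinAvg (a + b) F = coinAvg a fun ω => coinAvg b fun ω' => F (tapeGlue a ω ω') := by
  induction a generalizing F with
  | zero => simp [coinAvg, tapeGlue]
  | succ a ih =>
    rw [Nat.add_right_comm, coinAvg, coinAvg, ih, ih]
    rfl

theorem coinAvg_drop (a b : ℕ) (F : (ℕ → Bool) → ℝ) :
    coinAvg (a + b) (fun ω => F fun i => ω (a + i)) = coinAvg b F := by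
  rw [coinAvg_glue]
  simp only [tapeGlue_add]
  exact coinAvg_const a _

theorem coinAvg_take (a b : ℕ) (F : (ℕ → Bool) → ℝ)
    (hF : ∀ ω ω', (∀ i < a, ω i = ω' i) → F ω = F ω') : coinAvg (a + b) F = coinAvg a F := by
  rw [coinAvg_glue]
  congr 1; funext ω
  rw [← coinAvg_const b (F ω)]
  congr 1; funext ω'
  exact hF _ _ fun i hi => tapeGlue_lt _ _ hi

theorem ite_one_zero_nonneg {P : Prop} {_ : Decidable P} : (0 : ℝ) ≤ if P then 1 else 0 := by
  split_ifs <;> norm_num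

theorem coinProb_mono {B : ℕ} {P R : (ℕ → Bool) → Prop} (h : ∀ ω, P ω → R ω) :
    coinProb B P ≤ coinProb B R :=
  coinAvg_mono fun ω => by
    by_cases hP : P ω
    · simp [hP, h ω hP]
    · simp only [hP, if_false]; split_ifs <;> norm_num

theorem coinProb_nonneg (B : ℕ) (P : (ℕ → Bool) → Prop) : 0 ≤ coinProb B P := by
  unfold coinProb
  exact (coinAvg_const B 0).symm.le.trans (coinAvg_mono fun ω => by split_ifs <;> simp)

theorem coinProb_le_one (B : ℕ) (P : (ℕ → Bool) → Prop) : coinProb B P ≤ 1 := by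
  unfold coinProb
  conv_rhs => rw [← coinAvg_const B 1]
  exact coinAvg_mono fun ω => by split_ifs <;> simp

theorem coinProb_or_le (B : ℕ) (P R : (ℕ → Bool) → Prop) :
    coinProb B (fun ω => P ω ∨ R ω) ≤ coinProb B P + coinProb B R := by
  unfold coinProb
  rw [← coinAvg_add]
  exact coinAvg_mono fun ω => by split_ifs <;> simp_all

theorem coinProb_not (B : ℕ) (P : (ℕ → Bool) → Prop) :
    coinProb B (fun ω => ¬ P ω) = 1 - coinProb B P := by
  have : coinProb B (fun ω => ¬ P ω) + coinProb B P = 1 := by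
    unfold coinProb
    rw [← coinAvg_add]
    refine Eq.trans ?_ (coinAvg_const B 1)
    congr 1; funext ω
    by_cases hP : P ω <;> simp [hP]
  linarith

theorem coinProb_exists_le {B N : ℕ} {P : ℕ → (ℕ → Bool) → Prop} {c : ℝ}
    (h : ∀ i < N, coinProb B (P i) ≤ c) :
    coinProb B (fun ω => ∃ i < N, P i ω) ≤ N * c := by
  classical
  calc coinProb B (fun ω => ∃ i < N, P i ω)
      ≤ ∑ i ∈ Finset.range N, coinProb B (P i) := by
        unfold coinProb
        rw [← coinAvg_sum]
        refine coinAvg_mono fun ω => ?_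
        split_ifs with hi
        · obtain ⟨i, hi, hP⟩ := hi
          refine le_trans ?_ (Finset.single_le_sum (f := fun i => if P i ω then (1 : ℝ) else 0)
            (fun i _ => by split_ifs <;> simp) (Finset.mem_range.2 hi))
          simp [hP]
        · exact Finset.sum_nonneg fun i _ => by split_ifs <;> simp
    _ ≤ ∑ i ∈ Finset.range N, c := Finset.sum_le_sum fun i hi => h i (Finset.mem_range.1 hi)
    _ = N * c := by simp

theorem coinProb_drop (a b : ℕ) (P : (ℕ → Bool) → Prop) :
    coinProb (a + b) (fun ω => P fun i => ω (a + i)) = coinProb b P :=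
  coinAvg_drop a b fun ω => open Classical in if P ω then 1 else 0

theorem coinProb_take (a b : ℕ) (P : (ℕ → Bool) → Prop)
    (hP : ∀ ω ω', (∀ i < a, ω i = ω' i) → P ω → P ω') : coinProb (a + b) P = coinProb a P :=
  coinAvg_take a b _ fun ω ω' h => by
    have : P ω ↔ P ω' := ⟨hP _ _ h, hP _ _ fun i hi => (h i hi).symm⟩
    by_cases h : P ω
    · simp [h, this.1 h]
    · simp [h, mt this.2 h]

/-! ### Random radii -/

/-- The number with the binary digits `ω 0, …, ω (t - 1)`. -/
def tapeBits : ℕ → (ℕ → Bool) → ℕ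
  | 0, _ => 0
  | t + 1, ω => 2 * tapeBits t ω + (ω t).toNat

/-- The number of leading ones among `ω 0, …, ω (m - 1)`. -/
def tapeHeads : ℕ → (ℕ → Bool) → ℕ
  | 0, _ => 0
  | m + 1, ω => if ω 0 = true then tapeHeads m (fun i => ω (i + 1)) + 1 else 0

/-- A radius: uniform on an interval of length `2 ^ Q`, plus a geometric multiple of `2 ^ Q`. -/
def tapeRadius (Q m : ℕ) (ω : ℕ → Bool) : ℕ :=
  tapeBits Q ω + 2 ^ Q * (tapeHeads m (fun i => ω (Q + i)) + 1)

theorem tapeHeads_cons (m : ℕ) (b : Bool) (ω : ℕ → Bool) :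
    tapeHeads (m + 1) (tapeCons b ω) = if b = true then tapeHeads m ω + 1 else 0 := rfl

theorem tapeBits_congr {t : ℕ} {ω ω' : ℕ → Bool} (h : ∀ i < t, ω i = ω' i) :
    tapeBits t ω = tapeBits t ω' := by
  induction t with
  | zero => rfl
  | succ t ih => rw [tapeBits, tapeBits, ih fun i hi => h i (by omega), h t (by omega)]

theorem tapeHeads_congr {t : ℕ} {ω ω' : ℕ → Bool} (h : ∀ i < t, ω i = ω' i) :
    tapeHeads t ω = tapeHeads t ω' := by
  induction t generalizing ω ω' with
  | zero => rfl
  | succ t ih =>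
    rw [tapeHeads, tapeHeads, h 0 (by omega)]
    rw [ih fun i hi => h (i + 1) (by omega)]

theorem tapeRadius_congr {Q m : ℕ} {ω ω' : ℕ → Bool} (h : ∀ i < Q + m, ω i = ω' i) :
    tapeRadius Q m ω = tapeRadius Q m ω' := by
  rw [tapeRadius, tapeRadius, tapeBits_congr fun i hi => h i (by omega),
    tapeHeads_congr fun i hi => h (Q + i) (by omega)]

theorem tapeBits_lt (t : ℕ) (ω : ℕ → Bool) : tapeBits t ω < 2 ^ t := by
  induction t with
  | zero => simp [tapeBits]
  | succ t ih =>
    have := Bool.toNat_lt (ω t)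
    rw [tapeBits, pow_succ]; omega

theorem tapeHeads_le (m : ℕ) (ω : ℕ → Bool) : tapeHeads m ω ≤ m := by
  induction m generalizing ω with
  | zero => simp [tapeHeads]
  | succ m ih =>
    rw [tapeHeads]
    split_ifs
    · have := ih fun i => ω (i + 1)
      omega
    · omega

/-- The definition peels off the first coin, as the probability estimates require, whereas the
program extends the count at the end. This lemma connects the two. -/
theorem tapeHeads_succ (m : ℕ) (ω : ℕ → Bool) :
    tapeHeads (m + 1) ω = tapeHeads m ω + if ∀ i ≤ m, ω i = true then 1 else 0 := by
  induction m generalizing ω with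
  | zero => simp [tapeHeads]
  | succ m ih =>
    rw [tapeHeads, ih, tapeHeads]
    by_cases h : ω 0 = true
    · have : (∀ i ≤ m + 1, ω i = true) ↔ ∀ i ≤ m, ω (i + 1) = true := by
        constructor
        · exact fun h i hi => h (i + 1) (by omega)
        · intro h' i hi
          cases i with
          | zero => exact h
          | succ i => exact h' i (by omega)
      simp only [h, if_true, this]; ring
    · have : ¬ ∀ i ≤ m + 1, ω i = true := fun h' => h (h' 0 (by omega))
      simp [h, this]

/-- For the uniform part the situation is reversed: the definition follows the program, and the
probabilistic induction needs the leading digit split off. -/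
theorem tapeBits_cons (t : ℕ) (b : Bool) (ω : ℕ → Bool) :
    tapeBits (t + 1) (tapeCons b ω) = b.toNat * 2 ^ t + tapeBits t ω := by
  induction t with
  | zero => simp [tapeBits]
  | succ t ih => rw [tapeBits, ih, tapeBits, tapeCons_succ, pow_succ]; ring

theorem le_tapeRadius (Q m : ℕ) (ω : ℕ → Bool) : 2 ^ Q ≤ tapeRadius Q m ω := by
  unfold tapeRadius; nlinarith [Nat.zero_le (2 ^ Q * tapeHeads m fun i => ω (Q + i))]

theorem tapeRadius_lt (Q m : ℕ) (ω : ℕ → Bool) : tapeRadius Q m ω < 2 ^ Q * (m + 2) := by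
  have h1 := tapeBits_lt Q ω
  have h2 := tapeHeads_le m fun i => ω (Q + i)
  unfold tapeRadius
  calc _ < 2 ^ Q + 2 ^ Q * (tapeHeads m (fun i => ω (Q + i)) + 1) := by omega
    _ ≤ 2 ^ Q + 2 ^ Q * (m + 1) := by gcongr
    _ = _ := by ring

theorem coinProb_false (B : ℕ) : coinProb B (fun _ => False) = 0 := by
  simpa [coinProb] using coinAvg_const B 0

theorem coinProb_true (B : ℕ) : coinProb B (fun _ => True) = 1 := by
  simpa [coinProb] using coinAvg_const B 1

theorem coinProb_succ (B : ℕ) (P : (ℕ → Bool) → Prop) :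
    coinProb (B + 1) P = (coinProb B (fun ω => P (tapeCons false ω)) +
      coinProb B (fun ω => P (tapeCons true ω))) / 2 := rfl

theorem coinProb_tapeBits_eq_le (Q u : ℕ) :
    coinProb Q (fun ω => tapeBits Q ω = u) ≤ 1 / 2 ^ Q := by
  induction Q generalizing u with
  | zero => simpa using coinProb_le_one 0 _
  | succ Q ih =>
    rw [coinProb_succ]
    simp only [tapeBits_cons, Bool.toNat_false, Bool.toNat_true, zero_mul, zero_add, one_mul]
    have h2 : (1 : ℝ) / 2 ^ (Q + 1) = 1 / 2 ^ Q / 2 := by rw [pow_succ]; field_simp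
    rw [h2]
    gcongr
    -- Only one value of the leading digit is compatible with `u`.
    by_cases hu : u < 2 ^ Q
    · have : coinProb Q (fun ω => 2 ^ Q + tapeBits Q ω = u) ≤ 0 := by
        rw [← coinProb_false Q]; exact coinProb_mono fun ω h => by omega
      linarith [ih u]
    · have : coinProb Q (fun ω => tapeBits Q ω = u) ≤ 0 := by
        rw [← coinProb_false Q]
        exact coinProb_mono fun ω h => by have := tapeBits_lt Q ω; omega
      have : coinProb Q (fun ω => 2 ^ Q + tapeBits Q ω = u) ≤
          coinProb Q (fun ω => tapeBits Q ω = u - 2 ^ Q) := coinProb_mono fun ω h => by omega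
      linarith [ih (u - 2 ^ Q)]

/-- After `j` heads, stopping and going on are equally likely. The truncation after `m` coins
violates this only at `j = m`, and that value has probability `1 / 2 ^ m`. -/
theorem coinProb_tapeHeads_eq_le (m j : ℕ) :
    coinProb m (fun ω => tapeHeads m ω = j) ≤
      coinProb m (fun ω => j + 1 ≤ tapeHeads m ω) + 1 / 2 ^ m := by
  induction m generalizing j with
  | zero =>
    have h1 := coinProb_le_one 0 fun ω => tapeHeads 0 ω = j
    have h2 := coinProb_nonneg 0 fun ω => j + 1 ≤ tapeHeads 0 ω
    simp only [pow_zero, div_one]; linarith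
  | succ m ih =>
    have h2 : (1 : ℝ) / 2 ^ (m + 1) = 1 / 2 ^ m / 2 := by rw [pow_succ]; field_simp
    rw [coinProb_succ, coinProb_succ, h2]
    simp only [tapeHeads_cons, if_true, Bool.false_eq_true, if_false]
    cases j with
    | zero =>
      have h4 : coinProb m (fun ω => tapeHeads m ω + 1 = 0) ≤ 0 := by
        rw [← coinProb_false m]; exact coinProb_mono fun ω h => by omega
      have h6 : 1 ≤ coinProb m (fun ω => 0 + 1 ≤ tapeHeads m ω + 1) := by
        rw [← coinProb_true m]; exact coinProb_mono fun ω h => by omega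
      refine (div_le_div_of_nonneg_right (add_le_add (coinProb_le_one m _) h4) two_pos.le).trans ?_
      rw [← add_div]
      refine div_le_div_of_nonneg_right ?_ two_pos.le
      refine le_trans ?_ (add_le_add (add_le_add (coinProb_nonneg m _) h6)
        (show (0 : ℝ) ≤ 1 / 2 ^ m by positivity))
      norm_num
    | succ j =>
      have h3 := ih j
      have h4 : coinProb m (fun _ => 0 = j + 1) ≤ 0 := by
        rw [← coinProb_false m]; exact coinProb_mono fun ω h => by omega
      have h5 := coinProb_nonneg m fun _ => j + 1 + 1 ≤ 0
      have h6 : coinProb m (fun ω => tapeHeads m ω + 1 = j + 1) ≤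
          coinProb m (fun ω => tapeHeads m ω = j) := coinProb_mono fun ω h => by omega
      have h7 : coinProb m (fun ω => j + 1 ≤ tapeHeads m ω) ≤
        coinProb m (fun ω => j + 1 + 1 ≤ tapeHeads m ω + 1) := coinProb_mono fun ω h => by omega
      linarith

/-- The radius has a bounded hazard rate. -/
theorem coinProb_tapeRadius_eq_le (Q m k : ℕ) :
    coinProb (Q + m) (fun ω => tapeRadius Q m ω = k) ≤
      1 / 2 ^ Q * (coinProb (Q + m) (fun ω => k ≤ tapeRadius Q m ω) + 1 / 2 ^ m) := by
  have hS : 0 < 2 ^ Q := by positivity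
  have h0 : (0 : ℝ) ≤ 1 / 2 ^ Q := by positivity
  obtain hk | ⟨j, hj⟩ : k < 2 ^ Q ∨ ∃ j, k / 2 ^ Q = j + 1 := by
    rcases Nat.eq_zero_or_pos (k / 2 ^ Q) with h | h
    · exact .inl ((Nat.div_eq_zero_iff_lt hS).1 h)
    · exact .inr ⟨_, (Nat.sub_add_cancel h).symm⟩
  · have h1 : coinProb (Q + m) (fun ω => tapeRadius Q m ω = k) ≤ 0 := by
      rw [← coinProb_false (Q + m)]
      exact coinProb_mono fun ω h => by have := le_tapeRadius Q m ω; omega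
    have h2 := coinProb_nonneg (Q + m) fun ω => k ≤ tapeRadius Q m ω
    have h3 : (0 : ℝ) ≤ 1 / 2 ^ m := by positivity
    exact h1.trans (mul_nonneg h0 (by linarith))
  have hdm := Nat.div_add_mod k (2 ^ Q)
  have hml := Nat.mod_lt k hS
  rw [hj] at hdm
  -- The value `k` determines both parts of the radius by division with remainder, and the two parts
  -- use different coins.
  have e1 : coinProb (Q + m) (fun ω => tapeRadius Q m ω = k) ≤
      coinProb Q (fun ω => tapeBits Q ω = k % 2 ^ Q) * coinProb m (fun ω => tapeHeads m ω = j) := by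
    unfold coinProb
    rw [← coinAvg_mul_const, coinAvg_glue]
    refine coinAvg_mono fun ω => ?_
    rw [← coinAvg_const_mul]
    refine coinAvg_mono fun ω' => ?_
    have hU : tapeBits Q (tapeGlue Q ω ω') = tapeBits Q ω :=
      tapeBits_congr fun i hi => tapeGlue_lt _ _ hi
    have hH : tapeHeads m (fun i => tapeGlue Q ω ω' (Q + i)) = tapeHeads m ω' :=
      tapeHeads_congr fun i _ => tapeGlue_add _ _ _ _
    beta_reduce
    unfold tapeRadius
    rw [hU, hH]
    by_cases hr : tapeBits Q ω + 2 ^ Q * (tapeHeads m ω' + 1) = k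
    · have hb : tapeBits Q ω = k % 2 ^ Q := by
        rw [← hr, Nat.add_mul_mod_self_left, Nat.mod_eq_of_lt (tapeBits_lt Q ω)]
      have hh : tapeHeads m ω' = j := by
        rw [← hr, Nat.add_mul_div_left _ _ hS, Nat.div_eq_of_lt (tapeBits_lt Q ω)] at hj
        omega
      rw [if_pos hr, if_pos hb, if_pos hh, mul_one]
    · rw [if_neg hr]
      exact mul_nonneg ite_one_zero_nonneg ite_one_zero_nonneg
  -- One head more than needed for `k` lifts the radius above `k`, whatever the uniform part is.
  have e2 : coinProb m (fun ω => j + 1 ≤ tapeHeads m ω) ≤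
      coinProb (Q + m) (fun ω => k ≤ tapeRadius Q m ω) := by
    rw [← coinProb_drop Q m]
    refine coinProb_mono fun ω h => ?_
    unfold tapeRadius
    have : 2 ^ Q * (j + 1 + 1) ≤ 2 ^ Q * (tapeHeads m (fun i => ω (Q + i)) + 1) := by gcongr
    have : 2 ^ Q * (j + 1 + 1) = 2 ^ Q * (j + 1) + 2 ^ Q := by ring
    omega
  calc _ ≤ _ := e1
    _ ≤ 1 / 2 ^ Q * (coinProb m (fun ω => j + 1 ≤ tapeHeads m ω) + 1 / 2 ^ m) :=
      mul_le_mul (coinProb_tapeBits_eq_le _ _) (coinProb_tapeHeads_eq_le _ _)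
        (coinProb_nonneg _ _) h0
    _ ≤ _ := by gcongr

/-- The pointwise hazard bounds are added over the values of the interval; each tail event is
contained in the one for `x`. -/
theorem coinProb_tapeRadius_mem_le (Q m x ρ : ℕ) :
    coinProb (Q + m) (fun ω => x ≤ tapeRadius Q m ω ∧ tapeRadius Q m ω < x + ρ) ≤
      ρ / 2 ^ Q * (coinProb (Q + m) (fun ω => x ≤ tapeRadius Q m ω) + 1 / 2 ^ m) := by
  induction ρ with
  | zero =>
    simp only [Nat.cast_zero, zero_div, zero_mul]
    rw [← coinProb_false (Q + m)]
    exact coinProb_mono fun ω h => by omega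
  | succ ρ ih =>
    calc _ ≤ coinProb (Q + m) (fun ω => (x ≤ tapeRadius Q m ω ∧ tapeRadius Q m ω < x + ρ) ∨
          tapeRadius Q m ω = x + ρ) := coinProb_mono fun ω h => by omega
      _ ≤ _ := coinProb_or_le _ _ _
      _ ≤ _ := add_le_add ih (coinProb_tapeRadius_eq_le Q m (x + ρ))
      _ ≤ ρ / 2 ^ Q * (coinProb (Q + m) (fun ω => x ≤ tapeRadius Q m ω) + 1 / 2 ^ m) +
          1 / 2 ^ Q * (coinProb (Q + m) (fun ω => x ≤ tapeRadius Q m ω) + 1 / 2 ^ m) := by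
        gcongr
        exact coinProb_mono fun ω h => by omega
      _ = _ := by push_cast; ring

/-- The probability that, in a sequence of balls, the first ball with radius at least `lo` has
radius less than `hi`. -/
theorem coinProb_cut_le (Q m ρ N : ℕ) (lo hi : ℕ → ℕ) (h : ∀ j, hi j ≤ lo j + ρ) :
    coinProb (N * (Q + m)) (fun ω => ∃ j < N,
        lo j ≤ tapeRadius Q m (fun i => ω (j * (Q + m) + i)) ∧
        tapeRadius Q m (fun i => ω (j * (Q + m) + i)) < hi j ∧
        ∀ j' < j, tapeRadius Q m (fun i => ω (j' * (Q + m) + i)) < lo j') ≤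
      ρ / 2 ^ Q * (1 + N / 2 ^ m) := by
  induction N generalizing lo hi with
  | zero =>
    refine le_trans (b := (0 : ℝ)) ?_ (by positivity)
    rw [← coinProb_false (0 * (Q + m))]
    exact coinProb_mono fun ω h => by obtain ⟨j, hj, -⟩ := h; omega
  | succ N ih =>
    specialize ih (fun j => lo (j + 1)) (fun j => hi (j + 1)) (fun j => h _)
    set E : (ℕ → Bool) → Prop := fun ω => ∃ j < N,
        lo (j + 1) ≤ tapeRadius Q m (fun i => ω (j * (Q + m) + i)) ∧
        tapeRadius Q m (fun i => ω (j * (Q + m) + i)) < hi (j + 1) ∧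
        ∀ j' < j, tapeRadius Q m (fun i => ω (j' * (Q + m) + i)) < lo (j' + 1)
    set p := coinProb (N * (Q + m)) E
    set t := coinProb (Q + m) fun ω => lo 0 ≤ tapeRadius Q m ω
    have hcomp : coinProb (Q + m) (fun ω => tapeRadius Q m ω < lo 0) = 1 - t := by
      rw [← coinProb_not]; simp only [not_le]
    have hcut := coinProb_tapeRadius_mem_le Q m (lo 0) ρ
    -- Conditioning on the first ball: either it reaches its threshold and decides, or it falls
    -- short and the other balls, which use fresh coins, are in the situation of the induction
    -- hypothesis.
    have key : coinProb ((N + 1) * (Q + m)) (fun ω => ∃ j < N + 1,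
        lo j ≤ tapeRadius Q m (fun i => ω (j * (Q + m) + i)) ∧
        tapeRadius Q m (fun i => ω (j * (Q + m) + i)) < hi j ∧
        ∀ j' < j, tapeRadius Q m (fun i => ω (j' * (Q + m) + i)) < lo j') ≤
        coinProb (Q + m) (fun ω => lo 0 ≤ tapeRadius Q m ω ∧ tapeRadius Q m ω < lo 0 + ρ) +
        coinProb (Q + m) (fun ω => tapeRadius Q m ω < lo 0) * p := by
      rw [add_mul N, one_mul, add_comm (N * (Q + m))]
      unfold coinProb
      rw [coinAvg_glue, ← coinAvg_mul_const, ← coinAvg_add]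
      refine coinAvg_mono fun ω => ?_
      simp only [p]
      unfold coinProb
      rw [← coinAvg_const_mul]
      refine le_of_le_of_eq ?_ (congrArg (· + _) (coinAvg_const (N * (Q + m)) _))
      rw [← coinAvg_add]
      refine coinAvg_mono fun ω' => ?_
      have h0 : tapeRadius Q m (fun i => tapeGlue (Q + m) ω ω' (0 * (Q + m) + i)) =
          tapeRadius Q m ω := tapeRadius_congr fun i hi => by
        rw [zero_mul, zero_add]; exact tapeGlue_lt _ _ hi
      have hs : ∀ j, tapeRadius Q m (fun i => tapeGlue (Q + m) ω ω' ((j + 1) * (Q + m) + i)) =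
          tapeRadius Q m (fun i => ω' (j * (Q + m) + i)) := fun j =>
        tapeRadius_congr fun i _ => by
          rw [add_mul, one_mul, add_comm (j * (Q + m)), add_assoc]
          exact tapeGlue_add _ _ _ _
      by_cases hE : ∃ j < N + 1,
        lo j ≤ tapeRadius Q m (fun i => tapeGlue (Q + m) ω ω' (j * (Q + m) + i)) ∧
        tapeRadius Q m (fun i => tapeGlue (Q + m) ω ω' (j * (Q + m) + i)) < hi j ∧
        ∀ j' < j, tapeRadius Q m (fun i => tapeGlue (Q + m) ω ω' (j' * (Q + m) + i)) < lo j'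
      · rw [if_pos hE]
        obtain ⟨j, hj, ha, hb, hc⟩ := hE
        cases j with
        | zero =>
          rw [h0] at ha hb
          rw [if_pos ⟨ha, hb.trans_le (h 0)⟩]
          exact le_add_of_nonneg_right
            (mul_nonneg ite_one_zero_nonneg ite_one_zero_nonneg)
        | succ j =>
          have hE' : E ω' := ⟨j, by omega, by rwa [hs] at ha, by rwa [hs] at hb, fun j' hj' => by
            have := hc (j' + 1) (by omega)
            rwa [hs] at this⟩
          have hR : tapeRadius Q m ω < lo 0 := h0 ▸ hc 0 (by omega)
          rw [if_pos hR, if_pos hE', mul_one]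
          exact le_add_of_nonneg_left ite_one_zero_nonneg
      · rw [if_neg hE]
        exact add_nonneg ite_one_zero_nonneg
          (mul_nonneg ite_one_zero_nonneg ite_one_zero_nonneg)
    rw [hcomp] at key
    have ht : 0 ≤ t := coinProb_nonneg _ _
    have ht1 : t ≤ 1 := coinProb_le_one _ _
    have hx : (0 : ℝ) ≤ ρ / 2 ^ Q := by positivity
    set x : ℝ := ρ / 2 ^ Q
    have hη : (0 : ℝ) ≤ 1 / 2 ^ m := by positivity
    have hN : ((N : ℝ) / 2 ^ m) = N * (1 / 2 ^ m) := by ring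
    have hN' : (((N + 1 : ℕ) : ℝ) / 2 ^ m) = N * (1 / 2 ^ m) + 1 / 2 ^ m := by push_cast; ring
    rw [hN] at ih
    rw [hN']
    set η : ℝ := 1 / 2 ^ m
    -- From `x * (t + η) + (1 - t) * (x * (1 + N * η)) ≤ x * (1 + (N + 1) * η)`: the probability `t`
    -- cancels, so the balls together cost `x` once and only the truncation errors accumulate.
    have h1 : (1 - t) * p ≤ (1 - t) * (x * (1 + N * η)) :=
      mul_le_mul_of_nonneg_left ih (by linarith)
    have h2 : 0 ≤ t * (x * (N * η)) := by positivity
    nlinarith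

end HopEmbed

namespace HopEmbed

/-! ### The random partial tree embedding -/

namespace Input

variable {n : ℕ} (I : Input n)

/-- The weight matrix, row by row. -/
def mat (k : ℕ) : ℕ :=
  if hk : k < n * n then
    I.G.entry ⟨k / n, Nat.div_lt_of_lt_mul hk⟩
      ⟨k % n, Nat.mod_lt _ (Nat.pos_of_ne_zero fun h0 => by simp [h0] at hk)⟩ else 0

/-- The sum of the entries of the weight matrix. -/
def total : ℕ := ∑ k ∈ Finset.range (n * n), I.mat k

/-- The number of relevant hops. -/
def hops : ℕ := if I.h < n then I.h else n

/-- The number of coins for the geometric part of a radius. -/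
def gcoins (_ : Input n) : ℕ := Nat.clog 2 (n + 1)

/-- The radii are less than `2 ^ ucoins * 2 ^ mu`. -/
def mu : ℕ := Nat.clog 2 (I.gcoins + 2)

/-- The number of levels. -/
def levels : ℕ := Nat.clog 2 I.total + I.mu + 2

/-- The radii are at least `2 ^ q` times the cost of a hop. -/
def q : ℕ :=
  Nat.clog 2 I.hops + Nat.clog 2 I.levels + Nat.clog 2 (I.ε.den / I.ε.num.toNat + 1) + 3

/-- The number of coins for the uniform part of a radius. -/
def ucoins : ℕ := I.q + I.levels

/-- The width of the neighbourhoods that must not be cut. -/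
def width : ℕ := I.hops * (2 ^ I.levels + 2 ^ I.levels)

/-- The exponent of the factor of the weights at level `0`. -/
def expo : ℕ := I.q + 1 + I.mu

/-- The distance at a level; level `0` is the coarsest one. -/
noncomputable def lvlDist (l : ℕ) (u v : Fin n) : ℕ :=
  mixDist I.G (2 ^ (I.expo + l)) (2 ^ I.levels) u v

/-- The sequence of the centers of the balls: first the root, then all vertices. -/
def ctr (j : ℕ) : Fin n := if h : 0 < j ∧ j - 1 < n then ⟨j - 1, h.2⟩ else I.r

/-- The radius of the ball number `j` at level `l`. -/
def radius (ω : ℕ → Bool) (l j : ℕ) : ℕ :=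
  tapeRadius I.ucoins I.gcoins fun i =>
    ω (l * ((n + 1) * (I.ucoins + I.gcoins)) + (j * (I.ucoins + I.gcoins) + i))

/-- The cluster of a vertex at a level. -/
noncomputable def cl (ω : ℕ → Bool) (l : ℕ) (v : Fin n) : ℕ :=
  carve (fun j v => I.lvlDist l (I.ctr j) v) (I.radius ω l) v

/-- The neighbourhood of the vertex is cut at a level. -/
def IsCut (ω : ℕ → Bool) (l : ℕ) (v : Fin n) : Prop :=
  Cuts (fun j v => I.lvlDist l (I.ctr j) v) (I.radius ω l) I.width v

/-- The vertex belongs to the tree. -/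
def Alive (ω : ℕ → Bool) (v : Fin n) : Prop := ∀ l < I.levels, ¬ I.IsCut ω l v

open Classical in
/-- The number of coarsest levels, among the first `k`, at which two vertices are together. -/
noncomputable def common (ω : ℕ → Bool) (k : ℕ) (u v : Fin n) : ℕ :=
  Nat.findGreatest (fun l => ∀ i < l, I.cl ω i u = I.cl ω i v) k

/-- `u` is the parent of `v` in the tree. -/
def IsParent (ω : ℕ → Bool) (u v : Fin n) : Prop :=
  ∃ j ≤ (v : ℕ), u = I.ctr j ∧ I.Alive ω u ∧ ∀ i ≤ (v : ℕ), I.Alive ω (I.ctr i) →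
    I.common ω I.levels (I.ctr i) v ≤ I.common ω I.levels u v ∧
    (I.common ω I.levels (I.ctr i) v = I.common ω I.levels u v → j ≤ i)

theorem idx_lt (u v : Fin n) : (u : ℕ) * n + v < n * n := by
  have := u.2; have := v.2; nlinarith

theorem idx_div (u v : Fin n) : ((u : ℕ) * n + v) / n = u := by
  rw [mul_comm, Nat.mul_add_div (by have := u.2; omega), Nat.div_eq_of_lt v.2, add_zero]

theorem idx_mod (u v : Fin n) : ((u : ℕ) * n + v) % n = v := by
  rw [mul_comm, Nat.mul_add_mod, Nat.mod_eq_of_lt v.2]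

theorem mat_idx (u v : Fin n) : I.mat (u * n + v) = I.G.entry u v := by
  rw [mat, dif_pos (idx_lt u v)]
  congr 1
  · exact Fin.ext (idx_div u v)
  · exact Fin.ext (idx_mod u v)

theorem mat_of_ne {u v : Fin n} (h : u ≠ v) : I.mat (u * n + v) = I.G.w s(u, v) := by
  rw [mat_idx, WGraph.entry, if_neg h]

theorem exists_idx {k : ℕ} (hk : k < n * n) : ∃ u v : Fin n, k = u * n + v ∧ k / n = u ∧ k % n = v :=
  ⟨⟨k / n, Nat.div_lt_of_lt_mul hk⟩, ⟨k % n, Nat.mod_lt _ (Nat.pos_of_ne_zero fun h0 => by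
    simp [h0] at hk)⟩, (Nat.div_add_mod' k n).symm, rfl, rfl⟩

theorem idx_inj {u v u' v' : Fin n} (h : (u : ℕ) * n + v = u' * n + v') : u = u' ∧ v = v' := by
  have h1 := idx_div u v
  have h2 := idx_mod u v
  rw [h, idx_div] at h1
  rw [h, idx_mod] at h2
  exact ⟨Fin.ext h1.symm, Fin.ext h2.symm⟩

theorem ctr_zero : I.ctr 0 = I.r := by simp [ctr]

theorem ctr_succ (v : Fin n) : I.ctr (v + 1) = v := by simp [ctr]

end Input

/-! ### The program

Registers: `5` = `n * n`, `6` = `hops`, `7` = `total`, `8` = `gcoins`, `9` = `mu`, `10` = `levels`,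
`11` = `q`, `12` = `ucoins`, `14` = factor of the weights at the current level,
`15` = `2 ^ ucoins`, `16` = `2 ^ levels`, `17` = `n + 1`, `18` = `width`, `19` = weight of the
tree edges of the current level, `37` = `2 * n`, `20`–`24` = loop counters, `25` = center,
`27` = radius.  Arrays: `7` = together so far, `8` = cluster plus one, `9` = touched by a ball,
`10` = distance from the center, `11` and `12` = lengths and vertices of the paths to the centers,
`13` = parent. -/

namespace Alg

open Prog

def bitsLoop : Prog := forLt 23 12 (seq (flip 26) (assign 27 (.var 27 + .var 27 + .var 26)))

/-- Register `28` is `1` as long as no coin has shown `0`. The flipping goes on after the first `0`,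
so that every radius consumes the same number of coins and each ball has its block of coins at a
fixed position. -/
def headsLoop : Prog := forLt 23 8 (seq (flip 26) (seq (cond (.var 26) skip (assign 28 (.const 0)))
  (cond (.var 28) (assign 27 (.var 27 + .var 15)) skip)))

/-- Sample a radius. -/
def sampleRadius : Prog :=
  block [assign 27 (.const 0), bitsLoop, assign 27 (.var 27 + .var 15), assign 28 (.const 1),
    headsLoop]

def distInit : Prog := forLt 22 0 (store 10 (.var 22)
  (.var 14 * .load 0 (.var 25 * .var 0 + .var 22) + .var 16))

/-- One in-place round of Bellman–Ford over all ordered pairs. A diagonal position has weight `0`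
but still pays for a hop, so it never improves a value. -/
def relaxAll : Prog := forLt 22 5 (seq (assign 32 (.var 22 / .var 0))
  (seq (assign 33 (.var 22 % .var 0))
  (cond (.bin .lt (.load 10 (.var 32) + (.var 14 * .load 0 (.var 22) + .var 16))
      (.load 10 (.var 33)))
    (store 10 (.var 33) (.load 10 (.var 32) + (.var 14 * .load 0 (.var 22) + .var 16))) skip)))

/-- Compute the distances from the center. -/
def distances : Prog := block [distInit, store 10 (.var 25) (.const 0), forLt 23 0 relaxAll]

def findPrev : Prog := forLt 24 0 (cond (.bin .eq (.var 24) (.var 29)) skip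
  (cond (.bin .eq (.load 10 (.var 24) + (.var 14 * .load 0 (.var 24 * .var 0 + .var 29) + .var 16))
    (.load 10 (.var 29))) (assign 30 (.var 24)) skip))

/-- Once the center has been reached, the remaining rounds merely pad the row with copies of the
center; register `31` keeps the true length. -/
def traceLoop : Prog := forLt 23 0 (seq (store 12 (.var 22 * .var 0 + .var 23) (.var 29))
  (cond (.bin .eq (.var 29) (.var 25)) skip
    (block [findPrev, assign 29 (.var 30), assign 31 (.var 31 + .const 1)])))

/-- Record a shortest path from the vertex in register `22` to the center. -/
def trace : Prog := block [assign 29 (.var 22), assign 31 (.const 0), traceLoop,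
  store 11 (.var 22) (.var 31)]

def assignCluster : Prog := cond (.bin .eq (.load 8 (.var 22)) (.const 0))
  (cond (.bin .lt (.var 27) (.load 10 (.var 22))) skip
    (seq (store 8 (.var 22) (.var 21 + .const 1)) trace)) skip

/-- The mark in array `9` ensures that only the first ball within `width` of the vertex decides
whether the vertex is cut. -/
def touch : Prog := cond (.bin .eq (.load 9 (.var 22)) (.const 0))
  (cond (.bin .lt (.var 27 + .var 18) (.load 10 (.var 22))) skip
    (seq (store 9 (.var 22) (.const 1))
      (cond (.bin .lt (.var 27) (.load 10 (.var 22) + .var 18))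
        (store 1 (.var 22) (.const 0)) skip))) skip

def center : Prog := cond (.var 21) (assign 25 (.var 21 - .const 1)) (assign 25 (.var 4))

def vertexLoop : Prog := forLt 22 0 (seq assignCluster touch)

/-- Process one ball. -/
def ball : Prog := block [center, sampleRadius, distances, vertexLoop]

/-- The trace of the first vertex is followed by the reversed trace of the second. Always `2 * n`
cells are written; those beyond the length of the path are irrelevant. -/
def copyPath : Prog := forLt 23 37 (cond (.bin .lt (.load 11 (.var 32)) (.var 23))
  (store 6 (.var 22 * .var 0 + .var 22 * .var 0 + .var 23)
    (.load 12 (.var 33 * .var 0 + (.load 11 (.var 32) + .load 11 (.var 33) - .var 23))))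
  (store 6 (.var 22 * .var 0 + .var 22 * .var 0 + .var 23)
    (.load 12 (.var 32 * .var 0 + .var 23))))

/-- The levels run from coarse to fine, and weight and path are overwritten as long as the pair has
stayed together. What remains at the end are the data of the finest common level. -/
def pairStep : Prog := block [assign 32 (.var 22 / .var 0), assign 33 (.var 22 % .var 0),
  cond (.bin .eq (.load 8 (.var 32)) (.load 8 (.var 33))) skip (store 7 (.var 22) (.const 0)),
  cond (.load 7 (.var 22))
    (block [store 3 (.var 22) (.var 19),
      store 4 (.var 22) (.load 11 (.var 32) + .load 11 (.var 33)),
      store 5 (.var 22) (.var 22 * .var 0 + .var 22 * .var 0), copyPath]) skip]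

def clear : Prog := forLt 22 0 (seq (store 8 (.var 22) (.const 0)) (store 9 (.var 22) (.const 0)))

/-- Process one level. -/
def level : Prog := block [clear, forLt 21 17 ball, forLt 22 5 pairStep,
  assign 14 (.var 14 + .var 14), assign 19 (.var 19 / .const 2)]

/-- The value `0` in register `34` means that no candidate has been found yet, which is unambiguous
because weights are positive. The strict comparison keeps the earliest ball among equally close
candidates. -/
def parentStep : Prog := seq center (cond (.load 1 (.var 25))
  (cond (.bin .lt (.var 22) (.var 21)) skip
    (cond (.bin .eq (.var 34) (.const 0))
      (seq (assign 34 (.load 3 (.var 25 * .var 0 + .var 22))) (assign 35 (.var 25)))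
      (cond (.bin .lt (.load 3 (.var 25 * .var 0 + .var 22)) (.var 34))
        (seq (assign 34 (.load 3 (.var 25 * .var 0 + .var 22))) (assign 35 (.var 25))) skip))) skip)

/-- Find the parents. -/
def parents : Prog := forLt 22 0 (block [assign 34 (.const 0), assign 35 (.const 0),
  forLt 21 17 parentStep, store 13 (.var 22) (.var 35)])

/-- Products serve as conjunctions. In `adjacency` only the outcome of a comparison is stored, so
they do not conflict with `Expr.additive`. -/
def isChild (v p : Expr) : Expr :=
  .load 1 v * (.const 1 - .bin .eq v (.var 4)) * .bin .eq (.load 13 v) p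

/-- Write the adjacency matrix of the tree. -/
def adjacency : Prog := forLt 22 5 (block [assign 32 (.var 22 / .var 0),
  assign 33 (.var 22 % .var 0),
  store 2 (.var 22) (.bin .lt (.const 0)
    (isChild (.var 33) (.var 32) + isChild (.var 32) (.var 33)))])

def initTogether : Prog := forLt 22 5 (store 7 (.var 22) (.const 1))

def initAlive : Prog := forLt 22 0 (store 1 (.var 22) (.const 1))

def main : Prog := block [initTogether, initAlive, forLt 20 10 level, parents, adjacency]

/-- The sizes of the arrays and the number of relevant hops. -/
def sizeParams : Prog := block [assign 5 (.var 0 * .var 0), assign 17 (.var 0 + .const 1),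
  assign 37 (.var 0 + .var 0),
  cond (.bin .lt (.var 1) (.var 0)) (assign 6 (.var 1)) (assign 6 (.var 0))]

/-- The sum of the entries of the weight matrix. -/
def sumWeights : Prog := forLt 22 5 (assign 7 (.var 7 + .load 0 (.var 22)))

/-- The numbers of coins and levels. -/
def logParams : Prog := block [clog 8 13 17, assign 36 (.var 8 + .const 2), clog 9 13 36,
  clog 10 13 7, assign 10 (.var 10 + .var 9 + .const 2), clog 11 13 6, clog 36 13 10,
  assign 11 (.var 11 + .var 36), assign 38 (.var 3 / .var 2 + .const 1), clog 36 13 38,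
  assign 11 (.var 11 + .var 36 + .const 3), assign 12 (.var 11 + .var 10),
  assign 39 (.var 11 + .const 1 + .var 9)]

/-- Compute a power of two. -/
def pow (x y : ℕ) : Prog := seq (assign x (.const 1)) (forLt 23 y (assign x (.var x + .var x)))

/-- The powers of two that are needed. -/
def powParams : Prog := block [pow 15 12, pow 16 10, pow 14 39,
  forLt 23 6 (assign 18 (.var 18 + (.var 16 + .var 16))), assign 19 (.var 16)]

/-- The whole algorithm. -/
def alg : Prog := block [sizeParams, sumWeights, logParams, powParams, main]

end Alg

/-! ### Verification of the program -/

/-- The constants of the main part of the program. -/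
structure Input.Env {n : ℕ} (I : Input n) (s : State) : Prop where
  v0 : s.vars 0 = n
  v4 : s.vars 4 = I.r
  v5 : s.vars 5 = n * n
  v8 : s.vars 8 = I.gcoins
  v10 : s.vars 10 = I.levels
  v12 : s.vars 12 = I.ucoins
  v15 : s.vars 15 = 2 ^ I.ucoins
  v16 : s.vars 16 = 2 ^ I.levels
  v17 : s.vars 17 = n + 1
  v18 : s.vars 18 = I.width
  v37 : s.vars 37 = n + n
  a0 : s.arrs 0 = I.mat

/-- The program does not write the constants. -/
def Prog.keepsEnv (p : Prog) : Bool :=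
  ([0, 4, 5, 8, 10, 12, 15, 16, 17, 18, 37].all fun z => !p.wv.contains z) && !p.wa.contains 0

theorem Input.Env.of_frame {n : ℕ} {I : Input n} {s s' : State} (h : I.Env s) {p : Prog}
    (hf : p.Frame s s') (hp : p.keepsEnv = true) : I.Env s' := by
  simp only [Prog.keepsEnv, List.all_eq_true, Bool.and_eq_true, Bool.not_eq_true',
    List.contains_eq_mem, decide_eq_false_iff_not] at hp
  obtain ⟨hv, ha⟩ := hp
  constructor
  all_goals first
    | rw [hf.vars _ (hv _ (by simp))]
    | rw [hf.arrs _ ha]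
  exacts [h.v0, h.v4, h.v5, h.v8, h.v10, h.v12, h.v15, h.v16, h.v17, h.v18, h.v37, h.a0]

namespace Alg

open Prog

theorem run_bitsLoop (s : State) (h : s.vars 27 = 0) :
    (bitsLoop.run s).vars 27 = tapeBits (s.vars 12) s.coins ∧
    (bitsLoop.run s).coins = fun i => s.coins (s.vars 12 + i) := by
  refine forLt_rule rfl s (fun k s' => s'.vars 27 = tapeBits k s.coins ∧
    s'.coins = fun i => s.coins (k + i)) ⟨by simp [h, tapeBits], by simp⟩ ?_
  rintro k - s' - - ⟨h1, h2⟩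
  refine ⟨?_, ?_⟩
  · simp [h1, h2, tapeBits, two_mul]
  · funext i; simp [h2, add_assoc, add_comm 1]

theorem run_headsLoop (s : State) (h : s.vars 28 = 1) :
    (headsLoop.run s).vars 27 = s.vars 27 + s.vars 15 * tapeHeads (s.vars 8) s.coins ∧
    (headsLoop.run s).coins = fun i => s.coins (s.vars 8 + i) := by
  have := forLt_rule (x := 23) (y := 8) (p := seq (flip 26) (seq (cond (.var 26) skip
    (assign 28 (.const 0))) (cond (.var 28) (assign 27 (.var 27 + .var 15)) skip))) rfl s
    (fun k s' => s'.vars 27 = s.vars 27 + s.vars 15 * tapeHeads k s.coins ∧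
      (s'.vars 28 = if ∀ i < k, s.coins i = true then 1 else 0) ∧
      s'.coins = fun i => s.coins (k + i)) ⟨by simp [tapeHeads], by simp [h], by simp⟩ ?_
  · exact ⟨this.1, this.2.2⟩
  rintro k - s' hf - ⟨h1, h2, h3⟩
  have h15 : s'.vars 15 = s.vars 15 := hf.vars 15 (by decide)
  have hall : (∀ i < k + 1, s.coins i = true) ↔ (∀ i < k, s.coins i = true) ∧ s.coins k = true := by
    simp only [Nat.lt_succ_iff_lt_or_eq]; grind
  have hall' : (∀ i ≤ k, s.coins i = true) ↔ (∀ i < k, s.coins i = true) ∧ s.coins k = true := by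
    rw [← hall]; simp only [Nat.lt_succ_iff]
  rw [tapeHeads_succ]
  obtain ⟨P, hP⟩ : ∃ P : Prop, (∀ i < k, s.coins i = true) = P := ⟨_, rfl⟩
  rw [hP] at hall hall'
  classical
  replace h2 : s'.vars 28 = if P then 1 else 0 := by rw [h2]; exact if_congr (iff_of_eq hP) rfl rfl
  simp only [run_seq, run_flip, run_cond, hall, hall']
  have hc : s'.coins 0 = s.coins k := by simp [h3]
  refine ⟨?_, ?_, ?_⟩
  · cases hb : s.coins k <;> by_cases hA : P <;>
      simp [hc, hb, h1, h2, hA, h15, mul_add, add_assoc]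
  · cases hb : s.coins k <;> by_cases hA : P <;>
      simp [hc, hb, h1, h2, hA, h15]
  · funext i
    cases hb : s.coins k <;> by_cases hA : P <;>
      simp [hc, hb, h2, h3, hA, add_assoc, add_comm 1]

theorem run_sampleRadius (s : State) (h15 : s.vars 15 = 2 ^ s.vars 12) :
    (sampleRadius.run s).vars 27 = tapeRadius (s.vars 12) (s.vars 8) s.coins ∧
    (sampleRadius.run s).coins = fun i => s.coins (s.vars 12 + s.vars 8 + i) := by
  simp only [sampleRadius, block, run_seq, run_assign]
  set s1 := s.assign 27 ((Expr.const 0).eval s)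
  have hb := run_bitsLoop s1 (by simp [s1])
  have hfr := bitsLoop.frame s1
  have f15 := hfr.vars 15 (by decide)
  have f8 := hfr.vars 8 (by decide)
  set s2 := bitsLoop.run s1
  have hh := run_headsLoop ((s2.assign 27 ((Expr.var 27 + Expr.var 15).eval s2)).assign 28
    ((Expr.const 1).eval (s2.assign 27 ((Expr.var 27 + Expr.var 15).eval s2)))) (by simp)
  rw [hh.1, hh.2]
  simp [hb.1, hb.2, f15, f8, s1, h15, tapeRadius, add_assoc]
  ring

end Alg

end HopEmbed

/-! ### Distances from a center. -/

namespace HopEmbed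

theorem mixDist_comm {n : ℕ} {G : WGraph n} {a T : ℕ} (u v : Fin n) :
    mixDist G a T u v = mixDist G a T v u := by
  have h : ∀ u v, mixDist G a T u v ≤ mixDist G a T v u := fun u v => by
    obtain ⟨p, hp⟩ := exists_mixLen_eq (G := G) (a := a) (T := T) v u
    exact (mixDist_le p.reverse).trans_eq ((mixLen_reverse p).trans hp)
  exact le_antisymm (h u v) (h v u)

namespace Alg

open Prog

variable {n : ℕ} {I : Input n}

theorem run_distInit {s : State} (hs : I.Env s) (c : Fin n) (hc : s.vars 25 = c) (v : Fin n) :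
    (distInit.run s).arrs 10 v = s.vars 14 * I.mat (c * n + v) + s.vars 16 := by
  have := forLt_rule (x := 22) (y := 0) (p := store 10 (.var 22)
    (.var 14 * .load 0 (.var 25 * .var 0 + .var 22) + .var 16)) rfl s
    (fun k s' => ∀ v : Fin n, (v : ℕ) < k →
      s'.arrs 10 v = s.vars 14 * I.mat (c * n + v) + s.vars 16) (fun v hv => by omega) ?_
  · exact this v (hs.v0 ▸ v.2)
  rintro k - s' hf hk hI v hv
  simp [hf.vars 14 (by decide), hf.vars 25 (by decide), hf.vars 16 (by decide), hf.vars 0 (by decide),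
    hf.arrs 0 (by decide), hk, hs.v0, hs.a0, hc]
  rcases Nat.lt_succ_iff_lt_or_eq.1 hv with h' | h'
  · rw [if_neg (by omega), hI v h']
  · rw [if_pos h', h']

/-- Updating in place is harmless: values only decrease, so a bound in terms of the old values
persists, and no value falls below the true distance. -/
theorem run_relaxAll {s : State} (hs : I.Env s) (c : Fin n)
    (hD : ∀ v : Fin n, mixDist I.G (s.vars 14) (s.vars 16) c v ≤ s.arrs 10 v) :
    (∀ v : Fin n, (relaxAll.run s).arrs 10 v ≤ s.arrs 10 v) ∧
    (∀ x v : Fin n, (relaxAll.run s).arrs 10 v ≤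
      s.arrs 10 x + (s.vars 14 * I.mat (x * n + v) + s.vars 16)) ∧
    ∀ v : Fin n, mixDist I.G (s.vars 14) (s.vars 16) c v ≤ (relaxAll.run s).arrs 10 v := by
  have := forLt_rule (x := 22) (y := 5) (p := seq (assign 32 (.var 22 / .var 0))
    (seq (assign 33 (.var 22 % .var 0))
    (cond (.bin .lt (.load 10 (.var 32) + (.var 14 * .load 0 (.var 22) + .var 16))
      (.load 10 (.var 33)))
    (store 10 (.var 33) (.load 10 (.var 32) + (.var 14 * .load 0 (.var 22) + .var 16))) skip)))
    rfl s
    (fun k s' => (∀ v : Fin n, s'.arrs 10 v ≤ s.arrs 10 v) ∧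
      (∀ x v : Fin n, (x : ℕ) * n + v < k → s'.arrs 10 v ≤
        s.arrs 10 x + (s.vars 14 * I.mat (x * n + v) + s.vars 16)) ∧
      ∀ v : Fin n, mixDist I.G (s.vars 14) (s.vars 16) c v ≤ s'.arrs 10 v)
    ⟨fun v => by simp, fun x v h => by omega, by simpa using hD⟩ ?_
  · rw [hs.v5] at this
    exact ⟨this.1, fun x v => this.2.1 x v (Input.idx_lt x v), this.2.2⟩
  rintro k hk s' hf hk' ⟨h1, h2, h3⟩
  rw [hs.v5] at hk
  obtain ⟨x, v, hxv, hx, hv⟩ := Input.exists_idx hk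
  have f14 := hf.vars 14 (by decide)
  have f16 := hf.vars 16 (by decide)
  have f0 := hf.vars 0 (by decide)
  have fa := hf.arrs 0 (by decide)
  have hedge : mixDist I.G (s.vars 14) (s.vars 16) c v ≤
      s'.arrs 10 x + (s.vars 14 * I.mat k + s.vars 16) := by
    by_cases hne : x = v
    · subst hne; exact (h3 x).trans (Nat.le_add_right _ _)
    · rw [hxv, I.mat_of_ne hne]
      exact (mixDist_le_edge c hne).trans (by gcongr; exact h3 x)
  have hmono : ∀ w : Fin n, ((seq (assign 32 (.var 22 / .var 0))
    (seq (assign 33 (.var 22 % .var 0))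
    (cond (.bin .lt (.load 10 (.var 32) + (.var 14 * .load 0 (.var 22) + .var 16))
      (.load 10 (.var 33)))
    (store 10 (.var 33) (.load 10 (.var 32) + (.var 14 * .load 0 (.var 22) + .var 16)))
      skip))).run s').arrs 10 w =
      if w = v then min (s'.arrs 10 v) (s'.arrs 10 x + (s.vars 14 * I.mat k + s.vars 16))
      else s'.arrs 10 w := by
    intro w
    simp [run_cond, f14, f16, f0, fa, hk', hs.v0, hs.a0, hx, hv]
    split_ifs with h4 h5 h5
    · subst h5; simp; omega
    · simp [h5, Fin.val_inj]
    · subst h5; simp; omega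
    · simp
  simp only [State.assign_arrs, hmono]
  refine ⟨fun w => ?_, fun y w hyw => ?_, fun w => ?_⟩
  · split_ifs with h
    · subst h; exact (min_le_left _ _).trans (h1 w)
    · exact h1 w
  · rcases Nat.lt_succ_iff_lt_or_eq.1 hyw with h | h
    · have := h2 y w h
      split_ifs with hw
      · subst hw; exact (min_le_left _ _).trans this
      · exact this
    · rw [hxv] at h
      obtain ⟨rfl, rfl⟩ := Input.idx_inj h
      rw [if_pos rfl, ← hxv]
      exact (min_le_right _ _).trans (by gcongr; exact h1 y)
  · split_ifs with h
    · subst h; exact le_min (h3 w) hedge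
    · exact h3 w

theorem run_distances {s : State} (hs : I.Env s) (c : Fin n) (hc : s.vars 25 = c) (v : Fin n) :
    (distances.run s).arrs 10 v = mixDist I.G (s.vars 14) (s.vars 16) c v := by
  simp only [distances, block, run_seq, run_store]
  have hf0 := distInit.frame s
  have h0 := run_distInit hs c hc
  have f14 := hf0.vars 14 (by decide)
  have f16 := hf0.vars 16 (by decide)
  have f0 := hf0.vars 0 (by decide)
  have f25 := hf0.vars 25 (by decide)
  set s1 := (distInit.run s).store 10 ((Expr.var 25).eval (distInit.run s))
    ((Expr.const 0).eval (distInit.run s)) with hs1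
  have e1 : ∀ v : Fin n, s1.arrs 10 v = if v = c then 0 else
      s.vars 14 * I.mat (c * n + v) + s.vars 16 := by
    intro v
    simp [hs1, f25, hc, Fin.val_inj, h0]
  have hE1 : I.Env s1 := by
    refine hs.of_frame (p := seq distInit (store 10 (.var 25) (.const 0))) ?_ (by decide)
    exact (seq distInit (store 10 (.var 25) (.const 0))).frame s
  have g14 : s1.vars 14 = s.vars 14 := f14
  have g16 : s1.vars 16 = s.vars 16 := f16
  -- The initial values already account for walks with one hop, hence `t + 1` hops after `t` rounds.
  have := forLt_rule (x := 23) (y := 0) (p := relaxAll) rfl s1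
    (fun t s' => (∀ v : Fin n, mixDist I.G (s.vars 14) (s.vars 16) c v ≤ s'.arrs 10 v) ∧
      ∀ (v : Fin n) (p : (⊤ : SimpleGraph (Fin n)).Walk v c), p.length ≤ t + 1 →
        s'.arrs 10 v ≤ mixLen I.G (s.vars 14) (s.vars 16) p) ⟨?_, ?_⟩ ?_
  · rw [hE1.v0] at this
    obtain ⟨p, hp, hpe⟩ := exists_isPath_mixLen_eq (G := I.G) (a := s.vars 14) (T := s.vars 16) v c
    refine le_antisymm ?_ (this.1 v)
    rw [mixDist_comm, ← hpe]
    exact this.2 v p (by have := hp.length_lt; rw [Fintype.card_fin] at this; omega)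
  · intro v
    simp only [State.assign_arrs, e1]
    split_ifs with h
    · subst h; rw [mixDist_self]
    · rw [I.mat_of_ne (Ne.symm h)]
      simpa [mixDist_self] using mixDist_le_edge (G := I.G) (a := s.vars 14) (T := s.vars 16) c
        (x := c) (v := v) (Ne.symm h)
  · intro v p hp
    simp only [State.assign_arrs, e1]
    split_ifs with h
    · exact Nat.zero_le _
    · cases p with
      | nil => exact absurd rfl h
      | @cons _ x _ e p =>
        cases p with
        | nil => rw [mixLen_cons, mixLen_nil, I.mat_of_ne (Ne.symm h), Sym2.eq_swap]; omega
        | cons e' p => simp only [SimpleGraph.Walk.length_cons] at hp; omega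
  · rintro t - s' hf ht ⟨h1, h2⟩
    have k14 : s'.vars 14 = s.vars 14 := (hf.vars 14 (by decide)).trans g14
    have k16 : s'.vars 16 = s.vars 16 := (hf.vars 16 (by decide)).trans g16
    obtain ⟨r1, r2, r3⟩ := run_relaxAll (hE1.of_frame hf (by decide)) c (by rwa [k14, k16])
    rw [k14, k16] at r2 r3
    refine ⟨r3, fun v p hp => ?_⟩
    cases p with
    | nil => exact (r1 _).trans (h2 _ .nil (by simp))
    | @cons _ x _ e p =>
      refine (r2 x v).trans ?_
      rw [mixLen_cons, I.mat_of_ne (Ne.symm e), Sym2.eq_swap, add_comm]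
      gcongr
      exact h2 x p (by simp only [SimpleGraph.Walk.length_cons] at hp; omega)

end Alg

end HopEmbed

/-! ### Recorded shortest paths to the centers. -/

namespace HopEmbed

/-- The state contains a shortest path from `v` to the center `c`. -/
def HasTrace {n : ℕ} (G : WGraph n) (a T : ℕ) (s : State) (c v : Fin n) : Prop :=
  ∃ p : (⊤ : SimpleGraph (Fin n)).Walk v c, p.IsPath ∧ mixLen G a T p = mixDist G a T c v ∧
    s.arrs 11 v = p.length ∧ ∀ i ≤ p.length, s.arrs 12 (v * n + i) = p.getVert i

/-- The two states agree on the data of the vertex `v`. -/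
structure SameAt {n : ℕ} (s s' : State) (v : Fin n) : Prop where
  a8 : s'.arrs 8 v = s.arrs 8 v
  a9 : s'.arrs 9 v = s.arrs 9 v
  a1 : s'.arrs 1 v = s.arrs 1 v
  a11 : s'.arrs 11 v = s.arrs 11 v
  a12 : ∀ i < n, s'.arrs 12 (v * n + i) = s.arrs 12 (v * n + i)

theorem SameAt.trans {n : ℕ} {s s' s'' : State} {v : Fin n} (h : SameAt s s' v)
    (h' : SameAt s' s'' v) : SameAt s s'' v :=
  ⟨h'.a8.trans h.a8, h'.a9.trans h.a9, h'.a1.trans h.a1, h'.a11.trans h.a11,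
    fun i hi => (h'.a12 i hi).trans (h.a12 i hi)⟩

theorem SameAt.rfl {n : ℕ} {s : State} {v : Fin n} : SameAt s s v :=
  ⟨Eq.refl _, Eq.refl _, Eq.refl _, Eq.refl _, fun _ _ => Eq.refl _⟩

theorem HasTrace.congr {n : ℕ} {G : WGraph n} {a T : ℕ} {s s' : State} {c v : Fin n}
    (h : HasTrace G a T s c v) (h11 : s'.arrs 11 v = s.arrs 11 v)
    (h12 : ∀ i < n, s'.arrs 12 (v * n + i) = s.arrs 12 (v * n + i)) : HasTrace G a T s' c v := by
  obtain ⟨p, h1, h2, h3, h4⟩ := h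
  refine ⟨p, h1, h2, h11.trans h3, fun i hi => ?_⟩
  have := h1.length_lt
  rw [Fintype.card_fin] at this
  rw [h12 i (by omega), h4 i hi]

namespace Alg

open Prog

variable {n : ℕ} {I : Input n}

theorem run_findPrev {s : State} (hs : I.Env s) {c y : Fin n} (hy : s.vars 29 = y) (hyc : c ≠ y)
    (hE : ∀ x : Fin n, s.arrs 10 x = mixDist I.G (s.vars 14) (s.vars 16) c x) :
    ∃ x : Fin n, x ≠ y ∧ (findPrev.run s).vars 30 = x ∧
      mixDist I.G (s.vars 14) (s.vars 16) c x + (s.vars 14 * I.G.w s(x, y) + s.vars 16) =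
        mixDist I.G (s.vars 14) (s.vars 16) c y := by
  set P : Fin n → Prop := fun x => x ≠ y ∧
    mixDist I.G (s.vars 14) (s.vars 16) c x + (s.vars 14 * I.G.w s(x, y) + s.vars 16) =
        mixDist I.G (s.vars 14) (s.vars 16) c y
  have := forLt_rule (x := 24) (y := 0) (p := cond (.bin .eq (.var 24) (.var 29)) skip
    (cond (.bin .eq (.load 10 (.var 24) +
      (.var 14 * .load 0 (.var 24 * .var 0 + .var 29) + .var 16))
      (.load 10 (.var 29))) (assign 30 (.var 24)) skip)) rfl s
    -- Later matches overwrite earlier ones, so the invariant only says that some match is stored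
    -- once one has been met.
    (fun k s' => (∃ x : Fin n, (x : ℕ) < k ∧ P x) → ∃ x : Fin n, s'.vars 30 = x ∧ P x)
    (fun ⟨x, hx, _⟩ => by omega) ?_
  · obtain ⟨x, hx⟩ := exists_mixDist_eq_edge (G := I.G) (a := s.vars 14) (T := s.vars 16) hyc
    obtain ⟨z, hz1, hz2⟩ := this ⟨x, hs.v0 ▸ x.2, hx⟩
    exact ⟨z, hz2.1, hz1, hz2.2⟩
  rintro k hk s' hf hk' ih ⟨x, hx, hP⟩
  have f14 := hf.vars 14 (by decide)
  have f16 := hf.vars 16 (by decide)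
  have f0 := hf.vars 0 (by decide)
  have f29 := hf.vars 29 (by decide)
  have fa := hf.arrs 0 (by decide)
  have f10 := hf.arrs 10 (by decide)
  rw [hs.v0] at hk
  obtain ⟨z, rfl⟩ : ∃ z : Fin n, k = z := ⟨⟨k, hk⟩, rfl⟩
  have hold : x ≠ z → ∃ x : Fin n, s'.vars 30 = x ∧ P x := fun hne =>
    ih ⟨x, by have := Fin.val_ne_of_ne hne; omega, hP⟩
  simp only [run_cond, Expr.eval_eq, Expr.eval_var, Expr.eval_add, Expr.eval_mul, Expr.eval_load,
    f14, f16, f0, f29, fa, f10, hk', hs.v0, hs.a0, hy, hE, run_skip, Fin.val_inj]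
  by_cases hzy : z = y
  · simpa [hzy] using hold (fun h => hP.1 (h.trans hzy))
  · rw [I.mat_of_ne hzy]
    by_cases ht : mixDist I.G (s.vars 14) (s.vars 16) c z +
        (s.vars 14 * I.G.w s(z, y) + s.vars 16) = mixDist I.G (s.vars 14) (s.vars 16) c y
    · exact ⟨z, by simp [hzy, ht, hk'], hzy, ht⟩
    · simpa [hzy, ht] using hold (fun h => ht (h ▸ hP.2))

theorem run_traceLoop {s : State} (hs : I.Env s) {c v : Fin n} (hv : s.vars 22 = v)
    (hc : s.vars 25 = c) (h29 : s.vars 29 = v) (h31 : s.vars 31 = 0)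
    (hE : ∀ x : Fin n, s.arrs 10 x = mixDist I.G (s.vars 14) (s.vars 16) c x) :
    (∃ p : (⊤ : SimpleGraph (Fin n)).Walk v c, p.IsPath ∧
      mixLen I.G (s.vars 14) (s.vars 16) p = mixDist I.G (s.vars 14) (s.vars 16) c v ∧
      (traceLoop.run s).vars 31 = p.length ∧
      ∀ i ≤ p.length, (traceLoop.run s).arrs 12 (v * n + i) = p.getVert i) ∧
    ∀ w : Fin n, w ≠ v → ∀ i < n, (traceLoop.run s).arrs 12 (w * n + i) = s.arrs 12 (w * n + i) := by
  set D := mixDist I.G (s.vars 14) (s.vars 16) c with hD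
  -- The positive charge per hop makes the distance to the center strictly decrease along the trace,
  -- so that no vertex is visited twice.
  have hTpos : 0 < s.vars 16 := by rw [hs.v16]; positivity
  have := forLt_rule (x := 23) (y := 0)
    (p := seq (store 12 (.var 22 * .var 0 + .var 23) (.var 29))
      (cond (.bin .eq (.var 29) (.var 25)) skip
      (block [findPrev, assign 29 (.var 30), assign 31 (.var 31 + .const 1)]))) rfl s
    (fun t s' => (∃ (y : Fin n) (p : (⊤ : SimpleGraph (Fin n)).Walk v y), p.IsPath ∧
      s'.vars 29 = y ∧ (∀ x ∈ p.support, D y ≤ D x) ∧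
      mixLen I.G (s.vars 14) (s.vars 16) p + D y = D v ∧ s'.vars 31 = p.length ∧ p.length ≤ t ∧
      (y ≠ c → p.length = t) ∧
      ∀ i < t, i ≤ p.length → s'.arrs 12 (v * n + i) = p.getVert i) ∧
      ∀ w : Fin n, w ≠ v → ∀ i < n, s'.arrs 12 (w * n + i) = s.arrs 12 (w * n + i))
    ⟨⟨v, .nil, by simp, by simp [h29], by simp, by simp [mixLen_nil], by simp [h31], by simp,
      by simp, by simp⟩, by simp⟩ ?_
  · rw [hs.v0] at this
    obtain ⟨⟨y, p, h1, h2, h3, h4, h5, h6, h7, h8⟩, h9⟩ := this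
    have hlt := h1.length_lt
    rw [Fintype.card_fin] at hlt
    -- Otherwise the trace would be a simple path with `n` hops on `n` vertices.
    obtain rfl : y = c := by by_contra h; have := h7 h; omega
    refine ⟨⟨p, h1, ?_, h5, fun i hi => h8 i (by omega) hi⟩, h9⟩
    rwa [hD, mixDist_self, add_zero] at h4
  rintro t ht s' hf ht' ⟨⟨y, p, h1, h2, h3, h4, h5, h6, h7, h8⟩, h9⟩
  have f22 := hf.vars 22 (by decide)
  have f25 := hf.vars 25 (by decide)
  have f14 := hf.vars 14 (by decide)
  have f16 := hf.vars 16 (by decide)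
  have f10 := hf.arrs 10 (by decide)
  rw [hs.v0] at ht
  have hs' : I.Env s' := hs.of_frame hf (by decide)
  set s1 := s'.store 12 ((Expr.var 22 * Expr.var 0 + Expr.var 23).eval s')
    ((Expr.var 29).eval s') with hs1
  have e1 : ∀ (w : Fin n) (i : ℕ), i < n → s1.arrs 12 (w * n + i) =
      if w = v ∧ i = t then (y : ℕ) else s'.arrs 12 (w * n + i) := by
    intro w i hi
    have : (w : ℕ) * n + i = v * n + t ↔ w = v ∧ i = t := by
      constructor
      · intro h
        have := Input.idx_inj (u := w) (v := ⟨i, hi⟩) (u' := v) (v' := ⟨t, ht⟩) h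
        exact ⟨this.1, congrArg Fin.val this.2⟩
      · rintro ⟨rfl, rfl⟩; rfl
    simp [hs1, f22, hv, hs'.v0, ht', h2, this]
  have hrun : (seq (store 12 (.var 22 * .var 0 + .var 23) (.var 29))
      (cond (.bin .eq (.var 29) (.var 25)) skip
      (block [findPrev, assign 29 (.var 30), assign 31 (.var 31 + .const 1)]))).run s' =
      if y = c then s1 else (block [findPrev, assign 29 (.var 30),
        assign 31 (.var 31 + .const 1)]).run s1 := by
    simp [run_cond, h2, f25, hc, hs1, Fin.val_inj]
  rw [hrun]
  have h9' : ∀ w : Fin n, w ≠ v → ∀ i < n, s1.arrs 12 (w * n + i) = s.arrs 12 (w * n + i) :=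
    fun w hw i hi => by rw [e1 w i hi, if_neg (fun h => hw h.1), h9 w hw i hi]
  have h8' : ∀ i < t + 1, i ≤ p.length → s1.arrs 12 (v * n + i) = p.getVert i := by
    intro i hi hip
    rw [e1 v i (by omega)]
    by_cases hit : i = t
    · have : i = p.length := by omega
      rw [if_pos ⟨rfl, hit⟩, this, p.getVert_length]
    · rw [if_neg (fun h => hit h.2), h8 i (by omega) hip]
  by_cases hyc : y = c
  · rw [if_pos hyc]
    exact ⟨⟨y, p, h1, by simpa [hs1] using h2, h3, h4, by simpa [hs1] using h5, by omega,
      fun h => absurd hyc h, by simpa using h8'⟩, by simpa using h9'⟩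
  rw [if_neg hyc]
  have hs1E : I.Env s1 := hs'.of_frame (p := store 12 (.var 22 * .var 0 + .var 23) (.var 29))
    ((store 12 (.var 22 * .var 0 + .var 23) (.var 29)).frame s') (by decide)
  obtain ⟨x, hxy, hx30, hxD⟩ := run_findPrev hs1E (c := c) (y := y) (by simpa [hs1] using h2)
    (Ne.symm hyc) (by
      intro x
      simpa [hs1, f10, f14, f16, hD] using hE x)
  have g14 : s1.vars 14 = s.vars 14 := by simpa [hs1] using f14
  have g16 : s1.vars 16 = s.vars 16 := by simpa [hs1] using f16
  rw [g14, g16, ← hD] at hxD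
  have hfp := findPrev.frame s1
  have k31 : (findPrev.run s1).vars 31 = p.length := by
    rw [hfp.vars 31 (by decide)]; simpa [hs1] using h5
  have k12 := hfp.arrs 12 (by decide)
  simp only [block, run_seq, run_assign]
  have hlen := h7 hyc
  have hxs : x ∉ p.support := fun h => by have := h3 x h; omega
  refine ⟨⟨x, p.concat (show (⊤ : SimpleGraph (Fin n)).Adj y x from hxy.symm),
    h1.concat hxs _, by simp [hx30], ?_, ?_, by simp [k31], by simp [hlen], by simp [hlen], ?_⟩, ?_⟩
  · intro z hz
    rw [SimpleGraph.Walk.support_concat, List.mem_append, List.mem_singleton] at hz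
    rcases hz with hz | rfl
    · have := h3 z hz; omega
    · exact le_rfl
  · rw [SimpleGraph.Walk.concat_eq_append, mixLen_append, mixLen_cons, mixLen_nil, Sym2.eq_swap]
    omega
  · intro i hi hip
    rw [SimpleGraph.Walk.concat_eq_append, SimpleGraph.Walk.getVert_append]
    simp only [State.assign_arrs, k12]
    rw [h8' i hi (by omega)]
    split_ifs with h
    · rfl
    · have : i = p.length := by omega
      simp [this]
  · simpa [k12] using h9'

theorem run_trace {s : State} (hs : I.Env s) {c v : Fin n} (hv : s.vars 22 = v)
    (hc : s.vars 25 = c)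
    (hE : ∀ x : Fin n, s.arrs 10 x = mixDist I.G (s.vars 14) (s.vars 16) c x) :
    HasTrace I.G (s.vars 14) (s.vars 16) (trace.run s) c v ∧
    ∀ w : Fin n, w ≠ v → SameAt s (trace.run s) w := by
  have hfr := trace.frame s
  simp only [trace, block, run_seq, run_assign, run_store] at hfr ⊢
  set s1 := (s.assign 29 ((Expr.var 22).eval s)).assign 31
    ((Expr.const 0).eval (s.assign 29 ((Expr.var 22).eval s))) with hs1
  have hs1E : I.Env s1 := hs.of_frame
    (p := seq (assign 29 (.var 22)) (assign 31 (.const 0)))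
    ((seq (assign 29 (.var 22)) (assign 31 (.const 0))).frame s) (by decide)
  obtain ⟨⟨p, h1, h2, h3, h4⟩, h5⟩ := run_traceLoop hs1E (c := c) (v := v) (by simp [hs1, hv])
    (by simp [hs1, hc]) (by simp [hs1, hv]) (by simp [hs1]) (by simpa [hs1] using hE)
  have hft := traceLoop.frame s1
  have f22 : (traceLoop.run s1).vars 22 = v := by rw [hft.vars 22 (by decide)]; simp [hs1, hv]
  refine ⟨⟨p, h1, by simpa [hs1] using h2, by simp [f22, h3], by simpa using h4⟩, fun w hw => ?_⟩
  have hw' : (w : ℕ) ≠ v := Fin.val_ne_of_ne hw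
  constructor
  · exact congrFun (hfr.arrs 8 (by decide)) _
  · exact congrFun (hfr.arrs 9 (by decide)) _
  · exact congrFun (hfr.arrs 1 (by decide)) _
  · have k11 := hft.arrs 11 (by decide)
    simp [f22, hw', k11]
    rfl
  · intro i hi
    simpa [hs1] using h5 w hw i hi

end Alg

end HopEmbed

/-! ### Clusters and cut neighbourhoods, ball by ball. -/

namespace HopEmbed

namespace Input

variable {n : ℕ} (I : Input n)

theorem exists_mem_ball (ω : ℕ → Bool) (l : ℕ) (v : Fin n) :
    ∃ j, I.lvlDist l (I.ctr j) v ≤ I.radius ω l j :=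
  ⟨v + 1, by rw [ctr_succ, lvlDist, mixDist_self]; exact Nat.zero_le _⟩

theorem cl_eq_iff {ω : ℕ → Bool} {l : ℕ} {v : Fin n} {j : ℕ} :
    I.cl ω l v = j ↔ I.lvlDist l (I.ctr j) v ≤ I.radius ω l j ∧
      ∀ i < j, I.radius ω l i < I.lvlDist l (I.ctr i) v :=
  carve_eq_iff (I.exists_mem_ball ω l v)

theorem cl_le (ω : ℕ → Bool) (l : ℕ) (v : Fin n) : I.cl ω l v ≤ v + 1 := by
  by_contra! h
  have := ((I.cl_eq_iff (ω := ω) (l := l) (v := v)).1 rfl).2 _ h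
  rw [ctr_succ, lvlDist, mixDist_self] at this
  omega

theorem cl_le_card (ω : ℕ → Bool) (l : ℕ) (v : Fin n) : I.cl ω l v ≤ n :=
  (I.cl_le ω l v).trans v.2

/-- One of the balls before number `j` comes close to the vertex. -/
def Touched (ω : ℕ → Bool) (l j : ℕ) (v : Fin n) : Prop :=
  ∃ i < j, I.lvlDist l (I.ctr i) v ≤ I.radius ω l i + I.width

/-- The neighbourhood of the vertex is cut by one of the balls before number `j`. -/
def CutBefore (ω : ℕ → Bool) (l j : ℕ) (v : Fin n) : Prop :=
  ∃ i < j, I.lvlDist l (I.ctr i) v ≤ I.radius ω l i + I.width ∧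
    I.radius ω l i < I.lvlDist l (I.ctr i) v + I.width ∧ ¬ I.Touched ω l i v

theorem touched_succ {ω : ℕ → Bool} {l j : ℕ} {v : Fin n} : I.Touched ω l (j + 1) v ↔
    I.Touched ω l j v ∨ I.lvlDist l (I.ctr j) v ≤ I.radius ω l j + I.width := by
  simp only [Touched, Nat.lt_succ_iff_lt_or_eq]
  grind

theorem cutBefore_succ {ω : ℕ → Bool} {l j : ℕ} {v : Fin n} : I.CutBefore ω l (j + 1) v ↔
    I.CutBefore ω l j v ∨ (I.lvlDist l (I.ctr j) v ≤ I.radius ω l j + I.width ∧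
    I.radius ω l j < I.lvlDist l (I.ctr j) v + I.width ∧ ¬ I.Touched ω l j v) := by
  simp only [CutBefore, Nat.lt_succ_iff_lt_or_eq]
  grind

/-- Ball number `v + 1` is centered at `v`, so the first ball close to `v` is among the `n + 1`
balls that the program processes. -/
theorem isCut_iff {ω : ℕ → Bool} {l : ℕ} {v : Fin n} :
    I.IsCut ω l v ↔ I.CutBefore ω l (n + 1) v := by
  constructor
  · rintro ⟨j, h1, h2, h3⟩
    beta_reduce at h1 h2 h3
    refine ⟨j, ?_, h1, h2, fun ⟨i, hi, h⟩ => by have := h3 i hi; omega⟩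
    by_contra! hj
    have := h3 (v + 1) (by omega)
    rw [ctr_succ, lvlDist, mixDist_self] at this
    omega
  · rintro ⟨j, -, h1, h2, h3⟩
    exact ⟨j, h1, h2, fun i hi => not_le.1 fun h => h3 ⟨i, hi, h⟩⟩

/-- The data of the vertex `v` before the ball number `j` at level `l`. -/
structure VInv (ω : ℕ → Bool) (l j : ℕ) (s : State) (v : Fin n) : Prop where
  a8 : s.arrs 8 v = if I.cl ω l v < j then I.cl ω l v + 1 else 0
  tr : I.cl ω l v < j →
    HasTrace I.G (2 ^ (I.expo + l)) (2 ^ I.levels) s (I.ctr (I.cl ω l v)) v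
  touched : I.Touched ω l j v → s.arrs 9 v = 1
  not_touched : ¬ I.Touched ω l j v → s.arrs 9 v = 0
  alive : (∀ i < l, ¬ I.IsCut ω i v) ∧ ¬ I.CutBefore ω l j v → s.arrs 1 v = 1
  not_alive : ¬ ((∀ i < l, ¬ I.IsCut ω i v) ∧ ¬ I.CutBefore ω l j v) → s.arrs 1 v = 0

theorem VInv.congr {I : Input n} {ω : ℕ → Bool} {l j : ℕ} {s s' : State} {v : Fin n}
    (h : I.VInv ω l j s v) (hs : SameAt s s' v) : I.VInv ω l j s' v :=
  ⟨hs.a8.trans h.a8, fun hj => (h.tr hj).congr hs.a11 hs.a12, fun ht => hs.a9.trans (h.touched ht),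
    fun ht => hs.a9.trans (h.not_touched ht), fun ht => hs.a1.trans (h.alive ht),
    fun ht => hs.a1.trans (h.not_alive ht)⟩

end Input

namespace Alg

open Prog

variable {n : ℕ} {I : Input n}

/-- The constants of a level. -/
structure BallEnv (I : Input n) (ω : ℕ → Bool) (l j : ℕ) (s : State) : Prop extends I.Env s where
  v14 : s.vars 14 = 2 ^ (I.expo + l)
  v21 : s.vars 21 = j
  v25 : s.vars 25 = I.ctr j
  v27 : s.vars 27 = I.radius ω l j
  a10 : ∀ x : Fin n, s.arrs 10 x = I.lvlDist l (I.ctr j) x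

theorem BallEnv.of_frame {ω : ℕ → Bool} {l j : ℕ} {s s' : State} (h : BallEnv I ω l j s) {p : Prog}
    (hf : p.Frame s s') (hp : p.keepsEnv = true)
    (hp' : (([14, 21, 25, 27].all fun z => !p.wv.contains z) && !p.wa.contains 10) = true) :
    BallEnv I ω l j s' := by
  simp only [List.all_eq_true, Bool.and_eq_true, Bool.not_eq_true',
    List.contains_eq_mem, decide_eq_false_iff_not] at hp'
  obtain ⟨hv, ha⟩ := hp'
  refine ⟨h.1.of_frame hf hp, ?_, ?_, ?_, ?_, ?_⟩
  all_goals first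
    | rw [hf.vars _ (hv _ (by simp))]
    | rw [hf.arrs _ ha]
  exacts [h.v14, h.v21, h.v25, h.v27, h.a10]

theorem run_assignCluster {ω : ℕ → Bool} {l j : ℕ} {s : State} (hs : BallEnv I ω l j s) {v : Fin n}
    (hv : s.vars 22 = v) (h : I.VInv ω l j s v) :
    let s' := assignCluster.run s
    (s'.arrs 8 v = if I.cl ω l v < j + 1 then I.cl ω l v + 1 else 0) ∧
    (I.cl ω l v < j + 1 →
      HasTrace I.G (2 ^ (I.expo + l)) (2 ^ I.levels) s' (I.ctr (I.cl ω l v)) v) ∧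
    ∀ w : Fin n, w ≠ v → SameAt s s' w := by
  intro s'
  have hc := I.cl_eq_iff (ω := ω) (l := l) (v := v) (j := j)
  by_cases h1 : I.cl ω l v < j
  · have : s' = s := by
      have := h.a8
      rw [if_pos h1] at this
      simp [s', assignCluster, run_cond, hv, this]
    rw [this, if_pos (by omega)]
    refine ⟨by rw [h.a8, if_pos h1], fun _ => h.tr h1, fun w _ => SameAt.rfl⟩
  have h8 := h.a8
  rw [if_neg h1] at h8
  by_cases h2 : I.radius ω l j < I.lvlDist l (I.ctr j) v
  · have : s' = s := by
      simp [s', assignCluster, run_cond, hv, h8, hs.v27, hs.a10, h2]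
    have hne : ¬ I.cl ω l v < j + 1 := fun h => by
      have := (hc.1 (by omega)).1
      omega
    rw [this, if_neg hne]
    exact ⟨h8, fun h => absurd h hne, fun w _ => SameAt.rfl⟩
  have hcl : I.cl ω l v = j := by
    refine hc.2 ⟨by omega, fun i hi => ?_⟩
    exact ((I.cl_eq_iff (ω := ω) (l := l) (v := v)).1 rfl).2 _ (by omega)
  set s1 := s.store 8 v (j + 1) with hs1
  have : s' = trace.run s1 := by
    simp [s', assignCluster, run_cond, hv, h8, hs.v27, hs.a10, h2, hs.v21, hs1]
  have hs1E : BallEnv I ω l j s1 := by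
    refine hs.of_frame (p := store 8 (.var 22) (.var 21 + .const 1)) ?_ (by decide) (by decide)
    have := (store 8 (.var 22) (.var 21 + .const 1)).frame s
    simpa [hv, hs.v21] using this
  obtain ⟨ht1, ht2⟩ := run_trace hs1E.1 (c := I.ctr j) (v := v) (by simp [hs1, hv]) hs1E.v25
    (by intro x; rw [hs1E.a10, hs1E.v14, hs1E.v16]; rfl)
  rw [hs1E.v14, hs1E.v16] at ht1
  rw [this, hcl, if_pos (by omega)]
  refine ⟨?_, fun _ => ht1, fun w hw => ?_⟩
  · rw [(trace.frame s1).arrs 8 (by decide)]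
    simp [hs1]
  · refine SameAt.trans ?_ (ht2 w hw)
    have := Fin.val_ne_of_ne hw
    constructor <;> simp [hs1, this]

theorem run_touch {ω : ℕ → Bool} {l j : ℕ} {s : State} (hs : BallEnv I ω l j s) {v : Fin n}
    (hv : s.vars 22 = v) 
    (h1 : I.Touched ω l j v → s.arrs 9 v = 1) (h2 : ¬ I.Touched ω l j v → s.arrs 9 v = 0)
    (h3 : (∀ i < l, ¬ I.IsCut ω i v) ∧ ¬ I.CutBefore ω l j v → s.arrs 1 v = 1)
    (h4 : ¬ ((∀ i < l, ¬ I.IsCut ω i v) ∧ ¬ I.CutBefore ω l j v) → s.arrs 1 v = 0) :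
    let s' := touch.run s
    (I.Touched ω l (j + 1) v → s'.arrs 9 v = 1) ∧ (¬ I.Touched ω l (j + 1) v → s'.arrs 9 v = 0) ∧
    ((∀ i < l, ¬ I.IsCut ω i v) ∧ ¬ I.CutBefore ω l (j + 1) v → s'.arrs 1 v = 1) ∧
    (¬ ((∀ i < l, ¬ I.IsCut ω i v) ∧ ¬ I.CutBefore ω l (j + 1) v) → s'.arrs 1 v = 0) ∧
    ∀ w : Fin n, w ≠ v → SameAt s s' w := by
  intro s'
  rw [I.touched_succ, I.cutBefore_succ]
  obtain ⟨A, hA⟩ : ∃ A : Prop, (∀ i < l, ¬ I.IsCut ω i v) = A := ⟨_, rfl⟩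
  rw [hA] at h3 h4 ⊢
  by_cases ht : I.Touched ω l j v
  · have : s' = s := by simp [s', touch, run_cond, hv, h1 ht]
    rw [this]
    simp only [ht, true_or, not_true, and_false, or_false, forall_true_left, false_imp_iff]
    exact ⟨h1 ht, trivial, h3, h4, fun w _ => SameAt.rfl⟩
  by_cases hd : I.radius ω l j + I.width < I.lvlDist l (I.ctr j) v
  · have : s' = s := by simp [s', touch, run_cond, hv, h2 ht, hs.v27, hs.v18, hs.a10, hd]
    have hd' : ¬ I.lvlDist l (I.ctr j) v ≤ I.radius ω l j + I.width := by omega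
    rw [this]
    simp only [ht, hd', false_and, or_false, false_imp_iff, not_false_eq_true, forall_true_left]
    exact ⟨trivial, h2 ht, h3, h4, fun w _ => SameAt.rfl⟩
  have hd' : I.lvlDist l (I.ctr j) v ≤ I.radius ω l j + I.width := by omega
  by_cases he : I.radius ω l j < I.lvlDist l (I.ctr j) v + I.width
  · have : s' = (s.store 9 v 1).store 1 v 0 := by
      simp [s', touch, run_cond, hv, h2 ht, hs.v27, hs.v18, hs.a10, hd, he]
    rw [this]
    simp only [ht, hd', he, or_true, not_false_eq_true, and_true, not_true, and_false,
      false_imp_iff, forall_true_left]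
    refine ⟨by simp, trivial, trivial, by simp, fun w hw => ?_⟩
    have := Fin.val_ne_of_ne hw
    constructor <;> simp [this]
  · have : s' = s.store 9 v 1 := by
      simp [s', touch, run_cond, hv, h2 ht, hs.v27, hs.v18, hs.a10, hd, he]
    rw [this]
    simp only [ht, hd', he, or_true, false_and, and_false, not_true,
      false_imp_iff, forall_true_left, or_false]
    refine ⟨by simp, trivial, by simpa using h3, by simpa using h4, fun w hw => ?_⟩
    have := Fin.val_ne_of_ne hw
    constructor <;> simp [this]

theorem run_vertexLoop {ω : ℕ → Bool} {l j : ℕ} {s : State} (hs : BallEnv I ω l j s)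
    (h : ∀ v, I.VInv ω l j s v) : ∀ v, I.VInv ω l (j + 1) (vertexLoop.run s) v := by
  have := forLt_rule (x := 22) (y := 0) (p := seq assignCluster touch) rfl s
    (fun k s' => ∀ v : Fin n, ((v : ℕ) < k → I.VInv ω l (j + 1) s' v) ∧
      (k ≤ (v : ℕ) → I.VInv ω l j s' v))
    (fun v => ⟨fun hv => by omega, fun _ => (h v).congr (by constructor <;> simp)⟩) ?_
  · rw [hs.v0] at this
    exact fun v => (this v).1 v.2
  rintro k hk s' hf hk' ih
  rw [hs.v0] at hk
  obtain ⟨v, rfl⟩ : ∃ v : Fin n, k = v := ⟨⟨k, hk⟩, rfl⟩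
  have hs' : BallEnv I ω l j s' := hs.of_frame hf (by decide) (by decide)
  have hold := (ih v).2 le_rfl
  obtain ⟨a1, a2, a3⟩ := run_assignCluster hs' hk' hold
  have hfa := assignCluster.frame s'
  have hs1 := hs'.of_frame hfa (by decide) (by decide)
  set s1 := assignCluster.run s' with hs1def
  have e9 := hfa.arrs 9 (by decide)
  have e1 := hfa.arrs 1 (by decide)
  obtain ⟨b1, b2, b3, b4, b5⟩ := run_touch hs1 (v := v)
    ((hfa.vars 22 (by decide)).trans hk') (by rw [e9]; exact hold.touched)
    (by rw [e9]; exact hold.not_touched) (by rw [e1]; exact hold.alive)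
    (by rw [e1]; exact hold.not_alive)
  have hft := touch.frame s1
  intro w
  rw [run_seq, ← hs1def]
  by_cases hw : w = v
  · subst hw
    refine ⟨fun _ => ?_, fun h => by omega⟩
    refine ⟨?_, fun hcl => (a2 hcl).congr ?_ ?_, b1, b2, b3, b4⟩
    · simpa [hft.arrs 8 (by decide)] using a1
    · simp [hft.arrs 11 (by decide)]
    · simp [hft.arrs 12 (by decide)]
  · have hw' := Fin.val_ne_of_ne hw
    have hsame : SameAt s' ((touch.run s1).assign 22 (v + 1)) w := by
      have := (a3 w hw).trans (b5 w hw)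
      exact ⟨this.a8, this.a9, this.a1, this.a11, this.a12⟩
    exact ⟨fun h => ((ih w).1 (by omega)).congr hsame, fun h => ((ih w).2 (by omega)).congr hsame⟩

theorem run_center {s : State} (hs : I.Env s) {j : ℕ} (hj : j ≤ n) (h21 : s.vars 21 = j) :
    (center.run s).vars 25 = I.ctr j := by
  cases j with
  | zero => simp [center, run_cond, h21, hs.v4, I.ctr_zero]
  | succ j =>
    have := I.ctr_succ ⟨j, hj⟩
    simp only at this
    simp [center, run_cond, h21, this]

theorem run_ball {ω : ℕ → Bool} {l j : ℕ} {s : State} (hs : I.Env s) (hj : j ≤ n)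
    (h14 : s.vars 14 = 2 ^ (I.expo + l)) (h21 : s.vars 21 = j)
    (hc : s.coins = fun i =>
      ω (l * ((n + 1) * (I.ucoins + I.gcoins)) + (j * (I.ucoins + I.gcoins) + i)))
    (h : ∀ v, I.VInv ω l j s v) :
    (∀ v, I.VInv ω l (j + 1) (ball.run s) v) ∧ (ball.run s).coins = fun i =>
      ω (l * ((n + 1) * (I.ucoins + I.gcoins)) + ((j + 1) * (I.ucoins + I.gcoins) + i)) := by
  simp only [ball, block, run_seq]
  have f1 := center.frame s
  have c1 := run_center hs hj h21
  set s1 := center.run s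
  have E1 := hs.of_frame f1 (by decide)
  have r2 := run_sampleRadius s1 (by rw [E1.v15, E1.v12])
  have f2 := sampleRadius.frame s1
  set s2 := sampleRadius.run s1
  have E2 := E1.of_frame f2 (by decide)
  have c2 : s2.vars 25 = I.ctr j := (f2.vars 25 (by decide)).trans c1
  have h14' : s2.vars 14 = 2 ^ (I.expo + l) :=
    (f2.vars 14 (by decide)).trans ((f1.vars 14 (by decide)).trans h14)
  have f3 := distances.frame s2
  have r3 := run_distances E2 _ c2
  rw [h14', E2.v16] at r3
  set s3 := distances.run s2
  have E3 := E2.of_frame f3 (by decide)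
  have hb : BallEnv I ω l j s3 := by
    refine ⟨E3, (f3.vars 14 (by decide)).trans h14', ?_, (f3.vars 25 (by decide)).trans c2, ?_, r3⟩
    · rw [f3.vars 21 (by decide), f2.vars 21 (by decide), f1.vars 21 (by decide), h21]
    · rw [f3.vars 27 (by decide), r2.1, E1.v12, E1.v8, f1.coins (by decide), hc]
      rfl
  have hsame : ∀ v : Fin n, SameAt s s3 v := by
    intro v
    have e : ∀ a ∈ [8, 9, 1, 11, 12], s3.arrs a = s.arrs a := by
      intro a ha
      rw [f3.arrs a (by revert a; decide), f2.arrs a (by revert a; decide),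
        f1.arrs a (by revert a; decide)]
    constructor
    · rw [e 8 (by simp)]
    · rw [e 9 (by simp)]
    · rw [e 1 (by simp)]
    · rw [e 11 (by simp)]
    · rw [e 12 (by simp)]; exact fun _ _ => rfl
  refine ⟨run_vertexLoop hb fun v => (h v).congr (hsame v), ?_⟩
  rw [(vertexLoop.frame s3).coins (by decide), f3.coins (by decide), r2.2, f1.coins (by decide), hc,
    E1.v12, E1.v8]
  funext i
  exact congrArg ω (by ring)

end Alg

end HopEmbed

/-! ### Weights and paths for pairs of vertices. -/

namespace HopEmbed

/-- The state contains the path `p` as the path number `k`. -/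
structure PathAt {n : ℕ} (s : State) (k : ℕ) {u v : Fin n}
    (p : (⊤ : SimpleGraph (Fin n)).Walk u v) : Prop where
  a4 : s.arrs 4 k = p.length
  a5 : s.arrs 5 k = k * n + k * n
  lt : p.length < n + n
  a6 : ∀ i ≤ p.length, s.arrs 6 (k * n + k * n + i) = p.getVert i

/-- The two states agree on weight and path of the pair number `k`. -/
structure SamePath (n : ℕ) (s s' : State) (k : ℕ) : Prop where
  a3 : s'.arrs 3 k = s.arrs 3 k
  a4 : s'.arrs 4 k = s.arrs 4 k
  a5 : s'.arrs 5 k = s.arrs 5 k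
  a6 : ∀ i < n + n, s'.arrs 6 (k * n + k * n + i) = s.arrs 6 (k * n + k * n + i)

theorem SamePath.trans {n : ℕ} {s s' s'' : State} {k : ℕ} (h : SamePath n s s' k)
    (h' : SamePath n s' s'' k) : SamePath n s s'' k :=
  ⟨h'.a3.trans h.a3, h'.a4.trans h.a4, h'.a5.trans h.a5,
    fun i hi => (h'.a6 i hi).trans (h.a6 i hi)⟩

theorem PathAt.congr {n : ℕ} {s s' : State} {k : ℕ} {u v : Fin n}
    {p : (⊤ : SimpleGraph (Fin n)).Walk u v} (h : PathAt s k p) (hs : SamePath n s s' k) :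
    PathAt s' k p :=
  ⟨hs.a4.trans h.a4, hs.a5.trans h.a5, h.lt, fun i hi =>
    (hs.a6 i (hi.trans_lt h.lt)).trans (h.a6 i hi)⟩

/-- The state contains the path `p` as the trace of its first vertex. -/
structure TraceAt {n : ℕ} (s : State) {v c : Fin n} (p : (⊤ : SimpleGraph (Fin n)).Walk v c) :
    Prop where
  lt : p.length < n
  a11 : s.arrs 11 v = p.length
  a12 : ∀ i ≤ p.length, s.arrs 12 (v * n + i) = p.getVert i

/-- Paths of different pairs occupy disjoint blocks of `2 * n` cells. -/
theorem cell_inj {n k k' i j : ℕ} (hi : i < n + n) (hj : j < n + n)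
    (h : k * n + k * n + i = k' * n + k' * n + j) : k = k' ∧ i = j := by
  have e : ∀ k i : ℕ, k * n + k * n + i = (n + n) * k + i := fun k i => by ring
  rw [e, e] at h
  have h1 := congrArg (· / (n + n)) h
  simp only [Nat.mul_add_div (show 0 < n + n by omega), Nat.div_eq_of_lt hi,
    Nat.div_eq_of_lt hj] at h1
  have : k = k' := by omega
  subst this
  exact ⟨rfl, by omega⟩

namespace Alg

open Prog

variable {n : ℕ} {I : Input n}

theorem run_copyPath {s : State} (hs : I.Env s) {u v c : Fin n} (h22 : s.vars 22 = u * n + v)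
    (h32 : s.vars 32 = u) (h33 : s.vars 33 = v) {p : (⊤ : SimpleGraph (Fin n)).Walk u c}
    {q : (⊤ : SimpleGraph (Fin n)).Walk v c} (hp : TraceAt s p) (hq : TraceAt s q) :
    (∀ i ≤ (p.append q.reverse).length, (copyPath.run s).arrs 6
      (((u : ℕ) * n + v) * n + ((u : ℕ) * n + v) * n + i) = (p.append q.reverse).getVert i) ∧
    ∀ k ≠ (u : ℕ) * n + v, ∀ i < n + n,
      (copyPath.run s).arrs 6 (k * n + k * n + i) = s.arrs 6 (k * n + k * n + i) := by
  set k₀ := (u : ℕ) * n + v with hk₀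
  have hlen : (p.append q.reverse).length = p.length + q.length := by simp
  have := forLt_rule (x := 23) (y := 37) (p := cond (.bin .lt (.load 11 (.var 32)) (.var 23))
    (store 6 (.var 22 * .var 0 + .var 22 * .var 0 + .var 23)
    (.load 12 (.var 33 * .var 0 + (.load 11 (.var 32) + .load 11 (.var 33) - .var 23))))
    (store 6 (.var 22 * .var 0 + .var 22 * .var 0 + .var 23)
    (.load 12 (.var 32 * .var 0 + .var 23)))) rfl s
    (fun t s' => (∀ i < t, i ≤ (p.append q.reverse).length →
      s'.arrs 6 (k₀ * n + k₀ * n + i) = (p.append q.reverse).getVert i) ∧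
      ∀ k ≠ k₀, ∀ i < n + n, s'.arrs 6 (k * n + k * n + i) = s.arrs 6 (k * n + k * n + i))
    (by simp) ?_
  · rw [hs.v37] at this
    refine ⟨fun i hi => this.1 i ?_ hi, this.2⟩
    have := hp.lt; have := hq.lt; omega
  rintro t ht s' hf ht' ⟨ih1, ih2⟩
  rw [hs.v37] at ht
  have hs' := hs.of_frame hf (by decide)
  have f22 := hf.vars 22 (by decide)
  have f32 := hf.vars 32 (by decide)
  have f33 := hf.vars 33 (by decide)
  have f11 := hf.arrs 11 (by decide)
  have f12 := hf.arrs 12 (by decide)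
  rw [h22] at f22
  rw [h32] at f32
  rw [h33] at f33
  obtain ⟨val, hval, hrun⟩ : ∃ val : ℕ, (t ≤ p.length + q.length →
      val = (p.append q.reverse).getVert t) ∧
      (cond (.bin .lt (.load 11 (.var 32)) (.var 23))
    (store 6 (.var 22 * .var 0 + .var 22 * .var 0 + .var 23)
    (.load 12 (.var 33 * .var 0 + (.load 11 (.var 32) + .load 11 (.var 33) - .var 23))))
    (store 6 (.var 22 * .var 0 + .var 22 * .var 0 + .var 23)
    (.load 12 (.var 32 * .var 0 + .var 23)))).run s' = s'.store 6 (k₀ * n + k₀ * n + t) val := by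
    by_cases h : p.length < t
    · refine ⟨s.arrs 12 (v * n + (p.length + q.length - t)), fun ht => ?_, ?_⟩
      · rw [hq.a12 _ (by omega), SimpleGraph.Walk.getVert_append, if_neg (by omega),
          SimpleGraph.Walk.getVert_reverse]
        congr 2; omega
      · simp [run_cond, f32, f33, f11, f12, f22, hs'.v0, ht', hp.a11, hq.a11, h]
    · refine ⟨s.arrs 12 (u * n + t), fun ht => ?_, ?_⟩
      · rw [hp.a12 _ (by omega), SimpleGraph.Walk.getVert_append]
        split_ifs with h'
        · rfl
        · have : t = p.length := by omega
          simp [this]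
      · simp [run_cond, f32, f11, f12, f22, hs'.v0, ht', hp.a11, h]
  rw [hrun]
  constructor
  · intro i hi hil
    simp only [State.assign_arrs, State.store_arrs]
    by_cases hit : i = t
    · subst hit
      simp [hval (by omega)]
    · simp [hit, ih1 i (by omega) hil]
  · intro k hk i hi
    simp only [State.assign_arrs, State.store_arrs]
    rw [if_neg, ih2 k hk i hi]
    rintro ⟨-, h⟩
    exact hk (cell_inj hi ht h).1

theorem run_pairStep_true {s : State} (hs : I.Env s) {u v c : Fin n} (h22 : s.vars 22 = u * n + v)
    (h8 : s.arrs 8 u = s.arrs 8 v) (h7 : s.arrs 7 (u * n + v) = 1)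
    {p : (⊤ : SimpleGraph (Fin n)).Walk u c}
    {q : (⊤ : SimpleGraph (Fin n)).Walk v c} (hp : TraceAt s p) (hq : TraceAt s q) :
    (pairStep.run s).arrs 7 = s.arrs 7 ∧
    (pairStep.run s).arrs 3 (u * n + v) = s.vars 19 ∧
    PathAt (pairStep.run s) (u * n + v) (p.append q.reverse) ∧
    ∀ k ≠ (u : ℕ) * n + v, SamePath n s (pairStep.run s) k := by
  set s1 := ((((s.assign 32 u).assign 33 v).store 3 (u * n + v) (s.vars 19)).store 4 (u * n + v)
    (p.length + q.length)).store 5 (u * n + v) ((u * n + v) * n + (u * n + v) * n) with hs1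
  have hrun : pairStep.run s = copyPath.run s1 := by
    simp [pairStep, block, run_cond, h22, hs.v0, Input.idx_div, Nat.mod_eq_of_lt v.2, h8, h7, hs1,
      hp.a11, hq.a11]
  have hs1E : I.Env s1 := by
    constructor <;> simp [hs1, hs.v0, hs.v4, hs.v5, hs.v8, hs.v10, hs.v12, hs.v15, hs.v16, hs.v17,
      hs.v18, hs.v37]
    funext k
    simp [hs.a0]
  obtain ⟨r1, r2⟩ := run_copyPath hs1E (u := u) (v := v) (p := p) (q := q) (by simp [hs1, h22])
    (by simp [hs1]) (by simp [hs1]) ⟨hp.lt, by simp [hs1, hp.a11], by simpa [hs1] using hp.a12⟩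
    ⟨hq.lt, by simp [hs1, hq.a11], by simpa [hs1] using hq.a12⟩
  have hf := copyPath.frame s1
  rw [hrun]
  refine ⟨?_, ?_, ⟨?_, ?_, ?_, r1⟩, fun k hk => ⟨?_, ?_, ?_, fun i hi => ?_⟩⟩
  · rw [hf.arrs 7 (by decide)]; funext x; simp [hs1]
  · rw [hf.arrs 3 (by decide)]; simp [hs1]
  · rw [hf.arrs 4 (by decide)]; simp [hs1]
  · rw [hf.arrs 5 (by decide)]; simp [hs1]
  · have := hp.lt; have := hq.lt
    simp only [SimpleGraph.Walk.length_append, SimpleGraph.Walk.length_reverse]; omega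
  · rw [hf.arrs 3 (by decide)]; simp [hs1, hk]
  · rw [hf.arrs 4 (by decide)]; simp [hs1, hk]
  · rw [hf.arrs 5 (by decide)]; simp [hs1, hk]
  · rw [r2 k hk i hi]; simp [hs1]

theorem run_pairStep_false {s : State} (hs : I.Env s) {u v : Fin n} (h22 : s.vars 22 = u * n + v)
    (h : s.arrs 8 u ≠ s.arrs 8 v ∨ s.arrs 7 (u * n + v) = 0) :
    (∀ k, (pairStep.run s).arrs 7 k = if k = u * n + v then 0 else s.arrs 7 k) ∧
    ∀ k, SamePath n s (pairStep.run s) k := by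
  by_cases h8 : s.arrs 8 u = s.arrs 8 v
  · have h7 : s.arrs 7 (u * n + v) = 0 := h.resolve_left (fun h => h h8)
    have hrun : pairStep.run s = (s.assign 32 u).assign 33 v := by
      simp [pairStep, block, run_cond, h22, hs.v0, Input.idx_div, Nat.mod_eq_of_lt v.2, h8, h7]
    rw [hrun]
    refine ⟨fun k => ?_, fun k => ⟨rfl, rfl, rfl, fun _ _ => rfl⟩⟩
    simp only [State.assign_arrs]
    split_ifs with hk
    · rw [hk, h7]
    · rfl
  · have hrun : pairStep.run s = ((s.assign 32 u).assign 33 v).store 7 (u * n + v) 0 := by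
      simp [pairStep, block, run_cond, h22, hs.v0, Input.idx_div, Nat.mod_eq_of_lt v.2, h8]
    rw [hrun]
    exact ⟨fun k => by simp, fun k => ⟨by simp, by simp, by simp, by simp⟩⟩

/-- The result for a pair after a level. -/
structure PairInv (I : Input n) (ω : ℕ → Bool) (l : ℕ) (s : State) (u v : Fin n) : Prop where
  together : (∀ i < l, I.cl ω i u = I.cl ω i v) → s.arrs 7 (u * n + v) = 1
  not_together : ¬ (∀ i < l, I.cl ω i u = I.cl ω i v) → s.arrs 7 (u * n + v) = 0
  wt : 1 ≤ I.common ω l u v → s.arrs 3 (u * n + v) = 2 ^ (I.levels + 1 - I.common ω l u v)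
  path : 1 ≤ I.common ω l u v → ∃ p : (⊤ : SimpleGraph (Fin n)).Walk u v,
    mixLen I.G (2 ^ (I.expo + (I.common ω l u v - 1))) (2 ^ I.levels) p ≤
      2 * (2 ^ I.ucoins * (I.gcoins + 2)) ∧
    PathAt s (u * n + v) p ∧ PathAt s (v * n + u) p.reverse

theorem common_succ (ω : ℕ → Bool) (l : ℕ) (u v : Fin n) [Decidable
    (∀ i < l + 1, I.cl ω i u = I.cl ω i v)] : I.common ω (l + 1) u v =
    if ∀ i < l + 1, I.cl ω i u = I.cl ω i v then l + 1 else I.common ω l u v := by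
  unfold Input.common
  rw [Nat.findGreatest_succ]
  congr

theorem run_pairs {ω : ℕ → Bool} {l : ℕ} {s : State} (hs : I.Env s)
    (h19 : s.vars 19 = 2 ^ (I.levels - l)) (hl : l < I.levels)
    (h8 : ∀ v : Fin n, s.arrs 8 v = I.cl ω l v + 1)
    (ht : ∀ v : Fin n, HasTrace I.G (2 ^ (I.expo + l)) (2 ^ I.levels) s (I.ctr (I.cl ω l v)) v)
    (h : ∀ u v, PairInv I ω l s u v) :
    ∀ u v, PairInv I ω (l + 1) ((forLt 22 5 pairStep).run s) u v := by
  classical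
  choose tr htr using ht
  have hT : ∀ v, TraceAt s (tr v) := fun v =>
    ⟨by have := (htr v).1.length_lt; rwa [Fintype.card_fin] at this, (htr v).2.2.1, (htr v).2.2.2⟩
  have htrL : ∀ v, mixLen I.G (2 ^ (I.expo + l)) (2 ^ I.levels) (tr v) ≤
      2 ^ I.ucoins * (I.gcoins + 2) := fun v => by
    rw [(htr v).2.1]
    have h1 := ((I.cl_eq_iff (ω := ω) (l := l) (v := v)).1 rfl).1
    have h2 : I.radius ω l (I.cl ω l v) < 2 ^ I.ucoins * (I.gcoins + 2) := tapeRadius_lt ..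
    exact h1.trans h2.le
  -- The route is a function of the two traces, and exchanging the vertices reverses it. Therefore
  -- the entries for `(u, v)` and `(v, u)`, although written separately, hold opposite paths.
  let pr : ∀ u v, I.cl ω l u = I.cl ω l v → (⊤ : SimpleGraph (Fin n)).Walk u v := fun u v e =>
    (tr u).append (((tr v).copy rfl (congrArg I.ctr e.symm)).reverse)
  have hpr_rev : ∀ u v e, (pr u v e).reverse = pr v u e.symm := fun u v e => by
    have : ∀ (c c' : Fin n) (e : c' = c) (p : (⊤ : SimpleGraph (Fin n)).Walk u c)
        (q : (⊤ : SimpleGraph (Fin n)).Walk v c'),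
        (p.append (q.copy rfl e).reverse).reverse = q.append (p.copy rfl e.symm).reverse := by
      rintro c _ rfl p q
      simp
    exact this _ _ _ _ _
  have hpr_len : ∀ u v e, mixLen I.G (2 ^ (I.expo + l)) (2 ^ I.levels) (pr u v e) ≤
      2 * (2 ^ I.ucoins * (I.gcoins + 2)) := fun u v e => by
    have : ∀ (c c' : Fin n) (e : c' = c) (p : (⊤ : SimpleGraph (Fin n)).Walk u c)
        (q : (⊤ : SimpleGraph (Fin n)).Walk v c'), ∀ a T,
        mixLen I.G a T (p.append (q.copy rfl e).reverse) = mixLen I.G a T p + mixLen I.G a T q := by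
      rintro c _ rfl p q a T
      rw [mixLen_append, mixLen_reverse]
      rfl
    rw [this]
    have := htrL u; have := htrL v; omega
  -- Each position is changed only in its own step. The second clause records that positions not yet
  -- visited still hold the data of the previous level.
  have key := forLt_rule (x := 22) (y := 5) (p := pairStep) rfl s
    (fun k s' => ∀ u v : Fin n, ((u : ℕ) * n + v < k →
        ((∀ i < l + 1, I.cl ω i u = I.cl ω i v) → s'.arrs 7 (u * n + v) = 1 ∧
          s'.arrs 3 (u * n + v) = s.vars 19 ∧
          ∀ e : I.cl ω l u = I.cl ω l v, PathAt s' (u * n + v) (pr u v e)) ∧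
        (¬ (∀ i < l + 1, I.cl ω i u = I.cl ω i v) → s'.arrs 7 (u * n + v) = 0 ∧
          SamePath n s s' (u * n + v))) ∧
      (k ≤ (u : ℕ) * n + v → s'.arrs 7 (u * n + v) = s.arrs 7 (u * n + v) ∧
        SamePath n s s' (u * n + v)))
    (fun u v => ⟨fun h => by omega, fun _ => ⟨rfl, ⟨rfl, rfl, rfl, fun _ _ => rfl⟩⟩⟩) ?_
  · rw [hs.v5] at key
    intro u v
    have k1 := (key u v).1 (Input.idx_lt u v)
    have k2 := (key v u).1 (Input.idx_lt v u)
    have hc := common_succ (I := I) ω l u v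
    by_cases hA : ∀ i < l + 1, I.cl ω i u = I.cl ω i v
    · rw [if_pos hA] at hc
      have hA' : ∀ i < l + 1, I.cl ω i v = I.cl ω i u := fun i hi => (hA i hi).symm
      refine ⟨fun _ => (k1.1 hA).1, fun h => absurd hA h, fun _ => ?_, fun _ => ?_⟩
      · rw [(k1.1 hA).2.1, hc, h19]; congr 1; omega
      · rw [hc]
        have e := hA l (by omega)
        refine ⟨pr u v e, hpr_len u v e, (k1.1 hA).2.2 e, ?_⟩
        rw [hpr_rev u v e]
        exact (k2.1 hA').2.2 e.symm
    · rw [if_neg hA] at hc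
      have hA' : ¬ ∀ i < l + 1, I.cl ω i v = I.cl ω i u := fun h => hA fun i hi => (h i hi).symm
      refine ⟨fun h => absurd h hA, fun _ => (k1.2 hA).1, fun h1 => ?_, fun h1 => ?_⟩
      · rw [hc] at h1 ⊢
        rw [(k1.2 hA).2.a3, (h u v).wt h1]
      · rw [hc] at h1 ⊢
        obtain ⟨p, hp1, hp2, hp3⟩ := (h u v).path h1
        exact ⟨p, hp1, hp2.congr (k1.2 hA).2, hp3.congr (k2.2 hA').2⟩
  rintro k hk s' hf hk' ih
  rw [hs.v5] at hk
  have hs' := hs.of_frame hf (by decide)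
  have f8 := hf.arrs 8 (by decide)
  have f11 := hf.arrs 11 (by decide)
  have f12 := hf.arrs 12 (by decide)
  have f19 := hf.vars 19 (by decide)
  obtain ⟨x, y, rfl, -⟩ := Input.exists_idx hk
  have hT' : ∀ v, TraceAt s' (tr v) := fun v =>
    ⟨(hT v).lt, by rw [f11]; exact (hT v).a11, by rw [f12]; exact (hT v).a12⟩
  obtain ⟨o7, oS⟩ := (ih x y).2 le_rfl
  have hiff : (∀ i < l + 1, I.cl ω i x = I.cl ω i y) ↔
      (∀ i < l, I.cl ω i x = I.cl ω i y) ∧ I.cl ω l x = I.cl ω l y := by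
    simp only [Nat.lt_succ_iff_lt_or_eq]
    grind
  suffices hmain : ((∀ i < l + 1, I.cl ω i x = I.cl ω i y) →
        (pairStep.run s').arrs 7 (x * n + y) = 1 ∧
        (pairStep.run s').arrs 3 (x * n + y) = s.vars 19 ∧
        ∀ e : I.cl ω l x = I.cl ω l y, PathAt (pairStep.run s') (x * n + y) (pr x y e)) ∧
      (¬ (∀ i < l + 1, I.cl ω i x = I.cl ω i y) → (pairStep.run s').arrs 7 (x * n + y) = 0 ∧
        SamePath n s' (pairStep.run s') (x * n + y)) ∧
      ∀ k ≠ (x : ℕ) * n + y, (pairStep.run s').arrs 7 k = s'.arrs 7 k ∧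
        SamePath n s' (pairStep.run s') k by
    obtain ⟨m1, m2, m3⟩ := hmain
    have back : ∀ k, SamePath n (pairStep.run s')
        ((pairStep.run s').assign 22 ((x : ℕ) * n + y + 1)) k := fun k =>
      ⟨rfl, rfl, rfl, fun _ _ => rfl⟩
    intro u v
    by_cases huv : (u : ℕ) * n + v = x * n + y
    · obtain ⟨rfl, rfl⟩ := Input.idx_inj huv
      refine ⟨fun _ => ⟨fun hA => ?_, fun hA => ?_⟩, fun h => by omega⟩
      · exact ⟨(m1 hA).1, (m1 hA).2.1, fun e => ((m1 hA).2.2 e).congr (back _)⟩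
      · exact ⟨(m2 hA).1, (oS.trans (m2 hA).2).trans (back _)⟩
    · obtain ⟨n1, n2⟩ := m3 _ huv
      refine ⟨fun hlt => ⟨fun hA => ?_, fun hA => ?_⟩, fun hle => ?_⟩
      · obtain ⟨i1, i2, i3⟩ := ((ih u v).1 (by omega)).1 hA
        exact ⟨n1.trans i1, n2.a3.trans i2, fun e => ((i3 e).congr n2).congr (back _)⟩
      · obtain ⟨i1, i2⟩ := ((ih u v).1 (by omega)).2 hA
        exact ⟨n1.trans i1, (i2.trans n2).trans (back _)⟩
      · obtain ⟨i1, i2⟩ := (ih u v).2 (by omega)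
        exact ⟨n1.trans i1, (i2.trans n2).trans (back _)⟩
  by_cases hA : ∀ i < l + 1, I.cl ω i x = I.cl ω i y
  · have e := (hiff.1 hA).2
    have hTy : TraceAt s' ((tr y).copy rfl (congrArg I.ctr e.symm)) := by
      have := hT' y
      exact ⟨by simpa using this.lt, by simpa using this.a11, by simpa using this.a12⟩
    obtain ⟨r1, r2, r3, r4⟩ := run_pairStep_true hs' hk' (by rw [f8, h8, h8, e])
      (by rw [o7]; exact (h x y).together (hiff.1 hA).1) (hT' x) hTy
    refine ⟨fun _ => ⟨?_, r2.trans f19, fun _ => r3⟩, fun h => absurd hA h, fun k hk =>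
      ⟨by rw [r1], r4 k hk⟩⟩
    rw [r1, o7]; exact (h x y).together (hiff.1 hA).1
  · obtain ⟨r1, r2⟩ := run_pairStep_false hs' hk' (by
      rw [f8, h8, h8, o7]
      by_cases hB : ∀ i < l, I.cl ω i x = I.cl ω i y
      · left
        exact fun e => hA (hiff.2 ⟨hB, by omega⟩)
      · exact Or.inr ((h x y).not_together hB))
    exact ⟨fun h => absurd h hA, fun _ => ⟨by rw [r1, if_pos rfl], r2 _⟩, fun k hk =>
      ⟨by rw [r1, if_neg hk], r2 _⟩⟩

end Alg

end HopEmbed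

/-! ### The choice of the parameters and the hierarchy of clusters. -/

namespace HopEmbed

namespace Input

variable {n : ℕ} (I : Input n)

theorem hops_pos (hn : 0 < n) (hh : 1 ≤ I.h) : 0 < I.hops := by
  unfold hops; split_ifs <;> omega

theorem hops_le : I.hops ≤ n := by unfold hops; split_ifs <;> omega

theorem le_pow_clog (k : ℕ) : k ≤ 2 ^ Nat.clog 2 k := Nat.le_pow_clog (by norm_num) k

theorem gcoins_add_two_le : I.gcoins + 2 ≤ 2 ^ I.mu := le_pow_clog _

/-- `2 ^ q` is at least `8 * hops`, because `q` contains the rounded logarithm of `hops` and a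
summand `3`. -/
theorem width_le : I.width ≤ 2 ^ I.ucoins := by
  have h1 := le_pow_clog I.hops
  unfold width ucoins q
  rw [pow_add, pow_add, pow_add, pow_add]
  have h2 : 0 < 2 ^ Nat.clog 2 I.levels := by positivity
  have h3 : 0 < 2 ^ Nat.clog 2 (I.ε.den / I.ε.num.toNat + 1) := by positivity
  calc I.hops * (2 ^ I.levels + 2 ^ I.levels) = I.hops * 1 * 1 * 2 * 2 ^ I.levels := by ring
    _ ≤ _ := by gcongr <;> omega

theorem w_le_total {u v : Fin n} (h : u ≠ v) : I.G.w s(u, v) ≤ I.total := by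
  rw [← I.mat_of_ne h]
  exact Finset.single_le_sum (f := I.mat) (fun _ _ => Nat.zero_le _) (Finset.mem_range.2 (idx_lt u v))

theorem le_radius (ω : ℕ → Bool) (l j : ℕ) : 2 ^ I.ucoins ≤ I.radius ω l j := le_tapeRadius ..

/-- At the coarsest level the first ball, around the root, takes everything. A single edge from the
root costs no more than the smallest radius: half of it covers the weight, by the choice of
`levels`, and half covers the hop. -/
theorem cl_zero (ω : ℕ → Bool) (v : Fin n) : I.cl ω 0 v = 0 := by
  rw [cl_eq_iff]
  refine ⟨(le_trans ?_ (I.le_radius ω 0 0)), by simp⟩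
  rw [ctr_zero, lvlDist]
  by_cases h : I.r = v
  · rw [h, mixDist_self]; exact Nat.zero_le _
  have h1 := mixDist_le_edge (G := I.G) (a := 2 ^ (I.expo + 0)) (T := 2 ^ I.levels) I.r h
  rw [mixDist_self] at h1
  have h2 := I.w_le_total h
  have h3 := le_pow_clog I.total
  have hq : 1 ≤ I.q := by unfold q; omega
  have h4 : 2 * (2 ^ I.mu * I.total) * 2 ≤ 2 ^ I.levels := by
    have : 2 ^ I.levels = 2 ^ Nat.clog 2 I.total * 2 ^ I.mu * 4 := by
      unfold levels; rw [pow_add, pow_add]; norm_num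
    rw [this]
    calc 2 * (2 ^ I.mu * I.total) * 2 = I.total * 2 ^ I.mu * 4 := by ring
      _ ≤ _ := by gcongr
  have h5 : 2 ^ (I.expo + 0) * I.G.w s(I.r, v) * 2 ≤ 2 ^ I.ucoins := by
    calc 2 ^ (I.expo + 0) * I.G.w s(I.r, v) * 2 ≤ 2 ^ (I.expo + 0) * I.total * 2 := by gcongr
      _ = 2 ^ I.q * (2 * (2 ^ I.mu * I.total) * 2) := by
        unfold expo; rw [add_zero, pow_add, pow_add]; ring
      _ ≤ 2 ^ I.q * 2 ^ I.levels := by gcongr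
      _ = _ := by rw [ucoins, pow_add]
  have h6 : 2 ^ I.levels * 2 ≤ 2 ^ I.ucoins := by
    rw [ucoins, pow_add, mul_comm]
    gcongr
    calc 2 = 2 ^ 1 := rfl
      _ ≤ _ := Nat.pow_le_pow_right (by norm_num) hq
  omega

theorem levels_pos : 0 < I.levels := by unfold levels; omega

theorem common_le (ω : ℕ → Bool) (k : ℕ) (u v : Fin n) : I.common ω k u v ≤ k :=
  Nat.findGreatest_le _

theorem cl_eq_of_lt_common {ω : ℕ → Bool} {k i : ℕ} {u v : Fin n} (h : i < I.common ω k u v) :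
    I.cl ω i u = I.cl ω i v := by
  classical
  have := Nat.findGreatest_spec (P := fun l => ∀ i < l, I.cl ω i u = I.cl ω i v) (n := k)
    (Nat.zero_le _) (by simp)
  unfold common at h
  exact this i (by convert h)

theorem le_common {ω : ℕ → Bool} {k l : ℕ} {u v : Fin n} (hl : l ≤ k)
    (h : ∀ i < l, I.cl ω i u = I.cl ω i v) : l ≤ I.common ω k u v := by
  classical
  unfold common
  exact Nat.le_findGreatest (P := fun l => ∀ i < l, I.cl ω i u = I.cl ω i v) hl h

theorem common_comm (ω : ℕ → Bool) (k : ℕ) (u v : Fin n) :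
    I.common ω k u v = I.common ω k v u :=
  le_antisymm (I.le_common (I.common_le ..) fun _ hi => (I.cl_eq_of_lt_common hi).symm)
    (I.le_common (I.common_le ..) fun _ hi => (I.cl_eq_of_lt_common hi).symm)

theorem one_le_common (ω : ℕ → Bool) (u v : Fin n) : 1 ≤ I.common ω I.levels u v :=
  I.le_common I.levels_pos fun i hi => by
    obtain rfl : i = 0 := by omega
    rw [cl_zero, cl_zero]

/-- This is the ultrametric inequality for the tree weights, in terms of the number of common
levels. -/
theorem min_le_common (ω : ℕ → Bool) (k : ℕ) (u v x : Fin n) :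
    min (I.common ω k u v) (I.common ω k v x) ≤ I.common ω k u x :=
  I.le_common ((min_le_left _ _).trans (I.common_le ..)) fun _ hi =>
    (I.cl_eq_of_lt_common (hi.trans_le (min_le_left _ _))).trans
      (I.cl_eq_of_lt_common (hi.trans_le (min_le_right _ _)))

theorem cl_ne_of_common_lt {ω : ℕ → Bool} {k : ℕ} {u v : Fin n} (h : I.common ω k u v < k) :
    I.cl ω (I.common ω k u v) u ≠ I.cl ω (I.common ω k u v) v := fun e => by
  have := I.le_common (ω := ω) (k := k) (l := I.common ω k u v + 1) (u := u) (v := v) h fun i hi => by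
    rcases Nat.lt_succ_iff_lt_or_eq.1 hi with hi | rfl
    · exact I.cl_eq_of_lt_common hi
    · exact e
  omega

/-- The first ball is centered at the root and its radius is at least `width`, so it swallows the
whole neighbourhood. This is why the root heads the sequence of centers. -/
theorem alive_root (ω : ℕ → Bool) : I.Alive ω I.r := by
  rintro l - ⟨j, h1, h2, h3⟩
  beta_reduce at h1 h2 h3
  have e : I.lvlDist l (I.ctr 0) I.r = 0 := by rw [ctr_zero, lvlDist, mixDist_self]
  have hw := I.width_le
  have hR := I.le_radius ω l 0
  rcases Nat.eq_zero_or_pos j with rfl | hj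
  · omega
  · have := h3 0 hj
    omega

/-- A walk whose length is at most twice the largest radius is light and has few hops. -/
theorem weight_le_of_mixLen_le {k : ℕ} (hk : 1 ≤ k) (hk' : k ≤ I.levels) {u v : Fin n}
    {p : (⊤ : SimpleGraph (Fin n)).Walk u v}
    (h : mixLen I.G (2 ^ (I.expo + (k - 1))) (2 ^ I.levels) p ≤
      2 * (2 ^ I.ucoins * (I.gcoins + 2))) :
    pathWeight I.G.w p ≤ 2 ^ (I.levels + 1 - k) ∧ p.length ≤ 2 ^ I.expo := by
  -- The definition `expo = q + 1 + mu` is made for this: `mu` covers the spread of the radii and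
  -- `1` the two halves of the walk.
  have h1 : 2 * (2 ^ I.ucoins * (I.gcoins + 2)) ≤ 2 ^ (I.expo + I.levels) := by
    calc 2 * (2 ^ I.ucoins * (I.gcoins + 2)) ≤ 2 * (2 ^ I.ucoins * 2 ^ I.mu) := by
          have := I.gcoins_add_two_le
          gcongr
      _ = _ := by unfold ucoins expo; simp only [pow_add, pow_one]; ring
  have h2 := h.trans h1
  unfold mixLen at h2
  constructor
  · refine (pathWeight_le_sum _ _).trans ?_
    refine le_of_mul_le_mul_left (a := 2 ^ (I.expo + (k - 1))) ?_ (by positivity)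
    rw [← pow_add, show I.expo + (k - 1) + (I.levels + 1 - k) = I.expo + I.levels by omega]
    exact (Nat.le_add_right _ _).trans h2
  · refine le_of_mul_le_mul_left (a := 2 ^ I.levels) ?_ (by positivity)
    rw [← pow_add, add_comm I.levels]
    exact (Nat.le_add_left _ _).trans h2

end Input

end HopEmbed

/-! ### Levels, parents and the adjacency matrix. -/

namespace HopEmbed

namespace Alg

open Prog

variable {n : ℕ} {I : Input n}

theorem PairInv.congr {ω : ℕ → Bool} {l : ℕ} {s s' : State} {u v : Fin n}
    (h : PairInv I ω l s u v) (hs : ∀ a ∈ [3, 4, 5, 6, 7], s'.arrs a = s.arrs a) :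
    PairInv I ω l s' u v := by
  have hS : ∀ k, SamePath n s s' k := fun k => by
    constructor
    · rw [hs 3 (by simp)]
    · rw [hs 4 (by simp)]
    · rw [hs 5 (by simp)]
    · rw [hs 6 (by simp)]; exact fun _ _ => rfl
  refine ⟨fun ht => ?_, fun ht => ?_, fun ht => (hS _).a3.trans (h.wt ht), fun ht => ?_⟩
  · rw [hs 7 (by simp)]; exact h.together ht
  · rw [hs 7 (by simp)]; exact h.not_together ht
  · obtain ⟨p, h1, h2, h3⟩ := h.path ht
    exact ⟨p, h1, h2.congr (hS _), h3.congr (hS _)⟩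

/-- The state before level `l`. -/
structure LevelInv (I : Input n) (ω : ℕ → Bool) (l : ℕ) (s : State) : Prop extends I.Env s where
  v14 : s.vars 14 = 2 ^ (I.expo + l)
  v19 : s.vars 19 = 2 ^ (I.levels - l)
  coins : s.coins = fun i => ω (l * ((n + 1) * (I.ucoins + I.gcoins)) + i)
  alive : ∀ v : Fin n, (∀ i < l, ¬ I.IsCut ω i v) → s.arrs 1 v = 1
  not_alive : ∀ v : Fin n, ¬ (∀ i < l, ¬ I.IsCut ω i v) → s.arrs 1 v = 0
  pairs : ∀ u v, PairInv I ω l s u v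

theorem run_clear {s : State} (hs : I.Env s) (v : Fin n) :
    (clear.run s).arrs 8 v = 0 ∧ (clear.run s).arrs 9 v = 0 := by
  have := forLt_rule (x := 22) (y := 0)
    (p := seq (store 8 (.var 22) (.const 0)) (store 9 (.var 22) (.const 0))) rfl s
    (fun k s' => ∀ i < k, s'.arrs 8 i = 0 ∧ s'.arrs 9 i = 0) (by simp) ?_
  · rw [hs.v0] at this
    exact this v v.2
  intro k hk s' hf hk' ih i hi
  by_cases hik : i = k
  · simp [hk', hik]
  · simpa [hk', hik] using ih i (by omega)

theorem run_level {ω : ℕ → Bool} {l : ℕ} {s : State} (hs : LevelInv I ω l s) (hl : l < I.levels) :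
    LevelInv I ω (l + 1) (level.run s) := by
  have hF := level.frame s
  simp only [level, block, run_seq, run_assign] at hF ⊢
  have f1 := clear.frame s
  have r1 := run_clear hs.1
  set s1 := clear.run s
  have E1 := hs.1.of_frame f1 (by decide)
  have hV : ∀ v, I.VInv ω l 0 s1 v := fun v => by
    have a1 : s1.arrs 1 = s.arrs 1 := f1.arrs 1 (by decide)
    refine ⟨by simp [(r1 v).1], by simp, fun ⟨i, hi, _⟩ => by omega, fun _ => (r1 v).2, fun h => ?_,
      fun h => ?_⟩
    · rw [a1]; exact hs.alive v h.1
    · rw [a1]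
      refine hs.not_alive v fun h' => h ⟨h', fun ⟨i, hi, _⟩ => by omega⟩
  have h14 : s1.vars 14 = 2 ^ (I.expo + l) := (f1.vars 14 (by decide)).trans hs.v14
  have key := forLt_rule (x := 21) (y := 17) (p := ball) rfl s1
    (fun j s' => (∀ v, I.VInv ω l j s' v) ∧ s'.coins = fun i =>
      ω (l * ((n + 1) * (I.ucoins + I.gcoins)) + (j * (I.ucoins + I.gcoins) + i)))
    ⟨fun v => (hV v).congr ⟨rfl, rfl, rfl, rfl, fun _ _ => rfl⟩, by
      simp only [State.assign_coins, f1.coins (by decide), hs.coins, zero_mul, zero_add]⟩ ?_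
  swap
  · rintro j hj s' hf hj' ⟨h1, h2⟩
    rw [E1.v17] at hj
    have := run_ball (E1.of_frame hf (by decide)) (by omega) ((hf.vars 14 (by decide)).trans h14)
      hj' h2 h1
    exact ⟨fun v => (this.1 v).congr ⟨rfl, rfl, rfl, rfl, fun _ _ => rfl⟩, this.2⟩
  rw [E1.v17] at key
  have f2 := (forLt 21 17 ball).frame s1
  set s2 := (forLt 21 17 ball).run s1
  have E2 := E1.of_frame f2 (by decide)
  obtain ⟨hV2, hc2⟩ := key
  have hlt : ∀ v, I.cl ω l v < n + 1 := fun v => Nat.lt_succ_of_le (I.cl_le_card ω l v)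
  have k3 := run_pairs (ω := ω) (l := l) E2
    (by rw [f2.vars 19 (by decide), f1.vars 19 (by decide), hs.v19]) hl
    (fun v => by rw [(hV2 v).a8, if_pos (hlt v)]) (fun v => (hV2 v).tr (hlt v))
    (fun u v => (hs.pairs u v).congr fun a ha => by
      rw [f2.arrs a (by revert a; decide), f1.arrs a (by revert a; decide)])
  have f3 := (forLt 22 5 pairStep).frame s2
  set s3 := (forLt 22 5 pairStep).run s2
  have e14 : s3.vars 14 = 2 ^ (I.expo + l) := by
    rw [f3.vars 14 (by decide), f2.vars 14 (by decide), h14]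
  have e19 : s3.vars 19 = 2 ^ (I.levels - l) := by
    rw [f3.vars 19 (by decide), f2.vars 19 (by decide), f1.vars 19 (by decide), hs.v19]
  have hcut : ∀ v, (∀ i < l + 1, ¬ I.IsCut ω i v) ↔
      (∀ i < l, ¬ I.IsCut ω i v) ∧ ¬ I.CutBefore ω l (n + 1) v := fun v => by
    rw [← I.isCut_iff]
    simp only [Nat.lt_succ_iff_lt_or_eq]
    grind
  have hal : s3.arrs 1 = s2.arrs 1 := f3.arrs 1 (by decide)
  refine ⟨?_, ?_, ?_, ?_, fun v hv => ?_, fun v hv => ?_, fun u v => (k3 u v).congr fun _ _ => rfl⟩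
  · exact hs.1.of_frame (p := level) hF (by decide)
  · simp [e14]; ring
  · simp [e19]
    rw [show I.levels - l = I.levels - (l + 1) + 1 by omega, pow_succ]
    omega
  · simp only [State.assign_coins]
    rw [f3.coins (by decide), hc2]
    funext i
    exact congrArg ω (by ring)
  · simp only [State.assign_arrs, hal]
    exact (hV2 v).alive ((hcut v).1 hv)
  · simp only [State.assign_arrs, hal]
    exact (hV2 v).not_alive fun h => hv ((hcut v).2 h)

/-- The weights of the tree edges as computed by the program. -/
theorem LevelInv.arrs_three {ω : ℕ → Bool} {s : State} (h : LevelInv I ω I.levels s) (u v : Fin n) :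
    s.arrs 3 (u * n + v) = 2 ^ (I.levels + 1 - I.common ω I.levels u v) :=
  (h.pairs u v).wt (I.one_le_common ω u v)

theorem run_parentStep {s : State} (hs : I.Env s) {j : ℕ} (hj : j ≤ n)
    (h21 : s.vars 21 = j) {v : Fin n} (h22 : s.vars 22 = v) :
    ((parentStep.run s).vars 34 = if s.arrs 1 (I.ctr j) = 0 ∨ (v : ℕ) < j ∨
        (s.vars 34 ≠ 0 ∧ s.vars 34 ≤ s.arrs 3 (I.ctr j * n + v)) then s.vars 34 else
      s.arrs 3 (I.ctr j * n + v)) ∧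
    ((parentStep.run s).vars 35 = if s.arrs 1 (I.ctr j) = 0 ∨ (v : ℕ) < j ∨
        (s.vars 34 ≠ 0 ∧ s.vars 34 ≤ s.arrs 3 (I.ctr j * n + v)) then s.vars 35 else I.ctr j) := by
  have f := center.frame s
  have c := run_center hs hj h21
  have e22 := f.vars 22 (by decide)
  have e21 := f.vars 21 (by decide)
  have e34 := f.vars 34 (by decide)
  have e35 := f.vars 35 (by decide)
  have e1 := f.arrs 1 (by decide)
  have e3 := f.arrs 3 (by decide)
  have e0 := (hs.of_frame f (by decide)).v0
  rw [h22] at e22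
  rw [h21] at e21
  simp only [parentStep, run_seq]
  set s1 := center.run s
  by_cases h1 : s.arrs 1 (I.ctr j) = 0
  · simp [run_cond, c, e1, h1, e34, e35]
  by_cases h2 : (v : ℕ) < j
  · simp [run_cond, c, e1, h1, e34, e35, e22, e21, h2]
  by_cases h3 : s.vars 34 = 0
  · simp [run_cond, c, e1, e3, h1, e34, e22, e21, h2, h3, e0]
  by_cases h4 : s.arrs 3 (I.ctr j * n + v) < s.vars 34
  · simp [run_cond, c, e1, e3, h1, e34, e22, e21, h2, h3, h4, e0]
  · simp [run_cond, c, e1, e3, h1, e34, e35, e22, e21, h2, h3, h4, e0]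

theorem run_parents {ω : ℕ → Bool} {s : State} (hs : LevelInv I ω I.levels s) (v : Fin n) :
    ∃ u : Fin n, I.IsParent ω u v ∧ (parents.run s).arrs 13 v = u := by
  have key := forLt_rule (x := 22) (y := 0) (p := block [assign 34 (.const 0), assign 35 (.const 0),
    forLt 21 17 parentStep, store 13 (.var 22) (.var 35)]) rfl s
    (fun k s' => ∀ v : Fin n, (v : ℕ) < k → ∃ u : Fin n, I.IsParent ω u v ∧ s'.arrs 13 v = u)
    (fun v hv => by omega) ?_
  · rw [hs.v0] at key
    exact key v v.2
  clear v
  intro k hk s' hf hk' ih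
  rw [hs.v0] at hk
  obtain ⟨v, rfl⟩ : ∃ v : Fin n, k = v := ⟨⟨k, hk⟩, rfl⟩
  have hs' := hs.1.of_frame hf (by decide)
  have e1 := hf.arrs 1 (by decide)
  have e3 := hf.arrs 3 (by decide)
  simp only [block, run_seq, run_assign, run_store]
  set s1 := (s'.assign 34 ((Expr.const 0).eval s')).assign 35
    ((Expr.const 0).eval (s'.assign 34 ((Expr.const 0).eval s'))) with hs1
  have E1 : I.Env s1 := hs'.of_frame (p := seq (assign 34 (.const 0)) (assign 35 (.const 0)))
    ((seq (assign 34 (.const 0)) (assign 35 (.const 0))).frame s') (by decide)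
  have h22 : s1.vars 22 = v := by simp [hs1, hk']
  have wpos : ∀ u v : Fin n, 0 < s.arrs 3 (u * n + v) := fun u v => by
    rw [hs.arrs_three]; positivity
  -- The invariant distinguishes whether a surviving candidate has been met. If so, the registers
  -- describe the lightest one, and the earliest among those.
  have loop := forLt_rule (x := 21) (y := 17) (p := parentStep) rfl s1
    (fun j s2 => ((∀ i < j, i ≤ (v : ℕ) → ¬ I.Alive ω (I.ctr i)) → s2.vars 34 = 0) ∧
      ((∃ i < j, i ≤ (v : ℕ) ∧ I.Alive ω (I.ctr i)) → ∃ i₀ < j, i₀ ≤ (v : ℕ) ∧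
        I.Alive ω (I.ctr i₀) ∧ s2.vars 35 = I.ctr i₀ ∧ s2.vars 34 = s.arrs 3 (I.ctr i₀ * n + v) ∧
        ∀ i < j, i ≤ (v : ℕ) → I.Alive ω (I.ctr i) →
          s.arrs 3 (I.ctr i₀ * n + v) ≤ s.arrs 3 (I.ctr i * n + v) ∧
          (s.arrs 3 (I.ctr i₀ * n + v) = s.arrs 3 (I.ctr i * n + v) → i₀ ≤ i)))
    ⟨fun _ => by simp [hs1], by simp⟩ ?_
  · rw [E1.v17] at loop
    have f21 := (forLt 21 17 parentStep).frame s1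
    have g22 : ((forLt 21 17 parentStep).run s1).vars 22 = v := (f21.vars 22 (by decide)).trans h22
    have g13 : ((forLt 21 17 parentStep).run s1).arrs 13 = s'.arrs 13 := f21.arrs 13 (by decide)
    -- The root, at position `0`, always survives, so every vertex has a candidate. The entry of the
    -- root itself is ignored later.
    obtain ⟨i₀, -, h1, h2, h3, -, h4⟩ := loop.2 ⟨0, by omega, by omega, by
      rw [I.ctr_zero]; exact I.alive_root ω⟩
    intro w hw
    by_cases hwv : w = v
    · subst hwv
      refine ⟨I.ctr i₀, ⟨i₀, h1, rfl, h2, fun i hi hA => ?_⟩, by simp [g22, h3]⟩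
      obtain ⟨q1, q2⟩ := h4 i (by have := w.2; omega) hi hA
      rw [hs.arrs_three, hs.arrs_three] at q1 q2
      have c1 := I.common_le ω I.levels (I.ctr i) w
      have c2 := I.common_le ω I.levels (I.ctr i₀) w
      have q1' := (Nat.pow_le_pow_iff_right (by norm_num : 1 < 2)).1 q1
      exact ⟨by omega, fun h => q2 (by rw [h])⟩
    · have hne := Fin.val_ne_of_ne hwv
      obtain ⟨u, hu1, hu2⟩ := ih w (by omega)
      exact ⟨u, hu1, by simp [g22, hne, g13, hu2]⟩
  rintro j hj s2 hf2 hj2 ⟨ih1, ih2⟩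
  rw [E1.v17] at hj
  have E2 := E1.of_frame hf2 (by decide)
  obtain ⟨r1, r2⟩ := run_parentStep E2 (j := j) (by omega) hj2
    ((hf2.vars 22 (by decide)).trans h22)
  have x1 : s2.arrs 1 = s.arrs 1 := (hf2.arrs 1 (by decide)).trans e1
  have x3 : s2.arrs 3 = s.arrs 3 := (hf2.arrs 3 (by decide)).trans e3
  rw [x1, x3] at r1 r2
  simp only [State.assign_vars, show ¬ (34 = 21) by norm_num, show ¬ (35 = 21) by norm_num, if_false]
  have hal : s.arrs 1 (I.ctr j) = 0 ↔ ¬ I.Alive ω (I.ctr j) := by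
    constructor
    · intro h h'; have := hs.alive _ h'; omega
    · exact fun h => hs.not_alive _ h
  set W : ℕ → ℕ := fun i => s.arrs 3 (I.ctr i * n + v) with hW
  have hWpos : ∀ i, 0 < W i := fun i => wpos _ _
  change _ = if _ ∨ _ ∨ (_ ∧ _ ≤ W j) then _ else W j at r1
  change _ = if _ ∨ _ ∨ (_ ∧ _ ≤ W j) then _ else _ at r2
  by_cases hjA : I.Alive ω (I.ctr j) ∧ j ≤ v
  swap
  · have hc : ¬ I.Alive ω (I.ctr j) ∨ (v : ℕ) < j ∨ (s2.vars 34 ≠ 0 ∧ s2.vars 34 ≤ W j) := by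
      by_cases h : I.Alive ω (I.ctr j)
      · exact Or.inr (Or.inl (by by_contra h'; exact hjA ⟨h, by omega⟩))
      · exact Or.inl h
    rw [← hal] at hc
    rw [if_pos hc] at r1 r2
    rw [r1, r2]
    have hno : ∀ i < j + 1, i ≤ (v : ℕ) → I.Alive ω (I.ctr i) → i < j := by
      intro i hi hiv hA
      rcases Nat.lt_succ_iff_lt_or_eq.1 hi with h | rfl
      · exact h
      · exact absurd ⟨hA, hiv⟩ hjA
    refine ⟨fun h => ih1 fun i hi => h i (by omega), fun ⟨i, hi, hiv, hA⟩ => ?_⟩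
    obtain ⟨i₀, h1, h2, h3, h4, h5, h6⟩ := ih2 ⟨i, hno i hi hiv hA, hiv, hA⟩
    exact ⟨i₀, by omega, h2, h3, h4, h5, fun i hi hiv hA => h6 i (hno i hi hiv hA) hiv hA⟩
  obtain ⟨hA, hjv⟩ := hjA
  refine ⟨fun h => absurd hA (h j (by omega) hjv), fun _ => ?_⟩
  by_cases hex : ∃ i < j, i ≤ (v : ℕ) ∧ I.Alive ω (I.ctr i)
  · obtain ⟨i₀, h1, h2, h3, h4, h5, h6⟩ := ih2 hex
    have h5' : s2.vars 34 = W i₀ := h5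
    by_cases hle : W i₀ ≤ W j
    · have hc : ¬ I.Alive ω (I.ctr j) ∨ (v : ℕ) < j ∨ (s2.vars 34 ≠ 0 ∧ s2.vars 34 ≤ W j) :=
        Or.inr (Or.inr ⟨by have := hWpos i₀; omega, by omega⟩)
      rw [← hal] at hc
      rw [if_pos hc] at r1 r2
      rw [r1, r2]
      refine ⟨i₀, by omega, h2, h3, h4, h5, fun i hi hiv hAi => ?_⟩
      rcases Nat.lt_succ_iff_lt_or_eq.1 hi with h | rfl
      · exact h6 i h hiv hAi
      · exact ⟨hle, fun _ => h1.le⟩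
    · have hc : ¬ (¬ I.Alive ω (I.ctr j) ∨ (v : ℕ) < j ∨ (s2.vars 34 ≠ 0 ∧ s2.vars 34 ≤ W j)) := by
        rintro (h | h | h)
        · exact h hA
        · omega
        · omega
      rw [← hal] at hc
      rw [if_neg hc] at r1 r2
      rw [r1, r2]
      refine ⟨j, by omega, hjv, hA, rfl, rfl, fun i hi hiv hAi => ?_⟩
      rcases Nat.lt_succ_iff_lt_or_eq.1 hi with h | rfl
      · have hi0 : W i₀ ≤ W i := (h6 i h hiv hAi).1
        change W j ≤ W i ∧ (W j = W i → j ≤ i)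
        omega
      · exact ⟨le_rfl, fun _ => le_rfl⟩
  · have h0 := ih1 fun i hi hiv hAi => hex ⟨i, hi, hiv, hAi⟩
    have hc : ¬ (¬ I.Alive ω (I.ctr j) ∨ (v : ℕ) < j ∨ (s2.vars 34 ≠ 0 ∧ s2.vars 34 ≤ W j)) := by
      rintro (h | h | h)
      · exact h hA
      · omega
      · exact h.1 h0
    rw [← hal] at hc
    rw [if_neg hc] at r1 r2
    rw [r1, r2]
    refine ⟨j, by omega, hjv, hA, rfl, rfl, fun i hi hiv hAi => ?_⟩
    rcases Nat.lt_succ_iff_lt_or_eq.1 hi with h | rfl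
    · exact absurd ⟨i, h, hiv, hAi⟩ hex
    · exact ⟨le_rfl, fun _ => le_rfl⟩

/-- `u` is the parent of the vertex `v` of the tree. -/
def _root_.HopEmbed.Input.IsChild (I : Input n) (ω : ℕ → Bool) (v u : Fin n) : Prop :=
  I.Alive ω v ∧ v ≠ I.r ∧ I.IsParent ω u v

theorem _root_.HopEmbed.Input.IsParent.eq {ω : ℕ → Bool} {u u' v : Fin n}
    (h : I.IsParent ω u v) (h' : I.IsParent ω u' v) : u = u' := by
  obtain ⟨j, h1, h2, h3, h4⟩ := h
  obtain ⟨j', h1', h2', h3', h4'⟩ := h'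
  have a := h4 j' h1' (h2' ▸ h3')
  have b := h4' j h1 (h2 ▸ h3)
  rw [← h2'] at a
  rw [← h2] at b
  have : j = j' := le_antisymm (a.2 (by omega)) (b.2 (by omega))
  rw [h2, h2', this]

theorem run_adjacency {ω : ℕ → Bool} {s : State} (hs : I.Env s)
    (h1 : ∀ v : Fin n, I.Alive ω v → s.arrs 1 v = 1)
    (h2 : ∀ v : Fin n, ¬ I.Alive ω v → s.arrs 1 v = 0)
    (h3 : ∀ v : Fin n, ∃ u : Fin n, I.IsParent ω u v ∧ s.arrs 13 v = u) (u v : Fin n) :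
    (adjacency.run s).arrs 2 (u * n + v) = 1 ↔ I.IsChild ω v u ∨ I.IsChild ω u v := by
  have key := forLt_rule (x := 22) (y := 5) (p := block [assign 32 (.var 22 / .var 0),
    assign 33 (.var 22 % .var 0),
    store 2 (.var 22) (.bin .lt (.const 0)
    (isChild (.var 33) (.var 32) + isChild (.var 32) (.var 33)))]) rfl s
    (fun k s' => ∀ u v : Fin n, (u : ℕ) * n + v < k → (s'.arrs 2 (u * n + v) = 1 ↔
      I.IsChild ω v u ∨ I.IsChild ω u v)) (fun _ _ h => by omega) ?_
  · rw [hs.v5] at key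
    exact key u v (Input.idx_lt u v)
  clear u v
  intro k hk s' hf hk' ih
  rw [hs.v5] at hk
  obtain ⟨x, y, rfl, -⟩ := Input.exists_idx hk
  have hs' := hs.of_frame hf (by decide)
  have e1 := hf.arrs 1 (by decide)
  have e13 := hf.arrs 13 (by decide)
  have child : ∀ v u : Fin n, s.arrs 1 v * (1 - if (v : ℕ) = I.r then 1 else 0) *
      (if s.arrs 13 v = u then 1 else 0) ≠ 0 ↔ I.IsChild ω v u := by
    intro v u
    obtain ⟨p, hp, hp'⟩ := h3 v
    simp only [hp', Fin.val_inj]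
    unfold Input.IsChild
    by_cases hA : I.Alive ω v
    · rw [h1 v hA]
      by_cases hr : v = I.r
      · simp [hr]
      · by_cases hpu : p = u
        · subst hpu; simp [hr, hA, hp]
        · have : ¬ I.IsParent ω u v := fun h => hpu (hp.eq h)
          simp [hpu, this]
    · rw [h2 v hA]; simp [hA]
  intro u v huv
  by_cases h : (u : ℕ) * n + v = x * n + y
  · obtain ⟨rfl, rfl⟩ := Input.idx_inj h
    rw [← child, ← child]
    simp only [block, run_seq, run_assign, run_store, isChild]
    simp [hk', hs'.v0, hs'.v4, Input.idx_div, Nat.mod_eq_of_lt v.2, e1, e13]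
    grind
  · have := ih u v (by omega)
    simpa [block, hk', h] using this

end Alg

end HopEmbed

/-! ### The final state of the program. -/

namespace HopEmbed

namespace Alg

open Prog

variable {n : ℕ} {I : Input n}

/-- The output of the program. -/
structure Final (I : Input n) (ω : ℕ → Bool) (s : State) : Prop where
  root : s.vars 4 = I.r
  verts : ∀ v : Fin n, I.Alive ω v ↔ s.arrs 1 v = 1
  adj : ∀ u v : Fin n, s.arrs 2 (u * n + v) = 1 ↔ I.IsChild ω v u ∨ I.IsChild ω u v
  wt : ∀ u v : Fin n, s.arrs 3 (u * n + v) = 2 ^ (I.levels + 1 - I.common ω I.levels u v)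
  path : ∀ u v : Fin n, ∃ p : (⊤ : SimpleGraph (Fin n)).Walk u v,
    mixLen I.G (2 ^ (I.expo + (I.common ω I.levels u v - 1))) (2 ^ I.levels) p ≤
      2 * (2 ^ I.ucoins * (I.gcoins + 2)) ∧
    PathAt s (u * n + v) p ∧ PathAt s (v * n + u) p.reverse
  exists_parent : ∀ v, ∃ u, I.IsParent ω u v

theorem run_initTogether {s : State} (hs : I.Env s) (u v : Fin n) :
    (initTogether.run s).arrs 7 (u * n + v) = 1 := by
  have := forLt_rule (x := 22) (y := 5) (p := store 7 (.var 22) (.const 1)) rfl s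
    (fun k s' => ∀ i < k, s'.arrs 7 i = 1) (by simp) ?_
  · rw [hs.v5] at this
    exact this _ (Input.idx_lt u v)
  intro k hk s' hf hk' ih i hi
  by_cases hik : i = k
  · simp [hk', hik]
  · simpa [hk', hik] using ih i (by omega)

theorem run_initAlive {s : State} (hs : I.Env s) (v : Fin n) :
    (initAlive.run s).arrs 1 v = 1 := by
  have := forLt_rule (x := 22) (y := 0) (p := store 1 (.var 22) (.const 1)) rfl s
    (fun k s' => ∀ i < k, s'.arrs 1 i = 1) (by simp) ?_
  · rw [hs.v0] at this
    exact this _ v.2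
  intro k hk s' hf hk' ih i hi
  by_cases hik : i = k
  · simp [hk', hik]
  · simpa [hk', hik] using ih i (by omega)

theorem run_main {s : State} (hs : I.Env s) (h14 : s.vars 14 = 2 ^ I.expo)
    (h19 : s.vars 19 = 2 ^ I.levels) : Final I s.coins (main.run s) := by
  simp only [main, block, run_seq]
  have f1 := initTogether.frame s
  have r1 := run_initTogether hs
  set s1 := initTogether.run s
  have E1 := hs.of_frame f1 (by decide)
  have f2 := initAlive.frame s1
  have r2 := run_initAlive E1
  set s2 := initAlive.run s1
  have E2 := E1.of_frame f2 (by decide)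
  have hc : s2.coins = s.coins := (f2.coins (by decide)).trans (f1.coins (by decide))
  have L0 : LevelInv I s.coins 0 s2 := by
    refine ⟨E2, ?_, ?_, by simp [hc], fun v _ => r2 v, fun v h => by simp at h, fun u v => ?_⟩
    · rw [f2.vars 14 (by decide), f1.vars 14 (by decide), h14, add_zero]
    · rw [f2.vars 19 (by decide), f1.vars 19 (by decide), h19, Nat.sub_zero]
    · have h0 := I.common_le s.coins 0 u v
      refine ⟨fun _ => ?_, fun h => by simp at h, fun h => by omega, fun h => by omega⟩
      rw [f2.arrs 7 (by decide), r1]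
  have L := forLt_rule (x := 20) (y := 10) (p := level) rfl s2
    (fun l s' => l ≤ I.levels → LevelInv I s.coins l s')
    (fun _ => ⟨L0.1.of_frame (p := assign 20 (.const 0)) ((assign 20 (.const 0)).frame s2) (by decide),
      L0.v14, L0.v19, L0.coins, L0.alive, L0.not_alive,
      fun u v => (L0.pairs u v).congr fun _ _ => rfl⟩) ?_
  swap
  · rintro l hl s' hf - ih hl'
    have := run_level (ih (by omega)) hl'
    exact ⟨this.1.of_frame (p := assign 20 (.const (l + 1)))
      ((assign 20 (.const (l + 1))).frame _) rfl, this.v14, this.v19, this.coins,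
      this.alive, this.not_alive, fun u v => (this.pairs u v).congr fun _ _ => rfl⟩
  rw [E2.v10] at L
  have L := L le_rfl
  set s3 := (forLt 20 10 level).run s2
  have f4 := parents.frame s3
  have r4 := run_parents L
  set s4 := parents.run s3
  have E4 := L.1.of_frame f4 (by decide)
  have e1 : s4.arrs 1 = s3.arrs 1 := f4.arrs 1 (by decide)
  have r5 := run_adjacency (ω := s.coins) E4 (fun v hv => by rw [e1]; exact L.alive v hv)
    (fun v hv => by rw [e1]; exact L.not_alive v hv) r4
  have f5 := adjacency.frame s4
  set s5 := adjacency.run s4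
  have E5 := E4.of_frame f5 (by decide)
  have ea : ∀ a ∈ [1, 3, 4, 5, 6, 7], s5.arrs a = s3.arrs a := fun a ha => by
    rw [f5.arrs a (by revert a; decide), f4.arrs a (by revert a; decide)]
  have P5 : ∀ u v, PairInv I s.coins I.levels s5 u v := fun u v =>
    (L.pairs u v).congr fun a ha => ea a (List.mem_cons_of_mem _ ha)
  refine ⟨E5.v4, fun v => ?_, r5, fun u v => (P5 u v).wt (I.one_le_common ..),
    fun u v => (P5 u v).path (I.one_le_common ..), fun v => (r4 v).imp fun _ h => h.1⟩
  rw [ea 1 (by simp)]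
  constructor
  · exact L.alive v
  · intro h
    by_contra h'
    have := L.not_alive v h'
    omega

theorem run_sizeParams {s : State} (h0 : s.vars 0 = n) (h1 : s.vars 1 = I.h) :
    (sizeParams.run s).vars 5 = n * n ∧ (sizeParams.run s).vars 17 = n + 1 ∧
    (sizeParams.run s).vars 37 = n + n ∧ (sizeParams.run s).vars 6 = I.hops := by
  by_cases h : I.h < n <;> simp [sizeParams, block, run_cond, h0, h1, h, Input.hops]

theorem run_sumWeights {s : State} (h5 : s.vars 5 = n * n) (h7 : s.vars 7 = 0)
    (ha : s.arrs 0 = I.mat) : (sumWeights.run s).vars 7 = I.total := by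
  have := forLt_rule (x := 22) (y := 5) (p := assign 7 (.var 7 + .load 0 (.var 22))) rfl s
    (fun k s' => s'.vars 7 = ∑ i ∈ Finset.range k, I.mat i) (by simp [h7]) ?_
  · rwa [h5] at this
  intro k hk s' hf hk' ih
  have e := hf.arrs 0 (by decide)
  simp [ih, e, ha, hk', Finset.sum_range_succ]

theorem run_logParams {s : State} (h17 : s.vars 17 = n + 1) (h6 : s.vars 6 = I.hops)
    (h7 : s.vars 7 = I.total) (h2 : s.vars 2 = I.ε.num.toNat) (h3 : s.vars 3 = I.ε.den) :
    let s' := logParams.run s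
    s'.vars 8 = I.gcoins ∧ s'.vars 10 = I.levels ∧ s'.vars 12 = I.ucoins ∧ s'.vars 39 = I.expo := by
  simp [logParams, block, run_clog, h17, h6, h7, h2, h3, Input.gcoins, Input.levels, Input.ucoins,
    Input.q, Input.expo, Input.mu, Prog.ok]

theorem run_pow {x y : ℕ} (hok : (pow x y).ok = true) (hxy : x ≠ y) (hx : x ≠ 23) (s : State) :
    ((pow x y).run s).vars x = 2 ^ s.vars y := by
  have := forLt_rule (x := 23) (y := y) (p := assign x (.var x + .var x)) (by
    have := (Bool.and_eq_true _ _ ▸ hok : _ ∧ _).2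
    exact this) (s.assign x 1)
    (fun k s' => s'.vars x = 2 ^ k) (by simp [hx]) ?_
  · simpa [pow, hxy.symm] using this
  intro k hk s' hf hk' ih
  simp [ih, hx, pow_succ, mul_two]

theorem run_powParams {s : State} (h10 : s.vars 10 = I.levels) (h12 : s.vars 12 = I.ucoins)
    (h39 : s.vars 39 = I.expo) (h6 : s.vars 6 = I.hops) (h18 : s.vars 18 = 0) :
    let s' := powParams.run s
    s'.vars 15 = 2 ^ I.ucoins ∧ s'.vars 16 = 2 ^ I.levels ∧ s'.vars 14 = 2 ^ I.expo ∧
      s'.vars 18 = I.width ∧ s'.vars 19 = 2 ^ I.levels := by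
  simp only [powParams, block, run_seq]
  have f1 := (pow 15 12).frame s
  have r1 := run_pow (x := 15) (y := 12) rfl (by decide) (by decide) s
  set s1 := (pow 15 12).run s
  have f2 := (pow 16 10).frame s1
  have r2 := run_pow (x := 16) (y := 10) rfl (by decide) (by decide) s1
  set s2 := (pow 16 10).run s1
  have f3 := (pow 14 39).frame s2
  have r3 := run_pow (x := 14) (y := 39) rfl (by decide) (by decide) s2
  set s3 := (pow 14 39).run s2
  rw [h12] at r1
  rw [f1.vars 10 (by decide), h10] at r2
  rw [f2.vars 39 (by decide), f1.vars 39 (by decide), h39] at r3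
  have a16 : s3.vars 16 = 2 ^ I.levels := (f3.vars 16 (by decide)).trans r2
  have a18 : s3.vars 18 = 0 := by
    rw [f3.vars 18 (by decide), f2.vars 18 (by decide), f1.vars 18 (by decide), h18]
  have a6 : s3.vars 6 = I.hops := by
    rw [f3.vars 6 (by decide), f2.vars 6 (by decide), f1.vars 6 (by decide), h6]
  have key := forLt_rule (x := 23) (y := 6)
    (p := assign 18 (.var 18 + (.var 16 + .var 16))) rfl s3
    (fun k s' => s'.vars 18 = k * (2 ^ I.levels + 2 ^ I.levels)) (by simp [a18]) (by
      intro k hk s' hf hk' ih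
      simp [ih, hf.vars 16 (by decide), a16]; ring)
  have f4 := (forLt 23 6 (assign 18 (.var 18 + (.var 16 + .var 16)))).frame s3
  set s4 := (forLt 23 6 (assign 18 (.var 18 + (.var 16 + .var 16)))).run s3
  have e15 := f4.vars 15 (by decide)
  have e16 := f4.vars 16 (by decide)
  have e14 := f4.vars 14 (by decide)
  simp only [run_assign, Expr.eval_var, State.assign_vars]
  refine ⟨?_, ?_, ?_, ?_, ?_⟩
  · simp [e15, f3.vars 15 (by decide), f2.vars 15 (by decide), r1]
  · simp [e16, a16]
  · simp [e14, r3]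
  · simp only [show ¬ (18 = 19) by norm_num, if_false, key, a6]; rfl
  · simp [e16, a16]

/-- The states between the phases of the program. -/
theorem run_params (I : Input n) (ω : ℕ → Bool) :
    let s₁ := sizeParams.run (I.start ω)
    let s₂ := sumWeights.run s₁
    let s₃ := logParams.run s₂
    let s₄ := powParams.run s₃
    s₁.vars 5 = n * n ∧ s₂.vars 7 = I.total ∧
    (s₃.vars 12 = I.ucoins ∧ s₃.vars 10 = I.levels ∧ s₃.vars 39 = I.expo ∧ s₃.vars 6 = I.hops) ∧
    I.Env s₄ ∧ s₄.vars 14 = 2 ^ I.expo ∧ s₄.vars 19 = 2 ^ I.levels ∧ s₄.coins = ω := by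
  intro s₁ s₂ s₃ s₄
  have f1 := sizeParams.frame (I.start ω)
  have f2 := sumWeights.frame s₁
  have f3 := logParams.frame s₂
  have f4 := powParams.frame s₃
  obtain ⟨a5, a17, a37, a6⟩ := run_sizeParams (I := I) (s := I.start ω) rfl rfl
  have a7 := run_sumWeights (I := I) (s := s₁) a5 (f1.vars 7 (by decide)) (f1.arrs 0 (by decide))
  have e17 : s₂.vars 17 = n + 1 := (f2.vars 17 (by decide)).trans a17
  have e6 : s₂.vars 6 = I.hops := (f2.vars 6 (by decide)).trans a6
  obtain ⟨b8, b10, b12, b39⟩ := run_logParams (I := I) (s := s₂) e17 e6 a7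
    ((f2.vars 2 (by decide)).trans (f1.vars 2 (by decide)))
    ((f2.vars 3 (by decide)).trans (f1.vars 3 (by decide)))
  have g6 : s₃.vars 6 = I.hops := (f3.vars 6 (by decide)).trans e6
  obtain ⟨c15, c16, c14, c18, c19⟩ := run_powParams (I := I) (s := s₃) b10 b12 b39 g6 (by
    rw [f3.vars 18 (by decide), f2.vars 18 (by decide), f1.vars 18 (by decide)]; rfl)
  refine ⟨a5, a7, ⟨b12, b10, b39, g6⟩, ⟨?_, ?_, ?_, ?_, ?_, ?_, c15, c16, ?_, c18, ?_, ?_⟩, c14, c19, ?_⟩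
  · rw [f4.vars 0 (by decide), f3.vars 0 (by decide), f2.vars 0 (by decide),
      f1.vars 0 (by decide)]; rfl
  · rw [f4.vars 4 (by decide), f3.vars 4 (by decide), f2.vars 4 (by decide),
      f1.vars 4 (by decide)]; rfl
  · rw [f4.vars 5 (by decide), f3.vars 5 (by decide), f2.vars 5 (by decide), a5]
  · rw [f4.vars 8 (by decide), b8]
  · rw [f4.vars 10 (by decide), b10]
  · rw [f4.vars 12 (by decide), b12]
  · rw [f4.vars 17 (by decide), f3.vars 17 (by decide), e17]
  · rw [f4.vars 37 (by decide), f3.vars 37 (by decide), f2.vars 37 (by decide), a37]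
  · rw [f4.arrs 0 (by decide), f3.arrs 0 (by decide), f2.arrs 0 (by decide),
      f1.arrs 0 (by decide)]; rfl
  · rw [f4.coins (by decide), f3.coins (by decide), f2.coins (by decide), f1.coins (by decide)]; rfl

theorem run_alg (I : Input n) (ω : ℕ → Bool) : Final I ω (alg.run (I.start ω)) := by
  obtain ⟨-, -, -, hE, h14, h19, hc⟩ := run_params I ω
  have := run_main hE h14 h19
  rw [hc] at this
  exact this

end Alg

end HopEmbed

/-! ### Polynomial running time. -/

namespace HopEmbed

namespace Input

variable {n : ℕ} (I : Input n)

theorem size_entry_le (i j : Fin n) : 1 + (I.G.entry i j).size ≤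
    ∑ i : Fin n, ∑ j : Fin n, (1 + (I.G.entry i j).size) :=
  (Finset.single_le_sum (f := fun j => 1 + (I.G.entry i j).size) (fun _ _ => Nat.zero_le _)
    (Finset.mem_univ j)).trans
    (Finset.single_le_sum (f := fun i => ∑ j : Fin n, (1 + (I.G.entry i j).size))
      (fun _ _ => Nat.zero_le _) (Finset.mem_univ i))

theorem sq_le_size : n * n ≤ I.size := by
  have : n * n ≤ ∑ i : Fin n, ∑ j : Fin n, (1 + (I.G.entry i j).size) := by
    calc n * n = ∑ i : Fin n, ∑ j : Fin n, 1 := by simp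
      _ ≤ _ := Finset.sum_le_sum fun i _ => Finset.sum_le_sum fun j _ => Nat.le_add_right _ _
  unfold size; omega

theorem le_size : n ≤ I.size := (Nat.le_mul_self n).trans I.sq_le_size

theorem start_bdd (ω : ℕ → Bool) : (I.start ω).Bdd I.size := by
  have key : ∀ k : ℕ, k.size ≤ I.size → k < 2 ^ I.size := fun k hk => Nat.size_le.1 hk
  have h0 : 0 < 2 ^ I.size := by positivity
  constructor
  · intro x
    match x with
    | 0 => exact key n (by unfold size; omega)
    | 1 => exact key I.h (by unfold size; omega)
    | 2 => exact key I.ε.num.toNat (by unfold size; omega)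
    | 3 => exact key I.ε.den (by unfold size; omega)
    | 4 => exact key I.r (by unfold size; omega)
    | _ + 5 => exact h0
  · intro a i
    match a with
    | 0 =>
      change I.mat i < _
      unfold mat
      split_ifs with h
      · refine key _ ?_
        refine le_trans ?_ (show (∑ i : Fin n, ∑ j : Fin n, (1 + (I.G.entry i j).size)) ≤ I.size by
          unfold size; omega)
        exact (Nat.le_add_left _ _).trans (I.size_entry_le _ _)
      · exact h0
    | _ + 1 => exact h0

theorem clog_le_self (k : ℕ) : Nat.clog 2 k ≤ k :=
  Nat.clog_le_of_le_pow Nat.lt_two_pow_self.le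

theorem gcoins_le : I.gcoins ≤ n := Nat.clog_le_of_le_pow (by
  have := @Nat.lt_two_pow_self n; omega)

/-- Loop counts are values, not bit lengths. They stay polynomial because they derive from
logarithms of numbers whose bit length is already controlled. -/
theorem params_le {z : ℕ} (hz : I.total < 2 ^ z) : I.levels ≤ z + n + 4 ∧
    I.ucoins ≤ 2 * z + I.size + 3 * n + 11 ∧ I.expo ≤ z + I.size + 3 * n + 10 := by
  have h1 : Nat.clog 2 I.total ≤ z := Nat.clog_le_of_le_pow hz.le
  have h2 := I.gcoins_le
  have h3 : I.mu ≤ n + 2 := (clog_le_self _).trans (by omega)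
  have h4 := clog_le_self I.hops
  have h5 := I.hops_le
  have h6 := clog_le_self I.levels
  have h7 : Nat.clog 2 (I.ε.den / I.ε.num.toNat + 1) ≤ I.size := by
    refine Nat.clog_le_of_le_pow ?_
    have : I.ε.den < 2 ^ I.size := Nat.size_le.1 (by unfold size; omega)
    have := Nat.div_le_self I.ε.den I.ε.num.toNat
    omega
  unfold ucoins expo q
  have h8 : I.levels = Nat.clog 2 I.total + I.mu + 2 := rfl
  omega

end Input

namespace Alg

open Prog

/-- The program, with the root written to the output register. -/
def cmd : Cmd := .seq alg.compile (.assign 0 (.var 4))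

theorem mem_of_mem_bnds_main : ∀ y ∈ Alg.main.bnds, y ∈ [0, 5, 8, 10, 12, 17, 37] := by
  decide

/-- The cost bound requires that a program does not write the registers that bound its loops, so the
phases are split where such registers are computed and their polynomials are composed. Each `Zᵢ`
bounds the bit lengths, and the relevant loop counts, at the start of the next phase; `W` dominates
the numbers of levels and coins. -/
theorem exists_time : ∃ time : Polynomial ℕ, ∀ (n : ℕ) (I : Input n), 2 ≤ n →
    I.levels * ((n + 1) * (I.ucoins + I.gcoins)) ≤ time.eval I.size ∧
    ∀ ω : ℕ → Bool, ∃ t ≤ time.eval I.size,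
      Exec cmd (I.start ω) ((alg.run (I.start ω)).assign 0 I.r) t := by
  obtain ⟨P₁, Q₁, h₁⟩ := exists_cost_polynomial sizeParams rfl rfl rfl
  obtain ⟨P₂, Q₂, h₂⟩ := exists_cost_polynomial sumWeights rfl rfl rfl
  obtain ⟨P₃, Q₃, h₃⟩ := exists_cost_polynomial logParams rfl rfl rfl
  obtain ⟨P₄, Q₄, h₄⟩ := exists_cost_polynomial powParams rfl rfl rfl
  obtain ⟨P₅, Q₅, h₅⟩ := exists_cost_polynomial main rfl rfl rfl
  let Z₁ : Polynomial ℕ := Q₁ + .X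
  let Z₂ : Polynomial ℕ := Q₂.comp Z₁ + .X
  let W : Polynomial ℕ := 2 * Z₂ + 10 * .X + 20
  let Z₃ : Polynomial ℕ := Q₃.comp Z₂ + W
  let Z₄ : Polynomial ℕ := Q₄.comp Z₃ + W
  -- `X + 2` pays for writing the root to the output register. The last product covers all coins
  -- that are ever read, so that the finite tape really supplies fair coins for each of them.
  refine ⟨P₁ + (P₂.comp Z₁ + (P₃.comp Z₂ + (P₄.comp Z₃ + P₅.comp Z₄))) + .X + 2 +
    W * ((.X + 1) * (W + W)), fun n I hn => ?_⟩
  obtain ⟨z, hz⟩ : ∃ z, I.size = z := ⟨_, rfl⟩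
  have hnz := I.le_size
  have hnn := I.sq_le_size
  rw [hz] at hnz hnn
  have e₁ : Z₁.eval z = Q₁.eval z + z := by simp [Z₁]
  have e₂ : Z₂.eval z = Q₂.eval (Z₁.eval z) + z := by simp [Z₂]
  have eW : W.eval z = 2 * Z₂.eval z + 10 * z + 20 := by simp [W]
  have e₃ : Z₃.eval z = Q₃.eval (Z₂.eval z) + W.eval z := by simp [Z₃]
  have e₄ : Z₄.eval z = Q₄.eval (Z₃.eval z) + W.eval z := by simp [Z₄]
  clear_value Z₄ Z₃ W Z₂ Z₁
  simp only [hz, Polynomial.eval_add, Polynomial.eval_mul, Polynomial.eval_comp, Polynomial.eval_X,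
    Polynomial.eval_ofNat, Polynomial.eval_one]
  have main : ∀ ω, I.total < 2 ^ Z₂.eval z ∧ ∃ t ≤ P₁.eval z + (P₂.eval (Z₁.eval z) +
      (P₃.eval (Z₂.eval z) + (P₄.eval (Z₃.eval z) + P₅.eval (Z₄.eval z)))),
      Exec alg.compile (I.start ω) (alg.run (I.start ω)) t := by
    intro ω
    obtain ⟨v5, v7, ⟨v12, v10, v39, v6⟩, hE, -, -, -⟩ := run_params I ω
    have b0 := I.start_bdd ω
    rw [hz] at b0
    obtain ⟨b₁, t₁, ht₁, x₁⟩ := h₁ (I.start ω) z (by omega) b0 (by simp [sizeParams, block, bnds])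
    set s₁ := sizeParams.run (I.start ω)
    obtain ⟨b₂, t₂, ht₂, x₂⟩ := h₂ s₁ (Z₁.eval z) (by omega) (b₁.mono (by omega)) (by
      simp [sumWeights, bnds, v5]; omega)
    set s₂ := sumWeights.run s₁
    obtain ⟨b₃, t₃, ht₃, x₃⟩ := h₃ s₂ (Z₂.eval z) (by omega) (b₂.mono (by omega)) (by
      simp [logParams, block, bnds])
    set s₃ := logParams.run s₂
    have htot : I.total < 2 ^ Z₂.eval z := by
      rw [← v7]; exact (b₂.mono (by omega)).1 7
    obtain ⟨p1, p2, p3⟩ := I.params_le htot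
    have p4 := I.hops_le
    have p5 := I.gcoins_le
    rw [hz] at p2 p3
    obtain ⟨b₄, t₄, ht₄, x₄⟩ := h₄ s₃ (Z₃.eval z) (by omega) (b₃.mono (by omega)) (by
      simp [powParams, pow, block, bnds, v12, v10, v39, v6]; omega)
    set s₄ := powParams.run s₃
    obtain ⟨b₅, t₅, ht₅, x₅⟩ := h₅ s₄ (Z₄.eval z) (by omega) (b₄.mono (by omega)) (by
      intro y hy
      have := mem_of_mem_bnds_main y hy
      simp only [List.mem_cons, List.not_mem_nil, or_false] at this
      rcases this with rfl | rfl | rfl | rfl | rfl | rfl | rfl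
      · rw [hE.v0]; omega
      · rw [hE.v5]; omega
      · rw [hE.v8]; omega
      · rw [hE.v10]; omega
      · rw [hE.v12]; omega
      · rw [hE.v17]; omega
      · rw [hE.v37]; omega)
    refine ⟨htot, t₁ + (t₂ + (t₃ + (t₄ + t₅))), by gcongr, ?_⟩
    simp only [alg, block, run_seq, compile]
    exact .seq x₁ (.seq x₂ (.seq x₃ (.seq x₄ x₅)))
  constructor
  · obtain ⟨htot, -⟩ := main fun _ => false
    obtain ⟨p1, p2, -⟩ := I.params_le htot
    have p5 := I.gcoins_le
    rw [hz] at p2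
    calc I.levels * ((n + 1) * (I.ucoins + I.gcoins)) ≤
        W.eval z * ((z + 1) * (W.eval z + W.eval z)) := by
          gcongr <;> omega
      _ ≤ _ := Nat.le_add_left _ _
  · intro ω
    obtain ⟨-, t, ht, hx⟩ := main ω
    have h4 := (run_alg I ω).root
    have hs : (I.r : ℕ).size ≤ z := by rw [← hz]; unfold Input.size; omega
    refine ⟨t + ((Expr.var 4).cost (alg.run (I.start ω)) + 1), ?_, ?_⟩
    · simp only [Expr.cost, h4]; omega
    · have := Exec.seq hx (Exec.assign (alg.run (I.start ω)) 0 (.var 4))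
      simpa [cmd, h4] using this

end Alg

end HopEmbed

/-! ### The tree described by the final state. -/

namespace HopEmbed

namespace Input

variable {n : ℕ} (I : Input n)

/-- The first ball with the given center. -/
def rank (u : Fin n) : ℕ := if u = I.r then 0 else u + 1

theorem ctr_rank (u : Fin n) : I.ctr (I.rank u) = u := by
  unfold rank
  split_ifs with h
  · rw [ctr_zero, h]
  · rw [ctr_succ]

/-- Equality may fail because the root is a center twice, at position `0` and again among all
vertices. -/
theorem rank_ctr_le (j : ℕ) : I.rank (I.ctr j) ≤ j := by
  by_cases h : 0 < j ∧ j - 1 < n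
  · have : I.ctr j = ⟨j - 1, h.2⟩ := dif_pos h
    unfold rank
    split_ifs
    · omega
    · rw [this]; simp; omega
  · have : I.ctr j = I.r := dif_neg h
    rw [this, rank, if_pos rfl]; exact Nat.zero_le _

theorem rank_of_ne {v : Fin n} (h : v ≠ I.r) : I.rank v = v + 1 := if_neg h

/-- The exponents of the weights of the tree edges. -/
noncomputable def ex (ω : ℕ → Bool) (u v : Fin n) : ℕ := I.levels + 1 - I.common ω I.levels u v

theorem ex_le (ω : ℕ → Bool) (u v : Fin n) : I.ex ω u v ≤ I.levels := by
  have := I.one_le_common ω u v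
  unfold ex; omega

end Input

namespace Alg.Final

variable {n : ℕ} {I : Input n} {ω : ℕ → Bool} {s : State} (h : Alg.Final I ω s)

/-- The recorded path between two vertices. -/
noncomputable def route (u v : Fin n) : (⊤ : SimpleGraph (Fin n)).Walk u v :=
  -- The walks chosen for `(u, v)` and `(v, u)` are not visibly related, so one of them is reversed
  -- to get the symmetry.
  if u ≤ v then (h.path u v).choose else (h.path v u).choose.reverse

theorem route_symm {u v : Fin n} (huv : u ≠ v) : h.route v u = (h.route u v).reverse := by
  unfold route
  rcases lt_or_gt_of_ne huv with hlt | hlt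
  · rw [if_neg hlt.not_ge, if_pos hlt.le]
  · rw [if_pos hlt.le, if_neg hlt.not_ge, SimpleGraph.Walk.reverse_reverse]

theorem pathAt (u v : Fin n) : PathAt s (u * n + v) (h.route u v) := by
  unfold route
  split_ifs
  · exact (h.path u v).choose_spec.2.1
  · exact (h.path v u).choose_spec.2.2

theorem mixLen_route (u v : Fin n) :
    mixLen I.G (2 ^ (I.expo + (I.common ω I.levels u v - 1))) (2 ^ I.levels) (h.route u v) ≤
      2 * (2 ^ I.ucoins * (I.gcoins + 2)) := by
  unfold route
  split_ifs
  · exact (h.path u v).choose_spec.1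
  · rw [mixLen_reverse, I.common_comm]
    exact (h.path v u).choose_spec.1

theorem route_bound (u v : Fin n) : pathWeight I.G.w (h.route u v) ≤ 2 ^ I.ex ω u v ∧
    (h.route u v).length ≤ 2 ^ I.expo :=
  I.weight_le_of_mixLen_le (I.one_le_common ω u v) (I.common_le ω I.levels u v) (h.mixLen_route u v)

/-- The tree computed by the program. -/
noncomputable def treeData : TreeData I.G where
  A := {v | I.Alive ω v}
  root := I.r
  root_mem := I.alive_root ω
  rank := I.rank
  rank_inj u v huv := by rw [← I.ctr_rank u, huv, I.ctr_rank]
  root_le v := by rw [Input.rank, if_pos rfl]; exact Nat.zero_le _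
  ex := I.ex ω
  ex_comm u v := by rw [Input.ex, I.common_comm, ← Input.ex]
  ex_le_max u v x := by
    have := I.min_le_common ω I.levels u v x
    unfold Input.ex
    omega
  par v := (h.exists_parent v).choose
  par_mem v _ _ := by
    obtain ⟨_, _, _, hA, _⟩ := (h.exists_parent v).choose_spec
    exact hA
  rank_par_lt v _ hv := by
    obtain ⟨j, hj, he, _, _⟩ := (h.exists_parent v).choose_spec
    have := I.rank_ctr_le j
    rw [he, I.rank_of_ne hv]
    omega
  ex_par_le v _ hv u hu huv := by
    obtain ⟨j, hj, he, _, hmin⟩ := (h.exists_parent v).choose_spec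
    rw [I.rank_of_ne hv] at huv
    have := (hmin (I.rank u) (by omega) (by rw [I.ctr_rank]; exact hu)).1
    rw [I.ctr_rank] at this
    unfold Input.ex
    omega
  rank_par_le v _ hv u hu huv hex := by
    obtain ⟨j, hj, he, _, hmin⟩ := (h.exists_parent v).choose_spec
    rw [I.rank_of_ne hv] at huv
    have h1 := (hmin (I.rank u) (by omega) (by rw [I.ctr_rank]; exact hu)).2
    rw [I.ctr_rank] at h1
    have h2 := I.common_le ω I.levels u v
    have h3 := I.common_le ω I.levels (h.exists_parent v).choose v
    unfold Input.ex at hex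
    have h4 := h1 (by omega)
    have := I.rank_ctr_le j
    rw [he]
    omega
  path := h.route
  path_symm _ _ := h.route_symm
  path_weight u v _ := (h.route_bound u v).1

theorem tAdj_iff (u v : Fin n) : h.treeData.TAdj u v ↔ I.IsChild ω v u ∨ I.IsChild ω u v := by
  have key : ∀ u v, I.IsChild ω v u ↔ v ∈ h.treeData.A ∧ v ≠ h.treeData.root ∧
      h.treeData.par v = u := fun u v => by
    unfold Input.IsChild
    have hp : I.IsParent ω (h.treeData.par v) v := (h.exists_parent v).choose_spec
    refine and_congr Iff.rfl (and_congr Iff.rfl ⟨fun h' => hp.eq h', fun h' => h' ▸ hp⟩)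
  unfold TreeData.TAdj
  rw [key, key]

theorem outputs {s' : State} (hs : s'.arrs = s.arrs) (h0 : s'.vars 0 = I.r) :
    Outputs s' h.treeData.toEmbedding where
  root := h0
  verts v := by rw [hs]; exact h.verts v
  adj u v := by rw [hs, h.adj]; exact h.tAdj_iff u v
  wt u v _ := by rw [hs, h.wt]; rfl
  length u v _ := by rw [hs]; exact (h.pathAt u v).a4
  path u v _ i hi := by rw [hs, (h.pathAt u v).a5]; exact (h.pathAt u v).a6 i hi

end Alg.Final

end HopEmbed

/-! ### Worst-case stretch and probabilities of being cut or separated. -/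

namespace HopEmbed

theorem pathWeight_bypass_le {n : ℕ} (w : Sym2 (Fin n) → ℕ) {u v : Fin n}
    (p : (⊤ : SimpleGraph (Fin n)).Walk u v) : pathWeight w p.bypass ≤ pathWeight w p := by
  refine Finset.sum_le_sum_of_subset fun e he => ?_
  simp only [List.mem_toFinset] at he ⊢
  exact p.edges_bypass_sublist_edges.subset he

/-- An event that depends on a block of coins only. -/
theorem coinProb_block {a b B : ℕ} (hB : a + b ≤ B) (E : (ℕ → Bool) → Prop)
    (hE : ∀ ω ω', (∀ i < b, ω i = ω' i) → E ω → E ω') :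
    coinProb B (fun ω => E fun i => ω (a + i)) = coinProb b E := by
  obtain ⟨c, rfl⟩ := Nat.exists_eq_add_of_le hB
  rw [add_assoc, coinProb_drop, coinProb_take _ _ _ hE]

theorem two_pow_clog_le {k : ℕ} (hk : 1 ≤ k) : 2 ^ Nat.clog 2 k ≤ 2 * k := by
  rcases Nat.lt_or_ge k 2 with h | h
  · obtain rfl : k = 1 := by omega
    simp
  · have := Nat.pow_pred_clog_lt_self (b := 2) (by norm_num) h
    have hpos : 0 < Nat.clog 2 k := Nat.clog_pos (by norm_num) h
    obtain ⟨c, hc⟩ : ∃ c, Nat.clog 2 k = c + 1 := ⟨_, (Nat.succ_pred_eq_of_pos hpos).symm⟩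
    rw [hc] at this ⊢
    simp only [Nat.pred_succ] at this
    rw [pow_succ]; omega

namespace Input

variable {n : ℕ} (I : Input n)

/-- Loop erasure increases neither hops nor weight, so an optimal walk may be taken simple. Then it
has fewer than `n` hops, which justifies the cap in `hops`, and its weight is the sum along the
walk. -/
theorem exists_hopDist_eq (hh : 1 ≤ I.h) (u v : Fin n) :
    ∃ p : (⊤ : SimpleGraph (Fin n)).Walk u v, p.length ≤ I.hops ∧
      I.G.hopDist I.h u v = (((p.edges.map I.G.w).sum : ℕ) : ℝ≥0∞) ∧
      (u ≠ v → 1 ≤ (p.edges.map I.G.w).sum) := by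
  set S : Set ℕ := {d | ∃ p : (⊤ : SimpleGraph (Fin n)).Walk u v, p.length ≤ I.h ∧
    pathWeight I.G.w p = d}
  have hS : S.Nonempty := by
    by_cases h : u = v
    · subst h; exact ⟨_, .nil, by simp, rfl⟩
    · exact ⟨_, .cons (show (⊤ : SimpleGraph (Fin n)).Adj u v from h) .nil, by simpa using hh, rfl⟩
  obtain ⟨p, hp, hd⟩ := Nat.sInf_mem hS
  have hmin : ∀ p : (⊤ : SimpleGraph (Fin n)).Walk u v, p.length ≤ I.h →
      sInf S ≤ pathWeight I.G.w p := fun p hp => Nat.sInf_le ⟨p, hp, rfl⟩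
  have hb : p.bypass.length ≤ I.h := p.length_bypass_le_length.trans hp
  have hw : pathWeight I.G.w p.bypass = sInf S :=
    le_antisymm ((pathWeight_bypass_le _ p).trans hd.le) (hmin _ hb)
  refine ⟨p.bypass, ?_, ?_, fun huv => ?_⟩
  · have := p.bypass_isPath.length_lt
    rw [Fintype.card_fin] at this
    unfold hops; split_ifs <;> omega
  · rw [← pathWeight_eq_sum _ p.bypass_isPath]
    refine le_antisymm (iInf₂_le p.bypass (by exact_mod_cast hb)) (le_iInf₂ fun q hq => ?_)
    rw [hw]
    exact_mod_cast hmin q (by exact_mod_cast hq)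
  · cases hq : p.bypass with
    | nil => exact absurd rfl huv
    | @cons _ x _ e q =>
      simp only [SimpleGraph.Walk.edges_cons, List.map_cons, List.sum_cons]
      have := I.G.one_le s(u, x) (by simpa using e.ne)
      omega

/-- The binary logarithm of the distance stretch, up to a constant. -/
def lgStretch : ℕ :=
  Nat.clog 2 I.levels + Nat.clog 2 (I.ε.den / I.ε.num.toNat + 1) + I.mu + 5

/-- Rounding `hops` up to a power of two costs a factor of at most `2`; this is why `lgStretch` ends
in `5` where the remaining part of `expo` has `4`. -/
theorem two_pow_expo_le (hn : 0 < n) (hh : 1 ≤ I.h) :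
    2 ^ I.expo ≤ I.hops * 2 ^ I.lgStretch := by
  have h1 := two_pow_clog_le (I.hops_pos hn hh)
  have : I.expo = Nat.clog 2 I.hops + (Nat.clog 2 I.levels +
      Nat.clog 2 (I.ε.den / I.ε.num.toNat + 1) + I.mu + 4) := by
    unfold expo q; ring
  rw [this, lgStretch, pow_add, pow_succ _ (_ + 4)]
  calc _ ≤ 2 * I.hops * 2 ^ (Nat.clog 2 I.levels +
      Nat.clog 2 (I.ε.den / I.ε.num.toNat + 1) + I.mu + 4) := Nat.mul_le_mul_right _ h1
    _ = _ := by ring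

theorem cl_eq_of_alive {ω : ℕ → Bool} {l : ℕ} (hl : l < I.levels) {u v : Fin n}
    (hv : I.Alive ω v) (p : (⊤ : SimpleGraph (Fin n)).Walk u v)
    (hp : mixLen I.G (2 ^ (I.expo + l)) (2 ^ I.levels) p ≤ I.width) :
    I.cl ω l u = I.cl ω l v :=
  carve_eq_carve (I.exists_mem_ball ω l v) (hv l hl)
    (fun _ => (mixDist_le_add_reverse p).trans (Nat.add_le_add_left hp _))
    (fun _ => (mixDist_le_add p).trans (Nat.add_le_add_left hp _))

/-- Two vertices of the tree can only be separated at a level where their distance is large. -/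
theorem lt_of_common_lt {ω : ℕ → Bool} {u v : Fin n} (hv : I.Alive ω v)
    (hc : I.common ω I.levels u v < I.levels) (p : (⊤ : SimpleGraph (Fin n)).Walk u v)
    (hp : p.length ≤ I.hops) :
    I.hops * 2 ^ I.levels <
      2 ^ (I.expo + I.common ω I.levels u v) * (p.edges.map I.G.w).sum := by
  by_contra! h
  refine I.cl_ne_of_common_lt hc (I.cl_eq_of_alive hc hv p ?_)
  unfold mixLen width
  rw [mul_add]
  refine add_le_add h ?_
  rw [mul_comm]
  gcongr

theorem lt_of_common_lt' {ω : ℕ → Bool} {u v : Fin n} (hv : I.Alive ω v)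
    (hc : I.common ω I.levels u v < I.levels) (p : (⊤ : SimpleGraph (Fin n)).Walk u v)
    (hp : p.length ≤ I.hops) :
    I.hops * 2 ^ (I.levels - I.common ω I.levels u v) <
      2 ^ I.expo * (p.edges.map I.G.w).sum := by
  have h := I.lt_of_common_lt hv hc p hp
  rw [pow_add] at h
  have e : 2 ^ I.levels = 2 ^ (I.levels - I.common ω I.levels u v) *
      2 ^ I.common ω I.levels u v := by
    rw [← pow_add]; congr 1; omega
  rw [e] at h
  refine Nat.lt_of_mul_lt_mul_right (a := 2 ^ I.common ω I.levels u v) ?_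
  calc _ = I.hops * (2 ^ (I.levels - I.common ω I.levels u v) *
      2 ^ I.common ω I.levels u v) := by ring
    _ < _ := h
    _ = _ := by ring

theorem card_div_gcoins_le : ((n + 1 : ℕ) : ℝ) / 2 ^ I.gcoins ≤ 1 := by
  rw [div_le_one (by positivity)]
  exact_mod_cast le_pow_clog (n + 1)

/-- The number of coins for a level. -/
def blk : ℕ := (n + 1) * (I.ucoins + I.gcoins)

/-- The levels use disjoint blocks of coins, so the estimate for one sequence of balls applies. The
factor `2` absorbs the truncation errors, since `gcoins` is chosen with `n + 1 ≤ 2 ^ gcoins`. -/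
theorem coinProb_level_le {B l ρ : ℕ} (hB : (l + 1) * I.blk ≤ B) (lo hi : ℕ → ℕ)
    (h : ∀ j, hi j ≤ lo j + ρ) :
    coinProb B (fun ω => ∃ j < n + 1, lo j ≤ I.radius ω l j ∧ I.radius ω l j < hi j ∧
      ∀ i < j, I.radius ω l i < lo i) ≤ 2 * ρ / 2 ^ I.ucoins := by
  have h1 := coinProb_cut_le I.ucoins I.gcoins ρ (n + 1) lo hi h
  have h2 := coinProb_block (a := l * I.blk) (b := I.blk) (B := B) (by rw [← Nat.succ_mul]; exact hB)
    (fun ω => ∃ j < n + 1,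
        lo j ≤ tapeRadius I.ucoins I.gcoins (fun i => ω (j * (I.ucoins + I.gcoins) + i)) ∧
        tapeRadius I.ucoins I.gcoins (fun i => ω (j * (I.ucoins + I.gcoins) + i)) < hi j ∧
        ∀ j' < j, tapeRadius I.ucoins I.gcoins (fun i => ω (j' * (I.ucoins + I.gcoins) + i)) <
          lo j') (by
      rintro ω ω' hω ⟨j, hj, e1, e2, e3⟩
      have key : ∀ k ≤ j, tapeRadius I.ucoins I.gcoins
          (fun i => ω' (k * (I.ucoins + I.gcoins) + i)) =
          tapeRadius I.ucoins I.gcoins (fun i => ω (k * (I.ucoins + I.gcoins) + i)) :=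
        fun k hk => tapeRadius_congr fun i hi => (hω _ (by
          unfold blk
          calc k * (I.ucoins + I.gcoins) + i < (k + 1) * (I.ucoins + I.gcoins) := by
                rw [Nat.succ_mul]; omega
            _ ≤ _ := Nat.mul_le_mul_right _ (by omega))).symm
      refine ⟨j, hj, ?_, ?_, fun j' hj' => ?_⟩
      · rw [key j le_rfl]; exact e1
      · rw [key j le_rfl]; exact e2
      · rw [key j' hj'.le]; exact e3 j' hj')
  refine (h2.le.trans h1).trans ?_
  have h3 := I.card_div_gcoins_le
  have h4 : (0 : ℝ) ≤ ρ / 2 ^ I.ucoins := by positivity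
  calc (ρ : ℝ) / 2 ^ I.ucoins * (1 + ((n + 1 : ℕ) : ℝ) / 2 ^ I.gcoins) ≤ ρ / 2 ^ I.ucoins * (1 + 1) := by
        gcongr
    _ = _ := by ring

/-- The critical interval extends by `width` on both sides of the distance. Truncated subtraction at
its lower end is harmless. -/
theorem coinProb_isCut_le {B l : ℕ} (hB : (l + 1) * I.blk ≤ B) (v : Fin n) :
    coinProb B (fun ω => I.IsCut ω l v) ≤ 4 * I.width / 2 ^ I.ucoins := by
  have := I.coinProb_level_le hB (ρ := 2 * I.width) (fun j => I.lvlDist l (I.ctr j) v - I.width)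
    (fun j => I.lvlDist l (I.ctr j) v + I.width) (fun j => by omega)
  refine (coinProb_mono fun ω h => ?_).trans (this.trans_eq (by push_cast; ring))
  obtain ⟨j, hj, h1, h2, h3⟩ := I.isCut_iff.1 h
  refine ⟨j, hj, by omega, h2, fun i hi => ?_⟩
  by_contra h'
  exact h3 ⟨i, hi, by omega⟩

/-- The critical interval lies between the distances of the two vertices from the center, which
differ by at most the length of any walk joining them. -/
theorem coinProb_cl_ne_le {B l : ℕ} (hB : (l + 1) * I.blk ≤ B) {u v : Fin n}
    (p : (⊤ : SimpleGraph (Fin n)).Walk u v) :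
    coinProb B (fun ω => I.cl ω l u ≠ I.cl ω l v) ≤
      2 * mixLen I.G (2 ^ (I.expo + l)) (2 ^ I.levels) p / 2 ^ I.ucoins := by
  have := I.coinProb_level_le hB (ρ := mixLen I.G (2 ^ (I.expo + l)) (2 ^ I.levels) p)
    (fun j => min (I.lvlDist l (I.ctr j) u) (I.lvlDist l (I.ctr j) v))
    (fun j => max (I.lvlDist l (I.ctr j) u) (I.lvlDist l (I.ctr j) v)) (fun j => by
      have h1 : I.lvlDist l (I.ctr j) u ≤ I.lvlDist l (I.ctr j) v + _ := mixDist_le_add_reverse p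
      have h2 : I.lvlDist l (I.ctr j) v ≤ I.lvlDist l (I.ctr j) u + _ := mixDist_le_add p
      omega)
  refine (coinProb_mono fun ω h => ?_).trans this
  obtain ⟨j, h1, h2, h3⟩ := exists_of_carve_ne (I.exists_mem_ball ω l u) (I.exists_mem_ball ω l v) h
  refine ⟨j, ?_, h1, h2, h3⟩
  by_contra! hj
  have := h3 (u + 1) (by have := u.2; omega)
  simp only [ctr_succ] at this
  rw [show I.lvlDist l u u = 0 from mixDist_self u] at this
  omega

theorem width_div_le : 4 * (I.width : ℝ) / 2 ^ I.ucoins = 8 * I.hops / 2 ^ I.q := by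
  unfold width ucoins
  rw [pow_add]
  push_cast
  rw [div_eq_div_iff (by positivity) (by positivity)]
  ring

/-- Union bound over the levels. The four summands of `q` cancel the factors `hops`, `levels`, `1 /
ε` and `8`. -/
theorem coinProb_not_alive_le {B : ℕ} (hB : I.levels * I.blk ≤ B) (hε : 0 < I.ε) (v : Fin n) :
    coinProb B (fun ω => ¬ I.Alive ω v) ≤ I.ε := by
  have h1 : coinProb B (fun ω => ¬ I.Alive ω v) ≤ I.levels * (8 * I.hops / 2 ^ I.q) := by
    refine (coinProb_mono fun ω h => ?_).trans (coinProb_exists_le (P := fun l ω => I.IsCut ω l v)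
      fun l hl => (I.coinProb_isCut_le (B := B) ?_ v).trans_eq I.width_div_le)
    · unfold Alive at h
      push Not at h
      exact h
    · exact (Nat.mul_le_mul_right _ hl).trans hB
  refine h1.trans ?_
  have hnum : 0 < I.ε.num.toNat := by
    have := Rat.num_pos.2 hε; omega
  have a1 : (I.hops : ℝ) ≤ 2 ^ Nat.clog 2 I.hops := by exact_mod_cast le_pow_clog _
  have a2 : (I.levels : ℝ) ≤ 2 ^ Nat.clog 2 I.levels := by exact_mod_cast le_pow_clog _
  have a3 : ((I.ε.den / I.ε.num.toNat + 1 : ℕ) : ℝ) ≤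
    2 ^ Nat.clog 2 (I.ε.den / I.ε.num.toNat + 1) := by exact_mod_cast le_pow_clog _
  have a4 : 1 ≤ (I.ε : ℝ) * ((I.ε.den / I.ε.num.toNat + 1 : ℕ) : ℝ) := by
    have e : (I.ε : ℝ) = (I.ε.num.toNat : ℝ) / I.ε.den := by
      conv_lhs => rw [Rat.cast_def]
      congr 1
      have : ((I.ε.num.toNat : ℤ) : ℝ) = (I.ε.num : ℝ) := by
        rw [Int.toNat_of_nonneg (Rat.num_pos.2 hε).le]
      exact this.symm.trans (Int.cast_natCast _)
    rw [e, div_mul_eq_mul_div, le_div_iff₀ (by exact_mod_cast I.ε.den_pos), one_mul]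
    have := Nat.lt_mul_div_succ I.ε.den hnum
    exact_mod_cast this.le
  have hεr : (0 : ℝ) < I.ε := by exact_mod_cast hε
  have hq : (2 : ℝ) ^ I.q = 2 ^ Nat.clog 2 I.hops * 2 ^ Nat.clog 2 I.levels *
      2 ^ Nat.clog 2 (I.ε.den / I.ε.num.toNat + 1) * 8 := by
    unfold q; rw [pow_add, pow_add, pow_add]; norm_num
  rw [mul_div_assoc', div_le_iff₀ (by positivity), hq]
  calc (I.levels : ℝ) * (8 * I.hops) ≤ 2 ^ Nat.clog 2 I.levels * (8 * 2 ^ Nat.clog 2 I.hops) * 1 := by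
        rw [mul_one]; gcongr
    _ ≤ 2 ^ Nat.clog 2 I.levels * (8 * 2 ^ Nat.clog 2 I.hops) *
        (I.ε * 2 ^ Nat.clog 2 (I.ε.den / I.ε.num.toNat + 1)) := by
      gcongr
      exact a4.trans (by gcongr)
    _ = _ := by ring

end Input

end HopEmbed

/-! ### Expected stretch and the distribution of the output. -/

namespace HopEmbed

theorem tsum_map_mul {α β : Type*} (p : PMF α) (f : α → β) (F : β → ℝ≥0∞) :
    ∑' b, p.map f b * F b = ∑' a, p a * F (f a) := by
  classical
  simp only [PMF.map_apply, ← ENNReal.tsum_mul_right]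
  rw [ENNReal.tsum_comm]
  refine tsum_congr fun a => ?_
  rw [tsum_eq_single (f a) fun b hb => by rw [if_neg hb, zero_mul], if_pos rfl]

/-- Expectations over the distribution of the output, as averages over the coins. -/
theorem tsum_uniform_map_mul {β : Type*} {B : ℕ} (f : (Fin B → Bool) → β) (F : β → ℝ≥0∞) :
    ∑' b, (PMF.uniformOfFintype (Fin B → Bool)).map f b * F b =
      (∑ ρ : Fin B → Bool, F (f ρ)) / 2 ^ B := by
  rw [tsum_map_mul, tsum_fintype, ENNReal.div_eq_inv_mul, Finset.mul_sum]
  refine Finset.sum_congr rfl fun ρ _ => ?_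
  rw [PMF.uniformOfFintype_apply]
  simp

theorem ofReal_coinAvg {B : ℕ} {g : (ℕ → Bool) → ℝ} (hg : ∀ ω, 0 ≤ g ω) :
    ENNReal.ofReal (coinAvg B g) =
      (∑ ρ : Fin B → Bool, ENNReal.ofReal (g (coinTape ρ))) / 2 ^ B := by
  rw [coinAvg_eq_sum, ENNReal.ofReal_div_of_pos (by positivity),
    ENNReal.ofReal_sum_of_nonneg fun ρ _ => hg _, ENNReal.ofReal_pow (by norm_num)]
  simp

theorem toOuterMeasure_eq {β : Type*} (D : PMF β) (P : β → Prop) [DecidablePred P] :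
    D.toOuterMeasure {b | P b} = ∑' b, D b * (if P b then 1 else 0) := by
  rw [PMF.toOuterMeasure_apply]
  refine tsum_congr fun b => ?_
  rw [Set.indicator_apply]
  by_cases h : P b <;> simp [h]

namespace Input

variable {n : ℕ} (I : Input n)

open Classical in
/-- The bound for the distance in the tree, for two vertices of the tree. -/
noncomputable def cost (ω : ℕ → Bool) (u v : Fin n) : ℝ :=
  if I.Alive ω u ∧ I.Alive ω v then 4 * 2 ^ I.ex ω u v else 0

theorem two_pow_ex {ω : ℕ → Bool} {u v : Fin n} :
    4 * 2 ^ I.ex ω u v = 8 * 2 ^ (I.levels - I.common ω I.levels u v) := by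
  have : I.ex ω u v = I.levels - I.common ω I.levels u v + 1 := by
    have := I.common_le ω I.levels u v
    unfold ex; omega
  rw [this, pow_succ]; ring

/-- The levels, counted from the finest one, that matter for the expected distance. -/
def scales (d : ℕ) : Finset ℕ :=
  (Finset.range I.levels).filter fun c =>
    I.hops * 2 ^ (I.levels - c) < 2 ^ I.expo * d ∧ d < 2 ^ (I.levels - c)

/-- The exponents `levels - c` of these scales lie in a window of length `lgStretch` that begins
just above the binary logarithm of `d`. -/
theorem card_scales_le (hn : 0 < n) (hh : 1 ≤ I.h) (d : ℕ) : (I.scales d).card ≤ I.lgStretch := by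
  have hM := I.two_pow_expo_le hn hh
  have := Finset.card_le_card_of_injOn (s := I.scales d)
    (t := Finset.Ico (Nat.log 2 d + 1) (Nat.log 2 d + 1 + I.lgStretch)) (fun c => I.levels - c)
    (fun c hc => by
      simp only [scales, Finset.coe_filter, Set.mem_ofPred_eq, Finset.mem_range] at hc
      obtain ⟨-, h1, h2⟩ := hc
      have h3 := Nat.lt_pow_succ_log_self (b := 2) (by norm_num) d
      simp only [Finset.coe_Ico, Set.mem_Ico]
      constructor
      · by_contra! h
        have hd : d ≠ 0 := by rintro rfl; simp at h1
        have h4 := Nat.pow_log_le_self 2 hd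
        have : 2 ^ (I.levels - c) ≤ 2 ^ Nat.log 2 d := Nat.pow_le_pow_right (by norm_num) (by omega)
        omega
      · refine (Nat.pow_lt_pow_iff_right (a := 2) (by norm_num)).1 ?_
        refine Nat.lt_of_mul_lt_mul_left (a := I.hops) ?_
        calc I.hops * 2 ^ (I.levels - c) < 2 ^ I.expo * d := h1
          _ ≤ I.hops * 2 ^ I.lgStretch * 2 ^ (Nat.log 2 d + 1) := Nat.mul_le_mul hM h3.le
          _ = _ := by rw [pow_add _ _ I.lgStretch]; ring)
    (fun c hc c' hc' h => by
      simp only [scales, Finset.coe_filter, Set.mem_ofPred_eq, Finset.mem_range] at hc hc'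
      simp only at h
      omega)
  simpa using this

theorem cost_nonneg (ω : ℕ → Bool) (u v : Fin n) : 0 ≤ I.cost ω u v := by
  unfold cost; split_ifs <;> positivity

-- If the scale at which the vertices separate is at most `d`, the first term pays. Otherwise that
-- level belongs to `scales d`: it is coarse by assumption, and it cannot be too coarse because both
-- vertices survive. Never separated vertices fall under the first case, as `1 ≤ d`.
open Classical in
theorem cost_le_sum {ω : ℕ → Bool} {u v : Fin n} (p : (⊤ : SimpleGraph (Fin n)).Walk u v)
    (hp : p.length ≤ I.hops) (hd : 1 ≤ (p.edges.map I.G.w).sum) :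
    I.cost ω u v ≤ 8 * (p.edges.map I.G.w).sum + ∑ c ∈ I.scales (p.edges.map I.G.w).sum,
      (8 * 2 ^ (I.levels - c)) * (if I.cl ω c u ≠ I.cl ω c v then (1 : ℝ) else 0) := by
  set d := (p.edges.map I.G.w).sum
  have hnn : ∀ c ∈ I.scales d, (0 : ℝ) ≤
      (8 * 2 ^ (I.levels - c)) * (if I.cl ω c u ≠ I.cl ω c v then (1 : ℝ) else 0) := fun c _ =>
    mul_nonneg (by positivity) ite_one_zero_nonneg
  have hS := Finset.sum_nonneg hnn
  unfold cost
  split_ifs with hA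
  swap
  · positivity
  have e : (4 * 2 ^ I.ex ω u v : ℝ) = 8 * 2 ^ (I.levels - I.common ω I.levels u v) := by
    exact_mod_cast I.two_pow_ex
  rw [e]
  set c := I.common ω I.levels u v with hcdef
  by_cases h : 2 ^ (I.levels - c) ≤ d
  · have : (2 : ℝ) ^ (I.levels - c) ≤ d := by exact_mod_cast h
    linarith
  · have hc : c < I.levels := by
      by_contra h'
      rw [show I.levels - c = 0 by omega, pow_zero] at h
      omega
    have hmem : c ∈ I.scales d := by
      simp only [scales, Finset.mem_filter, Finset.mem_range]
      exact ⟨hc, I.lt_of_common_lt' hA.2 hc p hp, by omega⟩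
    have h1 := Finset.single_le_sum hnn hmem
    rw [if_pos (I.cl_ne_of_common_lt hc), mul_one] at h1
    have : (0 : ℝ) ≤ 8 * d := by positivity
    linarith

theorem coinAvg_cost_le {B : ℕ} (hB : I.levels * I.blk ≤ B) (hn : 0 < n) (hh : 1 ≤ I.h)
    {u v : Fin n} (p : (⊤ : SimpleGraph (Fin n)).Walk u v)
    (hp : p.length ≤ I.hops) (hd : 1 ≤ (p.edges.map I.G.w).sum) :
    coinAvg B (fun ω => I.cost ω u v) ≤
      (8 + 64 * 2 ^ I.mu * I.lgStretch) * (p.edges.map I.G.w).sum := by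
  classical
  refine (coinAvg_mono fun ω => I.cost_le_sum p hp hd).trans ?_
  rw [coinAvg_add, coinAvg_const, coinAvg_sum, add_mul]
  gcongr
  set d := (p.edges.map I.G.w).sum with hddef
  have hterm : ∀ c ∈ I.scales d, coinAvg B (fun ω => (8 * 2 ^ (I.levels - c)) *
      (if I.cl ω c u ≠ I.cl ω c v then (1 : ℝ) else 0)) ≤ 64 * 2 ^ I.mu * d := by
    intro c hc
    simp only [scales, Finset.mem_filter, Finset.mem_range] at hc
    obtain ⟨hcK, h1, -⟩ := hc
    rw [coinAvg_const_mul]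
    have h2 := I.coinProb_cl_ne_le (B := B) (l := c)
      ((Nat.mul_le_mul_right _ hcK).trans hB) p
    -- At a relevant scale the charge for the hops is dominated by that for the weight.
    have h3 : mixLen I.G (2 ^ (I.expo + c)) (2 ^ I.levels) p ≤ 2 * (2 ^ (I.expo + c) * d) := by
      unfold mixLen
      have : 2 ^ I.levels * p.length ≤ 2 ^ (I.expo + c) * d := by
        calc 2 ^ I.levels * p.length ≤ 2 ^ I.levels * I.hops := by gcongr
          _ = I.hops * 2 ^ (I.levels - c) * 2 ^ c := by
            rw [mul_assoc, ← pow_add, mul_comm]; congr 2; omega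
          _ ≤ 2 ^ I.expo * d * 2 ^ c := Nat.mul_le_mul_right _ h1.le
          _ = _ := by rw [pow_add]; ring
      rw [← hddef]
      omega
    have h3' : (mixLen I.G (2 ^ (I.expo + c)) (2 ^ I.levels) p : ℝ) ≤ 2 * (2 ^ (I.expo + c) * d) := by
      exact_mod_cast h3
    have h4 : coinProb B (fun ω => I.cl ω c u ≠ I.cl ω c v) ≤
        2 * (2 * (2 ^ (I.expo + c) * d)) / 2 ^ I.ucoins := h2.trans (by gcongr)
    have h5 : coinAvg B (fun ω => if I.cl ω c u ≠ I.cl ω c v then (1 : ℝ) else 0) ≤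
        2 * (2 * (2 ^ (I.expo + c) * d)) / 2 ^ I.ucoins := by
      refine le_of_eq_of_le ?_ h4
      refine congrArg (coinAvg B) (funext fun ω => ?_)
      by_cases hcl : I.cl ω c u = I.cl ω c v <;> simp [hcl]
    refine (mul_le_mul_of_nonneg_left h5 (by positivity)).trans_eq ?_
    rw [mul_div_assoc', div_eq_iff (by positivity)]
    -- Tree weight times separation probability does not depend on the level, so all relevant scales
    -- receive the same bound.
    have e : (2 : ℝ) ^ (I.levels - c) * 2 ^ (I.expo + c) = 2 ^ I.ucoins * 2 ^ I.mu * 2 := by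
      rw [← pow_add, ← pow_add, ← pow_succ]
      congr 1
      unfold expo ucoins; omega
    calc (8 : ℝ) * 2 ^ (I.levels - c) * (2 * (2 * (2 ^ (I.expo + c) * d)))
        = 32 * (2 ^ (I.levels - c) * 2 ^ (I.expo + c)) * d := by ring
      _ = _ := by rw [e]; ring
  refine (Finset.sum_le_card_nsmul _ _ _ hterm).trans ?_
  rw [nsmul_eq_mul]
  have : ((I.scales d).card : ℝ) ≤ I.lgStretch := by exact_mod_cast I.card_scales_le hn hh d
  calc ((I.scales d).card : ℝ) * (64 * 2 ^ I.mu * d) ≤ I.lgStretch * (64 * 2 ^ I.mu * d) := by gcongr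
    _ = _ := by ring

end Input

namespace Alg.Final

variable {n : ℕ} {I : Input n} {ω : ℕ → Bool} {s : State} (h : Alg.Final I ω s)

theorem verts_iff (v : Fin n) : v ∈ h.treeData.toEmbedding.verts ↔ I.Alive ω v := Iff.rfl

theorem dist_le_cost {u v : Fin n} (hu : I.Alive ω u) (hv : I.Alive ω v) :
    h.treeData.toEmbedding.dist u v ≤ ENNReal.ofReal (I.cost ω u v) := by
  refine (h.treeData.dist_le hu hv).trans_eq ?_
  rw [Input.cost, if_pos ⟨hu, hv⟩, ← ENNReal.ofReal_natCast]
  push_cast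
  rfl

theorem dist_le_hopDist (hn : 0 < n) (hh : 1 ≤ I.h) {u v : Fin n} (hu : I.Alive ω u)
    (hv : I.Alive ω v) :
    h.treeData.toEmbedding.dist u v ≤ ((8 * 2 ^ I.lgStretch : ℕ) : ℝ≥0∞) * I.G.hopDist I.h u v := by
  by_cases huv : u = v
  · subst huv
    rw [PartialTreeEmbedding.dist_self]
    exact zero_le
  obtain ⟨p, hp, hd, hpos⟩ := I.exists_hopDist_eq hh u v
  refine (h.treeData.dist_le hu hv).trans ?_
  rw [hd, ← Nat.cast_mul]
  refine Nat.cast_le.2 ?_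
  change 4 * 2 ^ I.ex ω u v ≤ _
  rw [I.two_pow_ex, mul_assoc]
  refine Nat.mul_le_mul_left _ ?_
  specialize hpos huv
  by_cases hc : I.common ω I.levels u v < I.levels
  · have h1 := I.lt_of_common_lt' hv hc p hp
    have h2 := I.two_pow_expo_le hn hh
    refine le_of_mul_le_mul_left (a := I.hops) ?_ (I.hops_pos hn hh)
    rw [← mul_assoc]
    exact h1.le.trans (Nat.mul_le_mul_right _ h2)
  -- The vertices are never separated, and it suffices that distinct vertices have distance at least
  -- `1`.
  · rw [show I.levels - I.common ω I.levels u v = 0 by omega, pow_zero]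
    exact Nat.mul_pos (by positivity) hpos

theorem length_toG_le (hn : 0 < n) (hh : 1 ≤ I.h) {u v : Fin n} (hu : I.Alive ω u)
    (hv : I.Alive ω v) (p : h.treeData.toEmbedding.graph.Walk u v) (hp : p.IsPath) :
    (h.treeData.toEmbedding.toG p).length ≤ 2 * (I.levels + 1) * 2 ^ I.lgStretch * I.h := by
  have h1 := h.treeData.length_le_of_isPath (K := I.levels) (I.ex_le ω) hu hv p hp
  have h2 := h.treeData.toEmbedding.length_toG_le (H := 2 ^ I.expo)
    (fun {u v} _ => (h.route_bound u v).2) p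
  have h3 := I.two_pow_expo_le hn hh
  have h4 : I.hops ≤ I.h := by unfold Input.hops; split_ifs <;> omega
  calc _ ≤ p.length * 2 ^ I.expo := h2
    _ ≤ (2 * (I.levels + 1)) * (I.h * 2 ^ I.lgStretch) :=
      Nat.mul_le_mul h1 (h3.trans (Nat.mul_le_mul_right _ h4))
    _ = _ := by ring

theorem isHop (hn : 0 < n) (hh : 1 ≤ I.h) {α β : ℝ} (hα : (8 * 2 ^ I.lgStretch : ℕ) ≤ α)
    (hβ : (2 * (I.levels + 1) * 2 ^ I.lgStretch : ℕ) ≤ β) :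
    h.treeData.toEmbedding.IsHop I.h α β := by
  have one_le : 1 ≤ 2 ^ I.lgStretch := Nat.one_le_two_pow
  have hop : ∀ u ∈ h.treeData.toEmbedding.verts, ∀ v ∈ h.treeData.toEmbedding.verts,
      ∀ p : h.treeData.toEmbedding.graph.Walk u v, p.IsPath →
      ((h.treeData.toEmbedding.toG p).length : ℝ) ≤ β * I.h := fun u hu v hv p hp => by
    have h1 : ((h.treeData.toEmbedding.toG p).length : ℝ) ≤
        ((2 * (I.levels + 1) * 2 ^ I.lgStretch : ℕ) : ℝ) * I.h := by
      exact_mod_cast h.length_toG_le hn hh hu hv p hp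
    exact h1.trans (by gcongr)
  refine ⟨?_, ?_, fun u hu v hv => ?_, fun u hu v hv => ?_, hop⟩
  · refine le_trans ?_ hα
    exact_mod_cast (by omega : 1 ≤ 8 * 2 ^ I.lgStretch)
  · refine le_trans ?_ hβ
    exact_mod_cast Nat.mul_pos (by omega) one_le
  · exact h.treeData.toEmbedding.hopDist_le_dist (hop u hu v hv)
  · refine (h.dist_le_hopDist hn hh hu hv).trans ?_
    gcongr
    rw [← ENNReal.ofReal_natCast]
    exact ENNReal.ofReal_le_ofReal hα

end Alg.Final

/-- The algorithm samples from a distribution with the required properties, up to the sizes of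
the parameters. -/
theorem exists_distribution {n : ℕ} (I : Input n) (hn : 2 ≤ n) (hh : 1 ≤ I.h) (hε : 0 < I.ε)
    {B : ℕ} (hB : I.levels * I.blk ≤ B)
    (hexec : ∀ ω : ℕ → Bool, ∃ t ≤ B,
      Exec Alg.cmd (I.start ω) ((Alg.alg.run (I.start ω)).assign 0 I.r) t) {α β γ : ℝ}
    (hα : (8 * 2 ^ I.lgStretch : ℕ) ≤ α) (hβ : (2 * (I.levels + 1) * 2 ^ I.lgStretch : ℕ) ≤ β)
    (hγ : 8 + 64 * 2 ^ I.mu * I.lgStretch ≤ γ) :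
    ∃ D : PMF (PartialTreeEmbedding I.G), SamplesWithin Alg.cmd I B D ∧
      (∀ T ∈ D.support, T.root = I.r ∧ T.WellSeparated ∧ T.IsHop I.h α β) ∧
      HasExclusionProb D I.ε ∧ HasExpectedStretch D I.h γ := by
  classical
  have hF : ∀ ω, Alg.Final I ω (Alg.alg.run (I.start ω)) := Alg.run_alg I
  set f : (Fin B → Bool) → PartialTreeEmbedding I.G :=
    fun ρ => (hF (coinTape ρ)).treeData.toEmbedding with hf
  refine ⟨(PMF.uniformOfFintype (Fin B → Bool)).map f, ⟨f, fun ρ => ?_, rfl⟩, fun T hT => ?_,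
    fun v => ?_, fun u v => ?_⟩
  · obtain ⟨t, ht, hx⟩ := hexec (coinTape ρ)
    exact ⟨_, t, hx, ht, (hF (coinTape ρ)).outputs (State.assign_arrs _ _ _) (by
      rw [State.assign_vars, if_pos (Eq.refl 0)])⟩
  · rw [PMF.support_map] at hT
    obtain ⟨ρ, -, rfl⟩ := hT
    exact ⟨rfl, (hF (coinTape ρ)).treeData.wellSeparated,
      (hF (coinTape ρ)).isHop (by omega) hh hα hβ⟩
  · rw [toOuterMeasure_eq, tsum_uniform_map_mul]
    have h1 := I.coinProb_not_alive_le hB hε v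
    rw [coinProb_not] at h1
    refine (ENNReal.ofReal_le_ofReal (show 1 - (I.ε : ℝ) ≤ coinProb B fun ω => I.Alive ω v by
      linarith)).trans_eq ?_
    unfold coinProb
    rw [ofReal_coinAvg fun _ => ite_one_zero_nonneg]
    congr 1
    refine Finset.sum_congr rfl fun ρ _ => ?_
    by_cases hA : I.Alive (coinTape ρ) v
    · rw [if_pos hA, if_pos ((hF (coinTape ρ)).verts_iff v |>.2 hA), ENNReal.ofReal_one]
    · rw [if_neg hA, if_neg fun h => hA ((hF (coinTape ρ)).verts_iff v |>.1 h), ENNReal.ofReal_zero]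
  · unfold inducedDist
    rw [tsum_uniform_map_mul f fun T => if u ∈ T.verts ∧ v ∈ T.verts then T.dist u v else 0]
    by_cases huv : u = v
    · subst huv
      simp [PartialTreeEmbedding.dist_self]
    obtain ⟨p, hp, hd, hpos⟩ := I.exists_hopDist_eq hh u v
    have h1 := I.coinAvg_cost_le hB (by omega) hh p hp (hpos huv)
    have h2 : (∑ ρ : Fin B → Bool, (if u ∈ (f ρ).verts ∧ v ∈ (f ρ).verts then (f ρ).dist u v else 0)) /
        2 ^ B ≤ ENNReal.ofReal (coinAvg B fun ω => I.cost ω u v) := by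
      rw [ofReal_coinAvg fun ω => I.cost_nonneg ω u v]
      gcongr with ρ
      split_ifs with h
      · exact (hF (coinTape ρ)).dist_le_cost h.1 h.2
      · exact zero_le
    refine h2.trans ((ENNReal.ofReal_le_ofReal h1).trans ?_)
    rw [hd, ENNReal.ofReal_mul (by positivity), ENNReal.ofReal_natCast]
    gcongr

end HopEmbed

/-! ### Asymptotic size of the parameters. -/

namespace HopEmbed

/-- From `2 ^ clog ≤ 2 * n` one gets `clog * log 2 ≤ 2 * log n`, and `2 / log 2 < 3`. -/
theorem clog_le_three_mul_log {n : ℕ} (hn : 2 ≤ n) : (Nat.clog 2 n : ℝ) ≤ 3 * Real.log n := by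
  have h2 := Real.log_two_gt_d9
  have hn' : (2 : ℝ) ≤ n := by exact_mod_cast hn
  have hlog : Real.log 2 ≤ Real.log n := Real.log_le_log (by norm_num) hn'
  have h1 : (2 : ℝ) ^ Nat.clog 2 n ≤ 2 * n := by exact_mod_cast two_pow_clog_le (by omega : 1 ≤ n)
  have h3 := Real.log_le_log (by positivity) h1
  rw [Real.log_pow, Real.log_mul (by norm_num) (by positivity)] at h3
  have h4 : (0 : ℝ) ≤ Nat.clog 2 n := by positivity
  nlinarith

namespace Input

variable {n : ℕ} (I : Input n)

theorem total_le {a : ℕ} (hw : ∀ e : Sym2 (Fin n), ¬ e.IsDiag → I.G.w e ≤ n ^ a) :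
    I.total ≤ n ^ (a + 2) := by
  have : ∀ k ∈ Finset.range (n * n), I.mat k ≤ n ^ a := by
    intro k hk
    obtain ⟨u, v, rfl, -⟩ := exists_idx (Finset.mem_range.1 hk)
    rw [mat_idx, WGraph.entry]
    split_ifs with h
    · exact Nat.zero_le _
    · exact hw _ (by simpa using h)
  refine (Finset.sum_le_card_nsmul _ _ _ this).trans_eq ?_
  rw [Finset.card_range, smul_eq_mul, pow_add, pow_two]; ring

/-- The sizes of the parameters. -/
theorem params_real {a : ℕ} (hn : 2 ≤ n)
    (hw : ∀ e : Sym2 (Fin n), ¬ e.IsDiag → I.G.w e ≤ n ^ a) :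
    (2 : ℝ) ^ I.mu ≤ 16 * Real.log n ∧ (I.levels : ℝ) ≤ (3 * a + 17) * Real.log n := by
  have hc := clog_le_three_mul_log hn
  have h2 := Real.log_two_gt_d9
  have hlog : Real.log 2 ≤ Real.log n := Real.log_le_log (by norm_num) (by exact_mod_cast hn)
  have hg : I.gcoins ≤ Nat.clog 2 n + 1 := by
    refine Nat.clog_le_of_le_pow ?_
    rw [pow_succ]
    have := le_pow_clog n
    omega
  have hg' : (I.gcoins : ℝ) ≤ Nat.clog 2 n + 1 := by exact_mod_cast hg
  have hmu : (2 : ℝ) ^ I.mu ≤ 2 * (I.gcoins + 2) := by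
    exact_mod_cast two_pow_clog_le (by omega : 1 ≤ I.gcoins + 2)
  have hmu' : (I.mu : ℝ) ≤ I.gcoins + 2 := by exact_mod_cast clog_le_self (I.gcoins + 2)
  have ht : Nat.clog 2 I.total ≤ (a + 2) * Nat.clog 2 n := by
    refine Nat.clog_le_of_le_pow ((I.total_le hw).trans ?_)
    rw [mul_comm, pow_mul]
    exact Nat.pow_le_pow_left (le_pow_clog n) _
  have ht' : (Nat.clog 2 I.total : ℝ) ≤ (a + 2) * Nat.clog 2 n := by exact_mod_cast ht
  have hl : (I.levels : ℝ) = Nat.clog 2 I.total + I.mu + 2 := by unfold levels; push_cast; ring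
  have ha : (0 : ℝ) ≤ a := by positivity
  have hac : (a + 2 : ℝ) * Nat.clog 2 n ≤ (a + 2) * (3 * Real.log n) := by gcongr
  -- Additive constants are absorbed with `log n ≥ log 2`; this is where `16` and `17` come from.
  refine ⟨by linarith, by linarith⟩

/-- The exponent splits into the contributions of `levels`, `1 / ε`, `mu` and the constant `5`. The
rounding losses multiply up to `4096 = 2 * (2 * 2) * 16 * 32`. -/
theorem two_pow_lgStretch_le {a : ℕ} (hn : 2 ≤ n)
    (hw : ∀ e : Sym2 (Fin n), ¬ e.IsDiag → I.G.w e ≤ n ^ a) (hε : 0 < I.ε) (hε' : I.ε < 1 / 3) :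
    (2 : ℝ) ^ I.lgStretch ≤ 4096 * (3 * a + 17) * (Real.log n ^ 2 / I.ε) := by
  obtain ⟨h1, h2⟩ := I.params_real hn hw
  have hlog : 0 < Real.log n := Real.log_pos (by exact_mod_cast (by omega : 1 < n))
  have hεr : (0 : ℝ) < I.ε := by exact_mod_cast hε
  have hεr' : (I.ε : ℝ) < 1 / 3 := by
    have : ((I.ε : ℚ) : ℝ) < ((1 / 3 : ℚ) : ℝ) := by exact_mod_cast hε'
    simpa using this
  have a1 : (2 : ℝ) ^ Nat.clog 2 I.levels ≤ 2 * I.levels := by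
    exact_mod_cast two_pow_clog_le I.levels_pos
  have a2 : (2 : ℝ) ^ Nat.clog 2 (I.ε.den / I.ε.num.toNat + 1) ≤
      2 * ((I.ε.den / I.ε.num.toNat + 1 : ℕ) : ℝ) := by
    exact_mod_cast two_pow_clog_le (Nat.le_add_left 1 (I.ε.den / I.ε.num.toNat))
  have a3 : ((I.ε.den / I.ε.num.toNat + 1 : ℕ) : ℝ) ≤ 2 / I.ε := by
    have e : (I.ε : ℝ) = (I.ε.num.toNat : ℝ) / I.ε.den := by
      conv_lhs => rw [Rat.cast_def]
      congr 1
      have : ((I.ε.num.toNat : ℤ) : ℝ) = (I.ε.num : ℝ) := by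
        rw [Int.toNat_of_nonneg (Rat.num_pos.2 hε).le]
      exact this.symm.trans (Int.cast_natCast _)
    have h3 : ((I.ε.den / I.ε.num.toNat : ℕ) : ℝ) ≤ 1 / I.ε := by
      rw [e, one_div_div]; exact Nat.cast_div_le
    have h4 : (1 : ℝ) ≤ 1 / I.ε := by rw [le_div_iff₀ hεr]; linarith
    push_cast
    calc ((I.ε.den / I.ε.num.toNat : ℕ) : ℝ) + 1 ≤ 1 / I.ε + 1 / I.ε := by gcongr
      _ = _ := by ring
  have e : (2 : ℝ) ^ I.lgStretch = 2 ^ Nat.clog 2 I.levels *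
      2 ^ Nat.clog 2 (I.ε.den / I.ε.num.toNat + 1) * 2 ^ I.mu * 32 := by
    unfold lgStretch; rw [pow_add, pow_add, pow_add]; norm_num
  rw [e]
  calc _ ≤ (2 * ((3 * a + 17) * Real.log n)) * (2 * (2 / I.ε)) * (16 * Real.log n) * 32 := by
        gcongr
        · exact a1.trans (by gcongr)
        · exact a2.trans (by gcongr)
    _ = _ := by field_simp; ring

end Input

/-- The factor of the number of scales. -/
noncomputable def scaleConst (a : ℕ) : ℝ := 2 * (2 * Real.log (4096 * (3 * a + 17)) + 2)

/-- Logarithms are taken in the previous bound, with `x = log n / ε`. The hypothesis `ε < 1 / 3`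
gives `x ≥ 2`, as `3 * log 2 > 2`; hence `log x` is bounded below and absorbs the additive constant.
-/
theorem Input.lgStretch_le {n : ℕ} (I : Input n) {a : ℕ} (hn : 2 ≤ n)
    (hw : ∀ e : Sym2 (Fin n), ¬ e.IsDiag → I.G.w e ≤ n ^ a) (hε : 0 < I.ε) (hε' : I.ε < 1 / 3) :
    1 / 2 ≤ Real.log (Real.log n / I.ε) ∧
    (I.lgStretch : ℝ) ≤ scaleConst a * Real.log (Real.log n / I.ε) := by
  have h := I.two_pow_lgStretch_le hn hw hε hε'
  have h2 := Real.log_two_gt_d9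
  have hlog : Real.log 2 ≤ Real.log n := Real.log_le_log (by norm_num) (by exact_mod_cast hn)
  have hεr : (0 : ℝ) < I.ε := by exact_mod_cast hε
  have hεr' : (I.ε : ℝ) < 1 / 3 := by
    have : ((I.ε : ℚ) : ℝ) < ((1 / 3 : ℚ) : ℝ) := by exact_mod_cast hε'
    simpa using this
  set x := Real.log n / I.ε with hx
  have hx2 : 2 ≤ x := by rw [hx, le_div_iff₀ hεr]; linarith
  have hlx : Real.log 2 ≤ Real.log x := Real.log_le_log (by norm_num) hx2
  have hsq : Real.log n ^ 2 / I.ε ≤ x ^ 2 := by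
    rw [hx, div_pow]
    gcongr
    nlinarith
  have hc : (1 : ℝ) ≤ 4096 * (3 * a + 17) := by
    have : (0 : ℝ) ≤ a := by positivity
    linarith
  have h3 : (2 : ℝ) ^ I.lgStretch ≤ 4096 * (3 * a + 17) * x ^ 2 := h.trans (by gcongr)
  have h4 := Real.log_le_log (by positivity) h3
  rw [Real.log_pow, Real.log_mul (by positivity) (by positivity), Real.log_pow] at h4
  have h5 := Real.log_nonneg hc
  have h6 : (0 : ℝ) ≤ I.lgStretch := by positivity
  refine ⟨by linarith, ?_⟩
  unfold scaleConst
  set y := Real.log (4096 * (3 * a + 17))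
  have h7 : (I.lgStretch : ℝ) * (1 / 2) ≤ I.lgStretch * Real.log 2 := by gcongr; linarith
  have h8 : y * 1 ≤ y * (2 * Real.log x) := by gcongr; linarith
  push_cast at h4
  linarith

end HopEmbed

theorem mainTheorem2 :
    ∃ (alg : HopEmbed.Cmd) (time : Polynomial ℕ), ∀ a : ℕ, ∃ C : ℝ, 0 < C ∧
      ∀ (n : ℕ) (I : HopEmbed.Input n), 2 ≤ n →
        (∀ e : Sym2 (Fin n), ¬ e.IsDiag → I.G.w e ≤ n ^ a) →
        1 ≤ I.h → 0 < I.ε → I.ε < 1 / 3 →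
        ∃ D : PMF (HopEmbed.PartialTreeEmbedding I.G),
          HopEmbed.SamplesWithin alg I (time.eval I.size) D ∧
          (∀ T ∈ D.support, T.root = I.r ∧ T.WellSeparated ∧
            T.IsHop I.h (C * (Real.log n ^ 2 / I.ε)) (C * (Real.log n ^ 3 / I.ε))) ∧
          HopEmbed.HasExclusionProb D I.ε ∧
          HopEmbed.HasExpectedStretch D I.h
            (C * (Real.log n * Real.log (Real.log n / I.ε))) := by
  obtain ⟨time, htime⟩ := HopEmbed.Alg.exists_time
  refine ⟨HopEmbed.Alg.cmd, time, fun a => ?_⟩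
  have hs : 0 ≤ HopEmbed.scaleConst a := by
    have := Real.log_nonneg (show (1 : ℝ) ≤ 4096 * (3 * a + 17) by
      have : (0 : ℝ) ≤ a := by positivity
      linarith)
    unfold HopEmbed.scaleConst
    linarith
  set c : ℝ := 4096 * (3 * a + 17) with hc
  have hc0 : 0 < c := by positivity
  -- The three summands are the constants for the worst-case stretch, the hop stretch and the
  -- expected stretch; each bound discards the other two.
  refine ⟨8 * c + 2 * (3 * a + 19) * c + (32 + 1024 * HopEmbed.scaleConst a), by positivity,
    fun n I hn hw hh hε hε' => ?_⟩
  obtain ⟨hB, hexec⟩ := htime n I hn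
  obtain ⟨hmu, hK⟩ := I.params_real hn hw
  have hM := I.two_pow_lgStretch_le hn hw hε hε'
  obtain ⟨hx, hlg⟩ := I.lgStretch_le hn hw hε hε'
  have h2 := Real.log_two_gt_d9
  have hlog : Real.log 2 ≤ Real.log n := Real.log_le_log (by norm_num) (by exact_mod_cast hn)
  have hεr : (0 : ℝ) < I.ε := by exact_mod_cast hε
  rw [← hc] at hM
  set y := Real.log (Real.log n / I.ε)
  have hL : 0 < Real.log n := by linarith
  have hL2 : 0 ≤ Real.log n ^ 2 / I.ε := by positivity
  have hL3 : 0 ≤ Real.log n ^ 3 / I.ε := by positivity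
  refine HopEmbed.exists_distribution I hn hh hε hB hexec ?_ ?_ ?_
  · push_cast
    calc 8 * (2 : ℝ) ^ I.lgStretch ≤ 8 * (c * (Real.log n ^ 2 / I.ε)) := by gcongr
      _ = (8 * c) * (Real.log n ^ 2 / I.ε) := by ring
      _ ≤ _ := by
        refine mul_le_mul_of_nonneg_right ?_ hL2
        have : 0 ≤ 2 * (3 * (a : ℝ) + 19) * c := by positivity
        linarith
  · push_cast
    calc 2 * ((I.levels : ℝ) + 1) * 2 ^ I.lgStretch
        ≤ 2 * ((3 * a + 19) * Real.log n) * (c * (Real.log n ^ 2 / I.ε)) := by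
          gcongr; linarith
      _ = (2 * (3 * a + 19) * c) * (Real.log n ^ 3 / I.ε) := by ring
      _ ≤ _ := by
        refine mul_le_mul_of_nonneg_right ?_ hL3
        have : 0 ≤ 8 * c := by positivity
        linarith
  -- Both logarithms are at least `1 / 2`, so the additive `8` is absorbed into the product.
  · have h1 : (1 : ℝ) ≤ 4 * (Real.log n * y) := by nlinarith
    calc 8 + 64 * (2 : ℝ) ^ I.mu * I.lgStretch
        ≤ 8 * (4 * (Real.log n * y)) + 64 * (16 * Real.log n) * (HopEmbed.scaleConst a * y) := by
          gcongr; linarith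
      _ = (32 + 1024 * HopEmbed.scaleConst a) * (Real.log n * y) := by ring
      _ ≤ _ := by
        refine mul_le_mul_of_nonneg_right ?_ (by positivity)
        have : 0 ≤ 8 * c + 2 * (3 * (a : ℝ) + 19) * c := by positivity
        linarith
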